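/- **Setting.** Fix integers $n\ge 2$ and $2\le m\le m_v$. For $j\in\mathbb Z$ let $Y_j$ be a face-to-face tiling of $\mathbb R^n$ by translates of $[0,m^{-j}]\times[0,m_v^{-j}]^{n-1}$, such that $Y_{j+1}$ subdivides $Y_j$ for every $j$. A cell of $Y_j$ is *vertical* if it lies in a hyperplane on which the first coordinate $x$ is constant. Let $G_j$ be the group of isometries $\mathrm{id}_{\mathbb R}\times h$ of $\mathbb R^n$ ($h$ an isometry of $\mathbb R^{n-1}$) that preserve the cell structure of $Y_j$. An *admissible direct system* with constants $\Delta,H\in\mathbb N$ consists of a direct system of cell (CW) complexes $\cdots\to X_j\xrightarrow{\pi_j}X_{j+1}\to\cdots$ ($j\in\mathbb Z$), continuous functions $x_j:X_j\to\mathbb R$, Radon measures $\mu_j$ on $X_j$, and, for each cell $\sigma$ of $X_j$, a nonempty set $\Phi_\sigma$ of distinguished characteristic maps $\phi:\hat\sigma\to\sigma$, with $\hat\sigma$ a cell of $Y_j$, such that for all $j$ (cells are closed unless called open; cells are *adjacent* if they intersect; a cell of $X_j$ is vertical if it is the image of a vertical cell under a distinguished characteristic map; $X_j^{(k)}$ denotes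 the subdivision of $X_j$ obtained by restricting distinguished characteristic maps to cells of $Y_{j+k}$): 1. $X_j$ is connected and is the union of its $n$-cells, and every cell is properly contained in at most $\Delta$ cells. 2. (a) Two elements $\hat\sigma_0\to\sigma$, $\hat\sigma_1\to\sigma$ of $\Phi_\sigma$ agree up to precomposition with some $g\in G_j$ with $g(\hat\sigma_0)=\hat\sigma_1$. (b) Restrictions of distinguished characteristic maps to faces are distinguished characteristic maps. (c) If $\phi:\hat\sigma\to\sigma$ is a distinguished characteristic map of $X_j$ and $\hat\sigma'\subset\hat\sigma$ is a cell of $Y_{j+1}$, then $\pi_j\circ\phi|_{\hat\sigma'}$ is a distinguished characteristic map of a cell of $X_{j+1}$, and all distinguished characteristic maps of $X_{j+1}$ arise in this way. (d) $x_j\circ\phi=x$ for every distinguished characteristic map $\phi$ of $X_j$. 3. $\pi_j:X_j^{(1)}\to X_{j+1}$ is a surjective cellular map. 4. Any two points of $X_j$ that $\pi_j$ maps to the same $0$-cell of $X_{j+1}$ are joined by a path of at most $H$ vertical $1$-cells of $X_j^{(1)}$. 5. Any two adjacent $n$-cells of $X_j$ are joined by a horizontal gallery of at most $\Delta$ cells,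 i.e. a sequence of $n$-cells such that the intersection of any two consecutive ones contains a vertical $(n-1)$-cell. 6. $(\pi_j)_\#\mu_j=\mu_{j+1}$; for every $n$-cell $\sigma$ of $X_j$ and $\phi\in\Phi_\sigma$, the restriction of $\mu_j$ to $\sigma$ is $w_\sigma$ times the pushforward of Lebesgue measure under $\phi$, for a constant $w_\sigma\in(0,\infty)$; and $w_\sigma\le\Delta\, w_{\sigma'}$ for adjacent $n$-cells $\sigma,\sigma'$. **Metrics.** Let $X_\infty$ be the direct limit of the sets $X_j$, let $\hat d_\infty$ be the largest pseudodistance on $X_\infty$ such that for every $j$ the image in $X_\infty$ of every cell of $X_j$ has diameter at most $m^{-j}$, let $(\bar X_\infty,\bar d_\infty)$ be the metric space obtained by identifying points at $\hat d_\infty$-distance $0$, and let $\bar\pi_j^\infty:X_j\to\bar X_\infty$ be the projection. Let $\hat d_j$ be the largest pseudodistance on $X_j$ such that for all $i\le j$ the image in $X_j$ of every cell of $X_i$ has diameter at most $m^{-i}$, and let $d_j$ be the largest pseudodistance on $X_j$ with $d_j\le\hat d_j$ and such that for all $k\ge 0$ every cell of $X_j^{(k)}$ has $d_j$-diameter at most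 $m^{-(j+k)}$. **Definitions.** A Lipschitz map $f:X\to Y$ is *Lipschitz light* if for some $C$ and every bounded $W\subset Y$ the $\operatorname{diam}(W)$-components of $f^{-1}(W)$ have diameter at most $C\operatorname{diam}(W)$; here the $\delta$-component of $p$ in $A$ is the set of points reached from $p$ by finite sequences in $A$ with steps of size at most $\delta$. It is *David–Semmes regular* if for some $C$ the inverse image of every ball of radius $r$ is covered by at most $C$ balls of radius $Cr$. A metric space is *Ahlfors $Q$-regular* if $C^{-1}r^Q\le\mathcal H^Q(B(p,r))\le C r^Q$ for some $C$ and all $p$ and $0<r\le$ the diameter of the space. Metric spaces are *uniformly totally disconnected* (uniformly of Assouad–Nagata dimension $0$) if for some $c$, for each of the spaces and each $r>0$, there is a cover by sets of diameter at most $cr$ such that each ball of radius $r$ meets at most one of them. **Theorem.** For every $n\ge2$, $m\ge2$ and $H$ there is $\underline{m_v}=\underline{m_v}(n,m,H)$ such that for all $m_v\ge\max(m,\underline{m_v})$ and every admissible direct system with constants $\Delta,H$, the following holds, with constants that depend only on $n,m,m_v,H,\Delta$. The pseudodistance $\hat d_\infty$ takes finite values, and for every $j\in\mathbb Z$: 1.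 $(X_j,d_j,\mu_j)$ is a doubling metric measure space: $d_j$ is a metric, $\mu_j$ is a measure on its Borel sets, and balls satisfy $0<\mu_j(B(p,2r))\le C\mu_j(B(p,r))<\infty$ for $r>0$. 2. $\bar\pi_j^\infty:(X_j,d_j)\to(\bar X_\infty,\bar d_\infty)$ is Lipschitz light, and its point inverses are uniformly totally disconnected. 3. Let $Q=1+\frac{(n-1)\log m_v}{\log m}$. If for every $i\in\mathbb Z$ the inverse image under $\pi_i$ of every open $n$-cell of $X_{i+1}$ is a single open $n$-cell of $X_i^{(1)}$, then $(X_j,d_j)$ is Ahlfors $Q$-regular and $\bar\pi_j^\infty:(X_j,d_j)\to(\bar X_\infty,\bar d_\infty)$ is David–Semmes regular. -/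

import Mathlib

open Set MeasureTheory
open scoped ENNReal NNReal

universe u

namespace Admissible

/-! ### Metric notions -/

section Metric

/-- `ρ` is an (extended) pseudodistance on `X`. -/
structure IsPseudoDist {X : Type*} (ρ : X → X → ℝ≥0∞) : Prop where
  self : ∀ x, ρ x x = 0
  comm : ∀ x y, ρ x y = ρ y x
  triangle : ∀ x y z, ρ x z ≤ ρ x y + ρ y z

/-- The pointwise supremum of all pseudodistances with property `P`. When `P` is a family of
upper bounds (as it always is below), this is the largest pseudodistance with property `P`. -/
noncomputable def largestPseudoDist {X : Type*} (P : (X → X → ℝ≥0∞) → Prop) (x y : X) : ℝ≥0∞ :=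
  ⨆ ρ : {ρ : X → X → ℝ≥0∞ // IsPseudoDist ρ ∧ P ρ}, ρ.1 x y

theorem isPseudoDist_largestPseudoDist {X : Type*} (P : (X → X → ℝ≥0∞) → Prop) :
    IsPseudoDist (largestPseudoDist P) where
  self x := by
    simp only [largestPseudoDist, ENNReal.iSup_eq_zero]
    exact fun ρ => ρ.2.1.self x
  comm x y := by
    unfold largestPseudoDist
    exact iSup_congr fun ρ => ρ.2.1.comm x y
  triangle x y z := by
    unfold largestPseudoDist
    refine iSup_le fun ρ => (ρ.2.1.triangle x y z).trans ?_
    exact add_le_add (le_iSup (fun ρ : {ρ : X → X → ℝ≥0∞ // IsPseudoDist ρ ∧ P ρ} => ρ.1 x y) ρ)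
      (le_iSup (fun ρ : {ρ : X → X → ℝ≥0∞ // IsPseudoDist ρ ∧ P ρ} => ρ.1 y z) ρ)

/-- The pseudometric space structure defined by `largestPseudoDist P`. -/
@[reducible] noncomputable def largestPseudoEMetric {X : Type*} (P : (X → X → ℝ≥0∞) → Prop) :
    PseudoEMetricSpace X where
  edist := largestPseudoDist P
  edist_self := (isPseudoDist_largestPseudoDist P).self
  edist_comm := (isPseudoDist_largestPseudoDist P).comm
  edist_triangle := (isPseudoDist_largestPseudoDist P).triangle

/-- `(X, d, μ)` is a doubling metric measure space with doubling constant `C`: `d` is a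
(finite, point separating) metric, `μ` is a measure on its Borel sets, balls have positive and
finite measure, and doubling the radius of a ball increases its measure at most `C`-fold. -/
structure IsDoublingMetricMeasureSpace (X : Type*) [PseudoEMetricSpace X] [MeasurableSpace X]
    (μ : Measure X) (C : ℝ≥0) : Prop where
  edist_ne_top : ∀ x y : X, edist x y ≠ ⊤
  eq_of_edist_eq_zero : ∀ x y : X, edist x y = 0 → x = y
  borel : BorelSpace X
  ball_pos : ∀ (x : X) (r : ℝ≥0), 0 < r → 0 < μ (Metric.eball x r)
  ball_lt_top : ∀ (x : X) (r : ℝ≥0), μ (Metric.eball x r) < ⊤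
  doubling : ∀ (x : X) (r : ℝ≥0), μ (Metric.eball x (2 * r)) ≤ C * μ (Metric.eball x r)

/-- `y` lies in the `δ`-component of `x` in `A`: there is a finite sequence of points of `A`
from `x` to `y` with steps of size at most `δ`. -/
def InSameComponent {X : Type*} [PseudoEMetricSpace X] (δ : ℝ≥0∞) (A : Set X) (x y : X) : Prop :=
  x ∈ A ∧ Relation.ReflTransGen (fun p q => p ∈ A ∧ q ∈ A ∧ edist p q ≤ δ) x y

/-- `f` is `C`-Lipschitz, and for every bounded `W`, the `diam W`-components of `f ⁻¹' W` have
diameter at most `C * diam W`. -/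
structure IsLipschitzLight {X Y : Type*} [PseudoEMetricSpace X] [PseudoEMetricSpace Y]
    (f : X → Y) (C : ℝ≥0) : Prop where
  lipschitz : LipschitzWith C f
  light : ∀ W : Set Y, Metric.ediam W ≠ ⊤ → ∀ x,
    Metric.ediam {y | InSameComponent (Metric.ediam W) (f ⁻¹' W) x y} ≤ C * Metric.ediam W

/-- The metric space `F` (a subset of `X` with the restricted metric) satisfies the condition in
the definition of "Assouad-Nagata dimension at most `k`" with constant `c`: for every `r > 0`
it has a `c r`-bounded cover such that every ball of radius `r` in `F` meets at most `k + 1` of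
the elements of the cover. -/
def AssouadNagataLE {X : Type*} [PseudoEMetricSpace X] (F : Set X) (k : ℕ) (c : ℝ≥0) : Prop :=
  ∀ r : ℝ≥0, 0 < r → ∃ U : Set (Set X),
    (∀ A ∈ U, A ⊆ F) ∧ F ⊆ ⋃₀ U ∧ (∀ A ∈ U, Metric.ediam A ≤ c * r) ∧
    ∀ x ∈ F, {A | A ∈ U ∧ (A ∩ Metric.eball x r).Nonempty}.encard ≤ k + 1

/-- The metric space `X` is Ahlfors `Q`-regular with constant `C`: its `Q`-dimensional Hausdorff
measure satisfies `C⁻¹ r ^ Q ≤ H^Q (B (x, r)) ≤ C r ^ Q` for all `x` and `0 < r ≤ diam X`. -/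
def IsAhlforsRegular (X : Type*) [PseudoEMetricSpace X] (Q : ℝ) (C : ℝ≥0) : Prop :=
  ∃ h : ∀ {x y : X}, edist x y = 0 → x = y,
    letI : EMetricSpace X := { ‹PseudoEMetricSpace X› with eq_of_edist_eq_zero := h }
    letI : MeasurableSpace X := borel X
    haveI : BorelSpace X := ⟨rfl⟩
    ∀ (x : X) (r : ℝ≥0), 0 < r → (r : ℝ≥0∞) ≤ Metric.ediam (univ : Set X) →
      (r : ℝ≥0∞) ^ Q ≤ C * Measure.hausdorffMeasure Q (Metric.closedEBall x r) ∧
      Measure.hausdorffMeasure Q (Metric.closedEBall x r) ≤ C * (r : ℝ≥0∞) ^ Q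

/-- `f` is `C`-Lipschitz and the inverse image of every ball of radius `r` can be covered by at
most `C` balls of radius `C r`. -/
structure IsDavidSemmesRegular {X Y : Type*} [PseudoEMetricSpace X] [PseudoEMetricSpace Y]
    (f : X → Y) (C : ℝ≥0) : Prop where
  lipschitz : LipschitzWith C f
  cover : ∀ (y : Y) (r : ℝ≥0), 0 < r → ∃ t : Finset X, (t.card : ℝ≥0) ≤ C ∧
    f ⁻¹' Metric.eball y r ⊆ ⋃ x ∈ t, Metric.eball x (C * r)

end Metric

/-! ### The tilings `Y j` of `ℝⁿ` -/

/-- The number `m ^ (-j)`, the size assigned to the cells of generation `j`. -/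
noncomputable def size (m : ℕ) (j : ℤ) : ℝ≥0∞ := ENNReal.ofReal ((m : ℝ) ^ (-j))

/-- Side lengths of the tiles of generation `j`: `m ^ (-j)` in the direction of the first
coordinate (number `0`), `mv ^ (-j)` in the directions of the others. -/
noncomputable def side {n : ℕ} [NeZero n] (m mv : ℕ) (j : ℤ) (i : Fin n) : ℝ :=
  if i = 0 then (m : ℝ) ^ (-j) else (mv : ℝ) ^ (-j)

/-- A nested family of (face-to-face) tilings `Y j`, `j ∈ ℤ`, of `ℝⁿ` by translates of
`[0, m ^ (-j)] × [0, mv ^ (-j)] ^ (n - 1)`. The set of vertices of `Y j` is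
`origin j + m ^ (-j) ℤ × (mv ^ (-j) ℤ) ^ (n - 1)`, and `refine` says that `Y (j + 1)` is a
subdivision of `Y j`. -/
structure Tilings (n m mv : ℕ) [NeZero n] where
  origin : ℤ → Fin n → ℝ
  refine : ∀ j i, ∃ k : ℤ, origin j i = origin (j + 1) i + k * side m mv (j + 1) i

/-- Combinatorial name of a cell of `Y j`: its lower corner is the vertex with number `corner`, and
it extends for one side length in each of the directions in `dirs`. Its dimension is
`dirs.card`. -/
structure GridCell (n : ℕ) where
  corner : Fin n → ℤ
  dirs : Finset (Fin n)

/-- A characteristic map: a cell of a tiling with a map from it to `X`. The map is extended to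
`ℝⁿ` by irrelevant values. -/
structure CharMap (n : ℕ) (X : Type u) where
  cell : GridCell n
  toFun : EuclideanSpace ℝ (Fin n) → X

/-- A cell is vertical if it does not extend in the direction of the first coordinate. -/
def GridCell.IsVertical {n : ℕ} [NeZero n] (c : GridCell n) : Prop := 0 ∉ c.dirs

namespace Tilings

variable {n m mv : ℕ} [NeZero n] (Y : Tilings n m mv)

/-- Lower corner of a cell of `Y j`. -/
noncomputable def lo (j : ℤ) (c : GridCell n) (i : Fin n) : ℝ :=
  Y.origin j i + c.corner i * side m mv j i

/-- The closed cell of `Y j` named `c`. -/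
def closedCell (j : ℤ) (c : GridCell n) : Set (EuclideanSpace ℝ (Fin n)) :=
  {p | ∀ i, (i ∈ c.dirs → Y.lo j c i ≤ p i ∧ p i ≤ Y.lo j c i + side m mv j i) ∧
    (i ∉ c.dirs → p i = Y.lo j c i)}

/-- The open cell of `Y j` named `c` (the relative interior of the closed cell). -/
def openCell (j : ℤ) (c : GridCell n) : Set (EuclideanSpace ℝ (Fin n)) :=
  {p | ∀ i, (i ∈ c.dirs → Y.lo j c i < p i ∧ p i < Y.lo j c i + side m mv j i) ∧
    (i ∉ c.dirs → p i = Y.lo j c i)}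

/-- The group `G j` of the isometries of `ℝⁿ` of the form `id × h`, with `h` an isometry of
`ℝ ^ (n - 1)`, that preserve the cell structure of `Y j`. -/
def G (j : ℤ) : Set (EuclideanSpace ℝ (Fin n) ≃ᵢ EuclideanSpace ℝ (Fin n)) :=
  {g | (∀ p, g p 0 = p 0) ∧
    (∀ p q, (∀ i, i ≠ 0 → p i = q i) → ∀ i, i ≠ 0 → g p i = g q i) ∧
    ∀ A : Set (EuclideanSpace ℝ (Fin n)),
      (∃ c, A = Y.closedCell j c) ↔ ∃ c, g '' A = Y.closedCell j c}

/-- The open cell of `X` with characteristic map `φ`, defined on a cell of `Y j`. -/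
def openImage {X : Type u} (j : ℤ) (φ : CharMap n X) : Set X := φ.toFun '' Y.openCell j φ.cell

/-- The closed cell of `X` with characteristic map `φ`, defined on a cell of `Y j`. -/
def closedImage {X : Type u} (j : ℤ) (φ : CharMap n X) : Set X :=
  φ.toFun '' Y.closedCell j φ.cell

/-- The family `Φ` of maps defined on cells of `Y j` consists of characteristic maps for the cells
of a CW complex structure on `X`, with at least one map in `Φ` for each cell. The cells of `X`
are thus represented by the sets `Y.openImage j φ`, `φ ∈ Φ`, and the collection of
characteristic maps of the cell `σ` is `{φ ∈ Φ | Y.openImage j φ = σ}`. -/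
structure IsCellComplex (j : ℤ) {X : Type u} [TopologicalSpace X] (Φ : Set (CharMap n X)) :
    Prop where
  t2 : T2Space X
  continuousOn : ∀ φ ∈ Φ, ContinuousOn φ.toFun (Y.closedCell j φ.cell)
  injOn : ∀ φ ∈ Φ, InjOn φ.toFun (Y.openCell j φ.cell)
  cover : ∀ p : X, ∃ φ ∈ Φ, p ∈ Y.openImage j φ
  partition : ∀ φ ∈ Φ, ∀ ψ ∈ Φ,
    (Y.openImage j φ = Y.openImage j ψ ∧ φ.cell.dirs.card = ψ.cell.dirs.card) ∨
      Disjoint (Y.openImage j φ) (Y.openImage j ψ)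
  closure_finite : ∀ φ ∈ Φ, ∃ t : Set (CharMap n X), t.Finite ∧ t ⊆ Φ ∧
    (∀ ψ ∈ t, ψ.cell.dirs.card < φ.cell.dirs.card) ∧
    φ.toFun '' (Y.closedCell j φ.cell \ Y.openCell j φ.cell) ⊆ ⋃ ψ ∈ t, Y.closedImage j ψ
  weak_topology : ∀ A : Set X,
    (∀ φ ∈ Φ, IsClosed (Y.closedCell j φ.cell ∩ φ.toFun ⁻¹' A)) → IsClosed A

/-- The `k`-skeleton of the complex with characteristic maps `Φ`. -/
def skeleton (j : ℤ) {X : Type u} (Φ : Set (CharMap n X)) (k : ℕ) : Set X :=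
  ⋃ φ ∈ {φ ∈ Φ | φ.cell.dirs.card ≤ k}, Y.closedImage j φ

/-- `p` is a `0`-cell of the complex with characteristic maps `Φ`. -/
def IsVertex (j : ℤ) {X : Type u} (Φ : Set (CharMap n X)) (p : X) : Prop :=
  ∃ φ ∈ Φ, φ.cell.dirs = ∅ ∧ p ∈ Y.closedImage j φ

/-- There is a vertical edge path of combinatorial length at most `L` from `p` to `q` in the
complex with characteristic maps `Φ`: a sequence of at most `L + 1` vertices in which any two
consecutive ones lie in a vertical `1`-cell. -/
def VerticalEdgePath (j : ℤ) {X : Type u} (Φ : Set (CharMap n X)) (L : ℕ) (p q : X) : Prop :=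
  ∃ l ≤ L, ∃ w : ℕ → X, w 0 = p ∧ w l = q ∧ (∀ i ≤ l, Y.IsVertex j Φ (w i)) ∧
    ∀ i < l, ∃ e ∈ Φ, e.cell.dirs.card = 1 ∧ e.cell.IsVertical ∧
      w i ∈ Y.closedImage j e ∧ w (i + 1) ∈ Y.closedImage j e

/-- There is a horizontal gallery of at most `L` cells from the `n`-cell of `φ` to the `n`-cell of
`ψ` in the complex with characteristic maps `Φ`: a sequence of `n`-cells in which the intersection
of any two consecutive ones contains a vertical `(n - 1)`-cell. -/
def HorizontalGallery (j : ℤ) {X : Type u} (Φ : Set (CharMap n X)) (L : ℕ) (φ ψ : CharMap n X) :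
    Prop :=
  ∃ l < L, ∃ γ : ℕ → CharMap n X,
    Y.openImage j (γ 0) = Y.openImage j φ ∧ Y.openImage j (γ l) = Y.openImage j ψ ∧
    (∀ i ≤ l, γ i ∈ Φ ∧ (γ i).cell.dirs = Finset.univ) ∧
    ∀ i < l, ∃ e ∈ Φ, e.cell.dirs.card = n - 1 ∧ e.cell.IsVertical ∧
      Y.closedImage j e ⊆ Y.closedImage j (γ i) ∩ Y.closedImage j (γ (i + 1))

end Tilings

/-! ### Direct systems of cell complexes -/

/-- The data of a direct system, indexed by the integers, of spaces `X j` with functions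
`x j : X j → ℝ`, measures `μ j` and distinguished characteristic maps `Φ j` defined on cells of
`Y j`. -/
structure System (n m mv : ℕ) [NeZero n] where
  Y : Tilings n m mv
  X : ℤ → Type u
  [topology : ∀ j, TopologicalSpace (X j)]
  [measurable : ∀ j, MeasurableSpace (X j)]
  π : ∀ i j : ℤ, i ≤ j → C(X i, X j)
  [directed : DirectedSystem X (π · · ·)]
  x : ∀ j, C(X j, ℝ)
  Φ : ∀ j, Set (CharMap n (X j))
  μ : ∀ j, Measure (X j)

namespace System

attribute [instance] System.topology System.measurable System.directed

variable {n m mv : ℕ} [NeZero n] (S : System.{u} n m mv)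

/-- The map `π j : X j → X (j + 1)`. -/
def next (j : ℤ) : C(S.X j, S.X (j + 1)) := S.π j (j + 1) (by lia)

/-- The characteristic maps of the iterated subdivision `X j ^ (k)`: the restrictions of the
distinguished characteristic maps of `X j` to cells of `Y (j + k)`. -/
def sub (j : ℤ) (k : ℕ) : Set (CharMap n (S.X j)) :=
  {ψ | ∃ φ ∈ S.Φ j, S.Y.closedCell (j + k) ψ.cell ⊆ S.Y.closedCell j φ.cell ∧
    ψ.toFun = φ.toFun}

/-- The distinguished characteristic maps of the `n`-cells of `X j`. -/
def topMaps (j : ℤ) : Set (CharMap n (S.X j)) := {φ ∈ S.Φ j | φ.cell.dirs = Finset.univ}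

/-- The cells (in `X j`) with characteristic maps `φ`, `ψ` are adjacent, i.e. they intersect. -/
def Adjacent (j : ℤ) (φ ψ : CharMap n (S.X j)) : Prop :=
  (S.Y.closedImage j φ ∩ S.Y.closedImage j ψ).Nonempty

/-- On the (closed) cell with characteristic map `φ`, the measure `μ j` is `w` times the
pushforward of Lebesgue measure under `φ`. -/
def IsWeight (j : ℤ) (φ : CharMap n (S.X j)) (w : ℝ≥0) : Prop :=
  (S.μ j).restrict (S.Y.closedImage j φ) =
    w • (volume.restrict (S.Y.closedCell j φ.cell)).map φ.toFun

/-- Admissible direct systems with constants `Δ`, `H`. -/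
structure IsAdmissible (Δ H : ℕ) : Prop where
  complex : ∀ j, S.Y.IsCellComplex j (S.Φ j)
  borel : ∀ j, BorelSpace (S.X j)
  radon : ∀ j, (S.μ j).Regular
  /-- each `X j` is connected -/
  connected : ∀ j, ConnectedSpace (S.X j)
  /-- each `X j` is the union of its closed `n`-cells -/
  union_topCells : ∀ j (p : S.X j), ∃ φ ∈ S.topMaps j, p ∈ S.Y.closedImage j φ
  /-- links (the cells properly containing a given cell) have cardinality at most `Δ` -/
  link : ∀ j, ∀ φ ∈ S.Φ j,
    {B | B ≠ S.Y.openImage j φ ∧ ∃ ψ ∈ S.Φ j, B = S.Y.openImage j ψ ∧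
      S.Y.openImage j φ ⊆ S.Y.closedImage j ψ}.encard ≤ Δ
  /-- compatibility with `G j` -/
  compat_group : ∀ j, ∀ φ ∈ S.Φ j, ∀ ψ ∈ S.Φ j, S.Y.openImage j φ = S.Y.openImage j ψ →
    ∃ g ∈ S.Y.G j, g '' S.Y.closedCell j φ.cell = S.Y.closedCell j ψ.cell ∧
      EqOn φ.toFun (ψ.toFun ∘ g) (S.Y.closedCell j φ.cell)
  /-- compatibility with face restrictions -/
  compat_face : ∀ j, ∀ φ ∈ S.Φ j, ∀ c : GridCell n,
    S.Y.closedCell j c ⊆ S.Y.closedCell j φ.cell → ⟨c, φ.toFun⟩ ∈ S.Φ j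
  /-- compatibility with subdivision -/
  compat_subdiv : ∀ j, ∀ φ ∈ S.Φ j, ∀ c : GridCell n,
    S.Y.closedCell (j + 1) c ⊆ S.Y.closedCell j φ.cell →
      ⟨c, S.next j ∘ φ.toFun⟩ ∈ S.Φ (j + 1)
  /-- all characteristic maps of `X (j + 1)` come from subdivision -/
  compat_subdiv_surj : ∀ j, ∀ ψ ∈ S.Φ (j + 1), ∃ φ ∈ S.Φ j,
    S.Y.closedCell (j + 1) ψ.cell ⊆ S.Y.closedCell j φ.cell ∧
      EqOn ψ.toFun (S.next j ∘ φ.toFun) (S.Y.closedCell (j + 1) ψ.cell)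
  /-- compatibility with `x j` -/
  compat_x : ∀ j, ∀ φ ∈ S.Φ j, ∀ p ∈ S.Y.closedCell j φ.cell, S.x j (φ.toFun p) = p 0
  /-- `π j` is surjective -/
  surjective : ∀ j, Function.Surjective (S.next j)
  /-- `π j : X j ^ (1) → X (j + 1)` is cellular -/
  cellular : ∀ j k, MapsTo (S.next j) (S.Y.skeleton (j + 1) (S.sub j 1) k)
    (S.Y.skeleton (j + 1) (S.Φ (j + 1)) k)
  /-- fibers have controlled vertical diameter -/
  fiber : ∀ j (v : S.X (j + 1)), S.Y.IsVertex (j + 1) (S.Φ (j + 1)) v →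
    ∀ v₀ v₁ : S.X j, S.next j v₀ = v → S.next j v₁ = v →
      S.Y.VerticalEdgePath (j + 1) (S.sub j 1) H v₀ v₁
  /-- gallery accessibility -/
  gallery : ∀ j, ∀ φ ∈ S.topMaps j, ∀ ψ ∈ S.topMaps j, S.Adjacent j φ ψ →
    S.Y.HorizontalGallery j (S.Φ j) Δ φ ψ
  /-- compatibility of the measures with projection -/
  pushforward : ∀ j, (S.μ j).map (S.next j) = S.μ (j + 1)
  /-- the measure is a positive multiple of Lebesgue measure on each `n`-cell -/
  lebesgue : ∀ j, ∀ φ ∈ S.topMaps j, ∃ w : ℝ≥0, 0 < w ∧ S.IsWeight j φ w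
  /-- the weights of adjacent `n`-cells agree to within a factor `Δ` -/
  weight : ∀ j, ∀ φ ∈ S.topMaps j, ∀ ψ ∈ S.topMaps j, S.Adjacent j φ ψ →
    ∀ w w' : ℝ≥0, S.IsWeight j φ w → S.IsWeight j ψ w' → w ≤ Δ * w'

/-- For every `j`, the inverse image under `π j` of every open `n`-cell of `X (j + 1)` is a single
open `n`-cell of `X j ^ (1)`. -/
def InjectiveOnTopCells : Prop :=
  ∀ j, ∀ ψ ∈ S.topMaps (j + 1), ∃ φ ∈ S.sub j 1, φ.cell.dirs = Finset.univ ∧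
    S.next j ⁻¹' S.Y.openImage (j + 1) ψ = S.Y.openImage (j + 1) φ

/-! ### The metrics -/

/-- The largest pseudodistance on `X j` such that for all `i ≤ j`, the image in `X j` of
every cell of `X i` has diameter at most `m ^ (-i)`. -/
noncomputable def hatDist (j : ℤ) : S.X j → S.X j → ℝ≥0∞ :=
  largestPseudoDist fun ρ => ∀ i, ∀ h : i ≤ j, ∀ φ ∈ S.Φ i,
    ∀ p ∈ S.Y.closedImage i φ, ∀ q ∈ S.Y.closedImage i φ, ρ (S.π i j h p) (S.π i j h q) ≤ size m i

/-- The set `X j`, to be equipped with the metric `d j`. -/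
def Fine (j : ℤ) : Type u := S.X j

/-- The metric `d j`: the largest pseudodistance on `X j` that is bounded by `hatDist j` and
such that every cell of `X j ^ (k)`, `k ≥ 0`, has diameter at most `m ^ (-(j + k))`. -/
noncomputable instance (j : ℤ) : PseudoEMetricSpace (S.Fine j) :=
  largestPseudoEMetric fun ρ => (∀ p q, ρ p q ≤ S.hatDist j p q) ∧
    ∀ k : ℕ, ∀ φ ∈ S.sub j k, ∀ p ∈ S.Y.closedImage (j + k) φ,
      ∀ q ∈ S.Y.closedImage (j + k) φ, ρ p q ≤ size m (j + k)

instance (j : ℤ) : MeasurableSpace (S.Fine j) := S.measurable j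

/-- `μ j`, as a measure on `(X j, d j)`. -/
noncomputable def fineMeasure (j : ℤ) : Measure (S.Fine j) := S.μ j

/-- The direct limit `X ∞` of the sets `X j`. -/
def Limit : Type u := DirectLimit S.X S.π

/-- The projection `X j → X ∞`. -/
noncomputable def toLimit (j : ℤ) (p : S.X j) : S.Limit := (⟦⟨j, p⟩⟧ : DirectLimit S.X S.π)

/-- The largest pseudodistance on `X ∞` such that for all `j`, the image of every cell of
`X j` has diameter at most `m ^ (-j)`. -/
noncomputable instance : PseudoEMetricSpace S.Limit :=
  largestPseudoEMetric fun ρ => ∀ j, ∀ φ ∈ S.Φ j, ∀ p ∈ S.Y.closedImage j φ,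
    ∀ q ∈ S.Y.closedImage j φ, ρ (S.toLimit j p) (S.toLimit j q) ≤ size m j

/-- The limit space of the system: the metric space obtained from `X ∞` by identifying points at
distance zero. -/
abbrev LimitSpace : Type u := SeparationQuotient S.Limit

/-- The projection from `(X j, d j)` to the limit space. -/
noncomputable def proj (j : ℤ) (p : S.Fine j) : S.LimitSpace := SeparationQuotient.mk (S.toLimit j p)

end System

end Admissible

/-!
The core of the proof is a statement about intersections: if two cells of generation `i` contain
points at distance less than `m ^ (-i)`, in the limit space or in one of the spaces `X j`, then the
two cells intersect (`LiftSystem.exists_meet`). Distances are infima of the costs of chains of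
cells, so the point is to lift a chain from `X (i + 1)` to `X i` with at most the same cost, rounded
down to whole cells of generation `i`. A chain of `m` cells of generation `i + 1` crosses at most one
cell of generation `i` horizontally. Vertically it can jump between points of a fibre of `π i`, but
fibres have vertical extent `H / mv` relative to the cells of generation `i`; since `mv` is large, `m`
such jumps do not lead from a point to a vertex on the far side of a cell, and after `m` cells one
starts afresh from a whole cell of generation `i` (`Reach.anchored`). The notion `Near` makes this
precise; it can be expressed in any characteristic map since characteristic maps agree up to
symmetries of the tilings (`IsAdmissible.exists_gridMap`). To treat both kinds of spaces at once, the
argument is carried out for a `LiftSystem`; the limit space is `limitSystem`, and the metric `d j` is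
the limit metric of the system truncated at `j`, in which later generations only subdivide `X j`
(`truncSystem`).

Consequently, balls of radius `m ^ (-i)` are contained in stars of cells of generation `i`, and a
star consists of a bounded number of cells (`IsAdmissible.exists_ball_cover`). As adjacent cells have
comparable weights, this gives the doubling property; it also shows that `d j` separates points and
that it has the same Borel sets as the cell complex.

For the components of the inverse image in `X j` of a set of diameter about `m ^ (-i)`, only the case
`j < i` requires an argument. Points with nearby images in the limit have nearby first coordinates,
and almost the same vertical distances to the lattice of generation `i`
(`IsAdmissible.hasLatDist_of_edist`). Hence one can choose a threshold, between one half and three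
quarters of a side, to which none of these distances is close (`exists_threshold`). A chain of small
steps which starts within the threshold of a vertex cannot cross it, so it stays in the star of this
vertex (`IsAdmissible.isCaptured_step`). Lightness follows, and the components of a point inverse
form the cover showing that it has Assouad–Nagata dimension zero.

If the projections are injective over open `n`-cells, then the inverse image in `X j` of a star in
`X i`, with `j ≤ i`, consists of boundedly many small cells, which gives David–Semmes regularity.
Moreover, weights do not increase under subdivision and projection
(`IsAdmissible.exists_hasWeight_le`), so on a given cell of weight `w` the measure of a ball of small
radius `r` is at most a constant times `w r ^ Q`, where `Q` is such that the volume of a cell of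
generation `i` is `(m ^ (-i)) ^ Q` (`size_rpow`). The mass distribution principle and coverings by
small cells then give Ahlfors regularity.
-/

namespace Admissible

/-! ### One-dimensional lattices -/

/-- `x` lies on the lattice `o + s ℤ` of the real line. -/
def OnLattice (o s x : ℝ) : Prop := ∃ z : ℤ, x = o + z * s

theorem OnLattice.add_mul {o s x : ℝ} (h : OnLattice o s x) (z : ℤ) : OnLattice o s (x + z * s) := by
  obtain ⟨y, rfl⟩ := h
  exact ⟨y + z, by push_cast; ring⟩

theorem OnLattice.add {o s x : ℝ} (h : OnLattice o s x) : OnLattice o s (x + s) := by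
  simpa using h.add_mul 1

theorem OnLattice.sub {o s x : ℝ} (h : OnLattice o s x) : OnLattice o s (x - s) := by
  simpa [sub_eq_add_neg] using h.add_mul (-1)

theorem OnLattice.exists_sub {o s x y : ℝ} (hx : OnLattice o s x) (hy : OnLattice o s y) :
    ∃ z : ℤ, x - y = z * s := by
  obtain ⟨a, rfl⟩ := hx
  obtain ⟨b, rfl⟩ := hy
  exact ⟨a - b, by push_cast; ring⟩

theorem OnLattice.gap {o s x y : ℝ} (hs : 0 < s) (hx : OnLattice o s x) (hy : OnLattice o s y)
    (hxy : x < y) : x + s ≤ y := by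
  obtain ⟨a, rfl⟩ := hx
  obtain ⟨b, rfl⟩ := hy
  have h1 : (a : ℝ) < b := by
    by_contra! h
    nlinarith
  have h2 : (a : ℝ) + 1 ≤ b := by exact_mod_cast Int.add_one_le_of_lt (by exact_mod_cast h1)
  nlinarith

theorem OnLattice.le_of_lt_add {o s x y : ℝ} (hs : 0 < s) (hx : OnLattice o s x)
    (hy : OnLattice o s y) (hxy : x < y + s) : x ≤ y := by
  by_contra! h
  linarith [hy.gap hs hx h]

theorem OnLattice.exists_nearest {o s A B a : ℝ} (hs : 0 < s) (hA : OnLattice o s A)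
    (hB : OnLattice o s B) (h1 : A ≤ a) (h2 : a ≤ B) :
    ∃ w, OnLattice o s w ∧ A ≤ w ∧ w ≤ B ∧ |a - w| ≤ s / 2 := by
  have e : a = o + (a - o) / s * s := by field_simp; ring
  have hr := abs_sub_round ((a - o) / s)
  have hw : |a - (o + round ((a - o) / s) * s)| ≤ s / 2 := by
    have : a - (o + round ((a - o) / s) * s) = ((a - o) / s - round ((a - o) / s)) * s := by
      field_simp; ring
    rw [this, abs_mul, abs_of_pos hs]
    nlinarith
  have hl : OnLattice o s (o + round ((a - o) / s) * s) := ⟨_, rfl⟩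
  have h3 := abs_le.1 hw
  refine ⟨_, hl, hA.le_of_lt_add hs hl (by linarith), hl.le_of_lt_add hs hB (by linarith), hw⟩

/-- A point and a nearby lattice point, both between the lattice points `A < B`, lie in a common
interval of the lattice subdivision of `[A, B]`. -/
theorem OnLattice.exists_interval {o s A B a w : ℝ} (hs : 0 < s) (hA : OnLattice o s A)
    (hB : OnLattice o s B) (hAB : A < B) (h1 : A ≤ a) (h2 : a ≤ B) (hw : OnLattice o s w)
    (h3 : A ≤ w) (h4 : w ≤ B) (haw : |a - w| ≤ s) :
    ∃ x, OnLattice o s x ∧ A ≤ x ∧ x + s ≤ B ∧ (x ≤ a ∧ a ≤ x + s) ∧ (x ≤ w ∧ w ≤ x + s) := by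
  have h := abs_le.1 haw
  by_cases hwB : w < a ∨ (w = a ∧ w < B)
  · have hlt : w < B := by
      rcases hwB with h | h
      · linarith
      · exact h.2
    have hle : w ≤ a := by
      rcases hwB with h | h
      · linarith
      · exact h.1.le
    exact ⟨w, hw, h3, hw.gap hs hB hlt, ⟨hle, by linarith⟩, le_rfl, by linarith⟩
  · have h5 : a ≤ w ∧ A < w := by
      push Not at hwB
      refine ⟨hwB.1, ?_⟩
      rcases eq_or_lt_of_le hwB.1 with h6 | h6
      · have := hwB.2 h6.symm
        linarith
      · linarith
    refine ⟨w - s, hw.sub, ?_, by linarith, ⟨by linarith, by linarith⟩, by linarith, by linarith⟩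
    linarith [hA.gap hs hw h5.2]

/-- An interval of a lattice with an interior point in an interval with endpoints on that lattice
is contained in the latter. -/
theorem OnLattice.subset_interval {o s A B a x : ℝ} (hs : 0 < s) (hA : OnLattice o s A)
    (hB : OnLattice o s B) (h1 : A ≤ a) (h2 : a ≤ B) (hx : OnLattice o s x) (h3 : x < a)
    (h4 : a < x + s) : A ≤ x ∧ x + s ≤ B :=
  ⟨hA.le_of_lt_add hs hx (by linarith), hx.gap hs hB (by linarith)⟩

/-! ### Cells of the tilings -/

section Side

variable {n m mv : ℕ} [NeZero n]

theorem side_zero (j : ℤ) : side (n := n) m mv j 0 = (m : ℝ) ^ (-j) := by simp [side]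

theorem side_of_ne {j : ℤ} {k : Fin n} (hk : k ≠ 0) : side m mv j k = (mv : ℝ) ^ (-j) := by
  simp [side, hk]

theorem side_pos (hm : 2 ≤ m) (hmv : m ≤ mv) (j : ℤ) (k : Fin n) : 0 < side m mv j k := by
  have h1 : (0 : ℝ) < m := by exact_mod_cast (by lia : 0 < m)
  have h2 : (0 : ℝ) < mv := by exact_mod_cast (by lia : 0 < mv)
  unfold side
  split_ifs <;> positivity

/-- The number of parts into which a side of a tile is divided from one generation to the
next. -/
def ratio (m mv : ℕ) (k : Fin n) : ℕ := if k = 0 then m else mv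

theorem side_succ (hm : 2 ≤ m) (hmv : m ≤ mv) (j : ℤ) (k : Fin n) :
    side m mv j k = ratio m mv k * side m mv (j + 1) k := by
  have h1 : (m : ℝ) ≠ 0 := by exact_mod_cast (by lia : m ≠ 0)
  have h2 : (mv : ℝ) ≠ 0 := by exact_mod_cast (by lia : mv ≠ 0)
  unfold side ratio
  split_ifs <;> rw [neg_add, zpow_add₀ (by assumption), zpow_neg_one] <;> field_simp

end Side

namespace Tilings

variable {n m mv : ℕ} [NeZero n] (Y : Tilings n m mv)

/-- `x` is the `k`-th coordinate of a vertex of `Y j`. -/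
def LatCoord (j : ℤ) (k : Fin n) (x : ℝ) : Prop := OnLattice (Y.origin j k) (side m mv j k) x

/-- `w` is a vertex of `Y j`. -/
def IsLat (j : ℤ) (w : EuclideanSpace ℝ (Fin n)) : Prop := ∀ k, Y.LatCoord j k (w k)

/-- Upper corner of a cell of `Y j`. -/
noncomputable def hi (j : ℤ) (c : GridCell n) (k : Fin n) : ℝ :=
  if k ∈ c.dirs then Y.lo j c k + side m mv j k else Y.lo j c k

theorem latCoord_lo (j : ℤ) (c : GridCell n) (k : Fin n) : Y.LatCoord j k (Y.lo j c k) :=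
  ⟨c.corner k, rfl⟩

theorem latCoord_hi (j : ℤ) (c : GridCell n) (k : Fin n) : Y.LatCoord j k (Y.hi j c k) := by
  unfold hi
  split_ifs
  · exact (Y.latCoord_lo j c k).add
  · exact Y.latCoord_lo j c k

theorem lo_le_hi (hm : 2 ≤ m) (hmv : m ≤ mv) (j : ℤ) (c : GridCell n) (k : Fin n) :
    Y.lo j c k ≤ Y.hi j c k := by
  unfold hi
  split_ifs
  · linarith [side_pos hm hmv j k]
  · rfl

theorem mem_closedCell {j : ℤ} {c : GridCell n} {p : EuclideanSpace ℝ (Fin n)} :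
    p ∈ Y.closedCell j c ↔ ∀ k, Y.lo j c k ≤ p k ∧ p k ≤ Y.hi j c k := by
  refine forall_congr' fun k => ?_
  unfold hi
  by_cases hk : k ∈ c.dirs
  · simp [hk]
  · simp only [hk, false_imp_iff, true_and, not_false_eq_true, true_imp_iff, if_false]
    exact ⟨fun h => ⟨h.ge, h.le⟩, fun h => le_antisymm h.2 h.1⟩

theorem openCell_subset (j : ℤ) (c : GridCell n) : Y.openCell j c ⊆ Y.closedCell j c :=
  fun _ hp k => ⟨fun h => ⟨((hp k).1 h).1.le, ((hp k).1 h).2.le⟩, (hp k).2⟩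

theorem exists_cell {j : ℤ} (D : Finset (Fin n)) {x : Fin n → ℝ} (hx : ∀ k, Y.LatCoord j k (x k)) :
    ∃ c : GridCell n, c.dirs = D ∧ ∀ k, Y.lo j c k = x k := by
  choose z hz using hx
  exact ⟨⟨z, D⟩, rfl, fun k => (hz k).symm⟩

theorem cell_eq (hm : 2 ≤ m) (hmv : m ≤ mv) {j : ℤ} {c c' : GridCell n} (hd : c.dirs = c'.dirs)
    (hl : ∀ k, Y.lo j c k = Y.lo j c' k) : c = c' := by
  obtain ⟨z, D⟩ := c
  obtain ⟨z', D'⟩ := c'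
  obtain rfl : D = D' := hd
  congr
  ext k
  have := hl k
  have hs := side_pos hm hmv j k
  simp only [lo, add_right_inj] at this
  exact_mod_cast mul_right_cancel₀ hs.ne' this

theorem latCoord_succ (hm : 2 ≤ m) (hmv : m ≤ mv) {j : ℤ} {k : Fin n} {x : ℝ}
    (h : Y.LatCoord j k x) : Y.LatCoord (j + 1) k x := by
  obtain ⟨z, rfl⟩ := h
  obtain ⟨y, hy⟩ := Y.refine j k
  refine ⟨y + z * ratio m mv k, ?_⟩
  rw [hy, side_succ hm hmv j k]
  push_cast
  ring

theorem latCoord_of_le (hm : 2 ≤ m) (hmv : m ≤ mv) {j i : ℤ} (hji : j ≤ i) {k : Fin n} {x : ℝ}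
    (h : Y.LatCoord j k x) : Y.LatCoord i k x := by
  induction i, hji using Int.leInduction with
  | base => exact h
  | succ i _ ih => exact Y.latCoord_succ hm hmv ih

theorem mem_closedCell_of_near (hm : 2 ≤ m) (hmv : m ≤ mv) {j : ℤ} {c : GridCell n}
    {a w : EuclideanSpace ℝ (Fin n)} (ha : a ∈ Y.closedCell j c) (hw : Y.IsLat j w)
    (h : ∀ k, |a k - w k| < side m mv j k) : w ∈ Y.closedCell j c := by
  rw [mem_closedCell] at ha ⊢
  intro k
  have hs := side_pos hm hmv j k
  have h1 := abs_lt.1 (h k)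
  exact ⟨(Y.latCoord_lo j c k).le_of_lt_add hs (hw k) (by linarith [(ha k).1]),
    (hw k).le_of_lt_add hs (Y.latCoord_hi j c k) (by linarith [(ha k).2])⟩

/-- A point of a cell of `Y j` is close to a vertex of `Y i` in the same cell. -/
theorem exists_near_vertex (hm : 2 ≤ m) (hmv : m ≤ mv) {j i : ℤ} (hji : j ≤ i) {c : GridCell n}
    {a : EuclideanSpace ℝ (Fin n)} (ha : a ∈ Y.closedCell j c) :
    ∃ w ∈ Y.closedCell j c, Y.IsLat i w ∧ ∀ k, |a k - w k| ≤ side m mv i k / 2 := by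
  rw [mem_closedCell] at ha
  have h k := OnLattice.exists_nearest (side_pos hm hmv i k)
    (Y.latCoord_of_le hm hmv hji (Y.latCoord_lo j c k))
    (Y.latCoord_of_le hm hmv hji (Y.latCoord_hi j c k)) (ha k).1 (ha k).2
  choose w hw using h
  exact ⟨WithLp.toLp 2 w, Y.mem_closedCell.2 fun k => ⟨(hw k).2.1, (hw k).2.2.1⟩,
    fun k => (hw k).1, fun k => (hw k).2.2.2⟩

/-- A point and a nearby vertex of `Y i` in a cell of `Y j` lie in a common subcell of
generation `i`, which can be taken of the same dimension as the given cell. -/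
theorem exists_subcell_vertex (hm : 2 ≤ m) (hmv : m ≤ mv) {j i : ℤ} (hji : j ≤ i) {c : GridCell n}
    {a w : EuclideanSpace ℝ (Fin n)} (ha : a ∈ Y.closedCell j c) (hw : w ∈ Y.closedCell j c)
    (hwl : Y.IsLat i w) (haw : ∀ k, |a k - w k| ≤ side m mv i k) :
    ∃ c' : GridCell n, c'.dirs = c.dirs ∧ Y.closedCell i c' ⊆ Y.closedCell j c ∧
      a ∈ Y.closedCell i c' ∧ w ∈ Y.closedCell i c' := by
  have h : ∀ k, ∃ x, Y.LatCoord i k x ∧ Y.lo j c k ≤ x ∧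
      (if k ∈ c.dirs then x + side m mv i k else x) ≤ Y.hi j c k ∧
      (x ≤ a k ∧ a k ≤ (if k ∈ c.dirs then x + side m mv i k else x)) ∧
      (x ≤ w k ∧ w k ≤ (if k ∈ c.dirs then x + side m mv i k else x)) := by
    intro k
    have ha' := Y.mem_closedCell.1 ha k
    have hw' := Y.mem_closedCell.1 hw k
    by_cases hk : k ∈ c.dirs
    · simp only [hk, if_true]
      refine OnLattice.exists_interval (side_pos hm hmv i k)
        (Y.latCoord_of_le hm hmv hji (Y.latCoord_lo j c k))
        (Y.latCoord_of_le hm hmv hji (Y.latCoord_hi j c k)) ?_ ha'.1 ha'.2 (hwl k) hw'.1 hw'.2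
        (haw k)
      simp [hi, hk, side_pos hm hmv j k]
    · simp only [hk, if_false]
      simp only [hi, hk, if_false] at ha' hw' ⊢
      exact ⟨w k, hwl k, hw'.1, hw'.2, ⟨by linarith, by linarith⟩, le_rfl, le_rfl⟩
  choose x hx using h
  obtain ⟨c', hd, hl⟩ := Y.exists_cell c.dirs fun k => (hx k).1
  have hh : ∀ k, Y.hi i c' k = if k ∈ c.dirs then x k + side m mv i k else x k := by
    intro k
    simp [hi, hd, hl]
  refine ⟨c', hd, fun p hp => Y.mem_closedCell.2 fun k => ?_, Y.mem_closedCell.2 fun k => ?_,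
    Y.mem_closedCell.2 fun k => ?_⟩
  · have := Y.mem_closedCell.1 hp k
    rw [hl, hh] at this
    exact ⟨(hx k).2.1.trans this.1, this.2.trans (hx k).2.2.1⟩
  · rw [hl, hh]
    exact (hx k).2.2.2.1
  · rw [hl, hh]
    exact (hx k).2.2.2.2

/-- Every point of a cell lies in a subcell of generation `i` of the same dimension. -/
theorem exists_subcell (hm : 2 ≤ m) (hmv : m ≤ mv) {j i : ℤ} (hji : j ≤ i) {c : GridCell n}
    {a : EuclideanSpace ℝ (Fin n)} (ha : a ∈ Y.closedCell j c) :
    ∃ c' : GridCell n, c'.dirs = c.dirs ∧ Y.closedCell i c' ⊆ Y.closedCell j c ∧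
      a ∈ Y.closedCell i c' := by
  obtain ⟨w, hw, hwl, haw⟩ := Y.exists_near_vertex hm hmv hji ha
  obtain ⟨c', h1, h2, h3, -⟩ := Y.exists_subcell_vertex hm hmv hji ha hw hwl fun k =>
    (haw k).trans (by linarith [side_pos hm hmv i k])
  exact ⟨c', h1, h2, h3⟩

/-- The carrier of a point of a closed cell: the face whose relative interior contains it. -/
theorem exists_carrier (hm : 2 ≤ m) (hmv : m ≤ mv) {j : ℤ} {c : GridCell n}
    {a : EuclideanSpace ℝ (Fin n)} (ha : a ∈ Y.closedCell j c) :
    ∃ e : GridCell n, e.dirs ⊆ c.dirs ∧ a ∈ Y.openCell j e ∧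
      (Y.closedCell j e = {p | p ∈ Y.closedCell j c ∧ ∀ k, k ∉ e.dirs → p k = a k}) ∧
      (e.dirs.card = c.dirs.card → a ∈ Y.openCell j c) ∧
      (∀ k, k ∉ e.dirs → Y.LatCoord j k (a k)) := by
  classical
  have hs := side_pos (n := n) hm hmv j
  let D : Finset (Fin n) := {k ∈ c.dirs | Y.lo j c k < a k ∧ a k < Y.lo j c k + side m mv j k}
  have hD : ∀ k, k ∈ D ↔ k ∈ c.dirs ∧ Y.lo j c k < a k ∧ a k < Y.lo j c k + side m mv j k := by
    simp [D]
  have hlat : ∀ k, k ∉ D → Y.LatCoord j k (a k) := by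
    intro k hk
    by_cases hc : k ∈ c.dirs
    · have h := (ha k).1 hc
      have h' : ¬ (Y.lo j c k < a k ∧ a k < Y.lo j c k + side m mv j k) := fun h => hk ((hD k).2 ⟨hc, h⟩)
      rcases h.1.eq_or_lt with h1 | h1
      · rw [← h1]; exact Y.latCoord_lo j c k
      · have : a k = Y.lo j c k + side m mv j k := by
          by_contra hne
          exact h' ⟨h1, lt_of_le_of_ne h.2 hne⟩
        rw [this]; exact (Y.latCoord_lo j c k).add
    · rw [(ha k).2 hc]; exact Y.latCoord_lo j c k
  obtain ⟨e, hd, hl⟩ := Y.exists_cell (j := j) D (x := fun k => if k ∈ D then Y.lo j c k else a k)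
    (by
      intro k
      by_cases hk : k ∈ D
      · simpa [hk] using Y.latCoord_lo j c k
      · simpa [hk] using hlat k hk)
  have hsub : D ⊆ c.dirs := Finset.filter_subset _ _
  refine ⟨e, hd ▸ hsub, fun k => ?_, ?_, fun hcard => ?_, fun k hk => hlat k (hd ▸ hk)⟩
  · rw [hd, hl]
    by_cases hk : k ∈ D
    · simpa [hk] using ((hD k).1 hk).2
    · simp [hk]
  · ext p
    simp only [closedCell, mem_ofPred_eq, hd, hl]
    constructor
    · intro h
      refine ⟨fun k => ?_, fun k hk => by simpa [hk] using (h k).2 hk⟩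
      by_cases hk : k ∈ D
      · have h1 := (h k).1 hk
        simp only [hk, if_true] at h1
        exact ⟨fun _ => h1, fun h2 => absurd (hsub hk) h2⟩
      · have h1 := (h k).2 hk
        simp only [hk, if_false] at h1
        rw [h1]
        exact ha k
    · rintro ⟨h1, h2⟩ k
      by_cases hk : k ∈ D
      · simpa [hk] using (h1 k).1 (hsub hk)
      · simpa [hk] using h2 k hk
  · have hDc : D = c.dirs := Finset.eq_of_subset_of_card_le hsub (by rw [← hcard, hd])
    intro k
    refine ⟨fun hk => ((hD k).1 (hDc ▸ hk)).2, (ha k).2⟩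

/-- A cell of generation `i` whose interior meets a cell of a coarser generation `j` is contained
in it. -/
theorem closedCell_subset_of_mem (hm : 2 ≤ m) (hmv : m ≤ mv) {j i : ℤ} (hji : j ≤ i)
    {c C : GridCell n} {a : EuclideanSpace ℝ (Fin n)} (ha : a ∈ Y.openCell i c)
    (hC : a ∈ Y.closedCell j C) : Y.closedCell i c ⊆ Y.closedCell j C := by
  intro p hp
  rw [mem_closedCell]
  intro k
  have hC' := Y.mem_closedCell.1 hC k
  by_cases hk : k ∈ c.dirs
  · have h1 := (ha k).1 hk
    have h2 := OnLattice.subset_interval (side_pos hm hmv i k)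
      (Y.latCoord_of_le hm hmv hji (Y.latCoord_lo j C k))
      (Y.latCoord_of_le hm hmv hji (Y.latCoord_hi j C k)) hC'.1 hC'.2 (Y.latCoord_lo i c k) h1.1 h1.2
    have h3 := (hp k).1 hk
    exact ⟨h2.1.trans h3.1, h3.2.trans h2.2⟩
  · rw [(hp k).2 hk, ← (ha k).2 hk]
    exact hC'

theorem openCell_nonempty (hm : 2 ≤ m) (hmv : m ≤ mv) (j : ℤ) (c : GridCell n) :
    (Y.openCell j c).Nonempty := by
  refine ⟨WithLp.toLp 2 fun k => if k ∈ c.dirs then Y.lo j c k + side m mv j k / 2 else Y.lo j c k,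
    fun k => ?_⟩
  have hs := side_pos hm hmv j k
  by_cases hk : k ∈ c.dirs
  · simp only [hk, if_true, true_imp_iff, not_true, false_imp_iff, and_true]
    exact ⟨by linarith, by linarith⟩
  · simp [hk]

/-- Between a cell and a coarser cell containing it there are cells of all intermediate
generations. -/
theorem exists_between (hm : 2 ≤ m) (hmv : m ≤ mv) {j i l : ℤ} (hji : j ≤ i) (hil : i ≤ l)
    {c C : GridCell n} (h : Y.closedCell l c ⊆ Y.closedCell j C) :
    ∃ e : GridCell n, Y.closedCell l c ⊆ Y.closedCell i e ∧ Y.closedCell i e ⊆ Y.closedCell j C := by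
  obtain ⟨a, ha⟩ := Y.openCell_nonempty hm hmv l c
  obtain ⟨e, -, h1, h2⟩ := Y.exists_subcell hm hmv hji (h (Y.openCell_subset l c ha))
  exact ⟨e, Y.closedCell_subset_of_mem hm hmv hil ha h2, h1⟩

theorem abs_sub_le_side {j : ℤ} {c : GridCell n}
    {a b : EuclideanSpace ℝ (Fin n)} (ha : a ∈ Y.closedCell j c) (hb : b ∈ Y.closedCell j c)
    (hm : 2 ≤ m) (hmv : m ≤ mv) (k : Fin n) : |a k - b k| ≤ side m mv j k := by
  have h1 := Y.mem_closedCell.1 ha k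
  have h2 := Y.mem_closedCell.1 hb k
  have hs := side_pos hm hmv j k
  have h3 : Y.hi j c k ≤ Y.lo j c k + side m mv j k := by
    unfold hi; split_ifs <;> linarith
  rw [abs_le]
  constructor <;> linarith

/-- Every vertex of the tiling is a `0`-cell. -/
theorem exists_vertexCell {j : ℤ} {w : EuclideanSpace ℝ (Fin n)} (hw : Y.IsLat j w) :
    ∃ e : GridCell n, e.dirs = ∅ ∧ Y.closedCell j e = {w} ∧ Y.openCell j e = {w} := by
  obtain ⟨e, hd, hl⟩ := Y.exists_cell ∅ hw
  refine ⟨e, hd, ?_, ?_⟩ <;> ext p <;>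
    simp [closedCell, openCell, hd, hl] <;>
    exact ⟨fun h => by ext k; exact h k, fun h k => by rw [h]⟩

end Tilings

/-! ### Symmetries of the tilings -/

namespace Tilings

variable {n m mv : ℕ} [NeZero n] (Y : Tilings n m mv)

/-- A map of `ℝⁿ` which fixes the first coordinate, permutes the others up to signs and
translations, and maps vertices of `Y j` to vertices of `Y j`. -/
structure IsGridMap (j : ℤ) (g : EuclideanSpace ℝ (Fin n) → EuclideanSpace ℝ (Fin n)) : Prop where
  signedPerm : ∃ (τ : Equiv.Perm (Fin n)) (ε : Fin n → ℝ), τ 0 = 0 ∧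
    (∀ k, ε k = 1 ∨ ε k = -1) ∧ ∀ p q k, g p (τ k) - g q (τ k) = ε k * (p k - q k)
  fst : ∀ p, g p 0 = p 0
  isLat : ∀ w, Y.IsLat j w → Y.IsLat j (g w)

theorem exists_isLat (j : ℤ) : ∃ w : EuclideanSpace ℝ (Fin n), Y.IsLat j w :=
  ⟨WithLp.toLp 2 (Y.origin j), fun _ => ⟨0, by simp⟩⟩

/-- Since the lattices of the tilings `Y j` are nested, symmetries of `Y j` are symmetries of
all `Y i` with `i ≥ j`. -/
theorem IsGridMap.of_le {Y : Tilings n m mv} (hm : 2 ≤ m) (hmv : m ≤ mv) {j i : ℤ} (hji : j ≤ i)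
    {g : EuclideanSpace ℝ (Fin n) → EuclideanSpace ℝ (Fin n)} (hg : Y.IsGridMap j g) :
    Y.IsGridMap i g := by
  refine ⟨hg.signedPerm, hg.fst, fun w hw l => ?_⟩
  obtain ⟨τ, ε, h0, hε, h⟩ := hg.signedPerm
  obtain ⟨w₀, hw₀⟩ := Y.exists_isLat j
  obtain ⟨k, rfl⟩ := τ.surjective l
  have h1 := Y.latCoord_of_le hm hmv hji (hg.isLat _ hw₀ (τ k))
  obtain ⟨z, hz⟩ := (hw k).exists_sub (Y.latCoord_of_le hm hmv hji (hw₀ k))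
  have hside : side m mv i (τ k) = side m mv i k := by
    have : τ k = 0 ↔ k = 0 := by rw [← h0, τ.apply_eq_iff_eq, h0]
    simp [side, this]
  have h2 := h w w₀ k
  rw [hz] at h2
  unfold LatCoord
  rcases hε k with e | e
  · have : g w (τ k) = g w₀ (τ k) + z * side m mv i (τ k) := by rw [hside]; rw [e] at h2; linarith
    rw [this]; exact h1.add_mul z
  · have : g w (τ k) = g w₀ (τ k) + (-z : ℤ) * side m mv i (τ k) := by
      rw [hside]; rw [e] at h2; push_cast; linarith
    rw [this]; exact h1.add_mul (-z)

theorem IsGridMap.side_perm {τ : Equiv.Perm (Fin n)} (h0 : τ 0 = 0) (i : ℤ) (k : Fin n) :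
    side m mv i (τ k) = side m mv i k := by
  have : τ k = 0 ↔ k = 0 := by rw [← h0, τ.apply_eq_iff_eq, h0]
  simp [side, this]

/-- An integral vector of length one is a unit coordinate vector up to sign. -/
theorem exists_unit_of_sum_sq {ι : Type*} [Fintype ι] [DecidableEq ι] {z : ι → ℤ}
    (h : ∑ k, z k ^ 2 = 1) :
    ∃ k, (z k = 1 ∨ z k = -1) ∧ ∀ l, l ≠ k → z l = 0 := by
  have hne : ∃ k, z k ≠ 0 := by
    by_contra! h0
    simp [h0] at h
  obtain ⟨k, hk⟩ := hne
  have h1 : (1 : ℤ) ≤ z k ^ 2 := by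
    have := sq_pos_of_ne_zero hk
    lia
  have h2 := Finset.add_sum_erase Finset.univ (fun k => z k ^ 2) (Finset.mem_univ k)
  have h3 : ∑ l ∈ Finset.univ.erase k, z l ^ 2 = 0 := by
    have h4 : 0 ≤ ∑ l ∈ Finset.univ.erase k, z l ^ 2 := Finset.sum_nonneg fun l _ => sq_nonneg _
    linarith
  rw [Finset.sum_eq_zero_iff_of_nonneg fun l _ => sq_nonneg _] at h3
  refine ⟨k, ?_, fun l hl => ?_⟩
  · have : z k ^ 2 = 1 := by
      have h5 : ∑ l ∈ Finset.univ.erase k, z l ^ 2 = 0 := Finset.sum_eq_zero h3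
      linarith
    exact (sq_eq_sq_iff_eq_or_eq_neg (b := (1 : ℤ))).1 (by simpa using this)
  · exact pow_eq_zero_iff (two_ne_zero) |>.1 (h3 l (Finset.mem_erase.2 ⟨hl, Finset.mem_univ _⟩))

theorem isLat_of_mem_G {j : ℤ} {g : EuclideanSpace ℝ (Fin n) ≃ᵢ EuclideanSpace ℝ (Fin n)}
    (hm : 2 ≤ m) (hmv : m ≤ mv)
    (hg : g ∈ Y.G j) {w : EuclideanSpace ℝ (Fin n)} (hw : Y.IsLat j w) : Y.IsLat j (g w) := by
  obtain ⟨e, -, he, -⟩ := Y.exists_vertexCell hw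
  obtain ⟨c, hc⟩ := (hg.2.2 {w}).1 ⟨e, he.symm⟩
  rw [image_singleton] at hc
  have h1 : WithLp.toLp 2 (Y.lo j c) ∈ Y.closedCell j c :=
    Y.mem_closedCell.2 fun k => ⟨le_rfl, Y.lo_le_hi hm hmv j c k⟩
  rw [← hc, mem_singleton_iff] at h1
  rw [← h1]
  exact Y.latCoord_lo j c

/-- The linear part fixes the first coordinate, and it maps each of the other coordinate vectors to
an integral vector, as lattice points go to lattice points. Being integral of length one, this is a
coordinate vector up to sign. -/
theorem isGridMap_of_mem_G (hm : 2 ≤ m) (hmv : m ≤ mv) {j : ℤ}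
    {g : EuclideanSpace ℝ (Fin n) ≃ᵢ EuclideanSpace ℝ (Fin n)} (hg : g ∈ Y.G j) :
    Y.IsGridMap j g := by
  classical
  refine ⟨?_, hg.1, fun w hw => Y.isLat_of_mem_G hm hmv hg hw⟩
  let L := g.toRealLinearIsometryEquiv
  have hL : ∀ p q, g p - g q = L (p - q) := by
    intro p q
    rw [map_sub]
    simp [L]
  have hL0 : ∀ v, L v 0 = v 0 := by
    intro v
    have := hL v 0
    rw [sub_zero] at this
    rw [← this, PiLp.sub_apply, hg.1, hg.1]
    simp
  let E : Fin n → EuclideanSpace ℝ (Fin n) := fun k => EuclideanSpace.single k 1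
  have hEn : ∀ k, ‖E k‖ = 1 := fun k => by simp [E]
  -- The linear part maps each coordinate vector to a coordinate vector, up to sign.
  have key : ∀ k, ∃ l, ∃ ε : ℝ, (ε = 1 ∨ ε = -1) ∧ L (E k) = ε • E l ∧ (k = 0 → l = 0) := by
    intro k
    have hn1 : ‖L (E k)‖ = 1 := by rw [L.norm_map, hEn]
    rw [EuclideanSpace.norm_eq, Real.sqrt_eq_one] at hn1
    simp only [Real.norm_eq_abs, sq_abs] at hn1
    by_cases hk : k = 0
    · subst hk
      refine ⟨0, 1, Or.inl rfl, ?_, fun _ => rfl⟩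
      have h0 : L (E 0) 0 = 1 := by rw [hL0]; simp [E]
      have h2 := Finset.add_sum_erase Finset.univ (fun l => (L (E 0) l) ^ 2) (Finset.mem_univ 0)
      simp only [hn1, h0] at h2
      have h3 : ∑ l ∈ Finset.univ.erase 0, (L (E 0) l) ^ 2 = 0 := by linarith
      rw [Finset.sum_eq_zero_iff_of_nonneg fun l _ => sq_nonneg _] at h3
      ext l
      by_cases hl : l = 0
      · subst hl; simp [h0, E]
      · have := h3 l (Finset.mem_erase.2 ⟨hl, Finset.mem_univ _⟩)
        simp [E, hl, pow_eq_zero_iff] at this ⊢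
        exact this
    · obtain ⟨w, hw⟩ := Y.exists_isLat j
      set s := side m mv j k with hs_def
      have hs : 0 < s := side_pos hm hmv j k
      have hw' : Y.IsLat j (w + s • E k) := by
        intro l
        by_cases hl : l = k
        · subst hl
          have := (hw l).add
          simpa [E, LatCoord, ← hs_def] using this
        · simpa [E, hl] using hw l
      have hz : ∀ l, ∃ z : ℤ, L (E k) l = z := by
        intro l
        by_cases hl : l = 0
        · subst hl
          exact ⟨0, by rw [hL0]; simp [E, Ne.symm hk]⟩
        · obtain ⟨z, hz⟩ := (Y.isLat_of_mem_G hm hmv hg hw' l).exists_sub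
            (Y.isLat_of_mem_G hm hmv hg hw l)
          refine ⟨z, ?_⟩
          have h1 : g (w + s • E k) l - g w l = s * L (E k) l := by
            rw [← PiLp.sub_apply, hL, add_sub_cancel_left, map_smul]
            simp
          rw [h1, side_of_ne hl, ← side_of_ne (m := m) hk, ← hs_def, mul_comm] at hz
          exact mul_right_cancel₀ hs.ne' hz
      choose z hz using hz
      have hsum : ∑ l, z l ^ 2 = 1 := by
        simp only [hz] at hn1
        exact_mod_cast hn1
      obtain ⟨l, h1, h2⟩ := exists_unit_of_sum_sq hsum
      refine ⟨l, z l, ?_, ?_, fun h => absurd h hk⟩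
      · rcases h1 with h | h <;> simp [h]
      · ext i
        by_cases hi : i = l
        · subst hi; simp [E, hz]
        · simp [E, hi, hz, h2 i hi]
  choose τ ε hε hτ h0 using key
  have hinj : Function.Injective τ := by
    intro k k' hkk
    by_contra hne
    have h1 : L (E k) = (ε k * ε k') • L (E k') := by
      rw [hτ k, hτ k', hkk, smul_smul]
      rcases hε k with h | h <;> rcases hε k' with h' | h' <;> simp [h, h']
    rw [← map_smul] at h1
    have h2 := congrFun (congrArg WithLp.ofLp (L.injective h1)) k
    simp [E, hne] at h2
  let σ : Equiv.Perm (Fin n) := Equiv.ofBijective τ (Finite.injective_iff_bijective.1 hinj)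
  refine ⟨σ, ε, h0 0 rfl, hε, fun p q k => ?_⟩
  have h1 : (g p - g q) (σ k) = inner ℝ (L (E k)) (L (p - q)) * ε k := by
    rw [hL, hτ k, real_inner_smul_left]
    have : inner ℝ (E (τ k)) (L (p - q)) = L (p - q) (τ k) := by
      simp [E, EuclideanSpace.inner_single_left]
    rw [this]
    change L (p - q) (τ k) = _
    rcases hε k with h | h <;> simp [h]
  rw [← PiLp.sub_apply, h1, L.inner_map_map]
  simp [E, EuclideanSpace.inner_single_left, mul_comm]

end Tilings

/-! ### Changing charts -/

namespace System

variable {n m mv : ℕ} [NeZero n] {S : System.{u} n m mv} {Δ H : ℕ}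

theorem mem_openImage {X : Type u} {Y : Tilings n m mv} {j : ℤ} {c : GridCell n}
    {f : EuclideanSpace ℝ (Fin n) → X} {a : EuclideanSpace ℝ (Fin n)} (ha : a ∈ Y.openCell j c) :
    f a ∈ Y.openImage j ⟨c, f⟩ := ⟨a, ha, rfl⟩

/-- Two representations `φ a = ψ b` of a point of `X j` differ by a symmetry of the tiling `Y j`,
which identifies `φ` and `ψ` on the face of the cell of `φ` carrying `a`. -/
theorem IsAdmissible.exists_gridMap (hS : S.IsAdmissible Δ H) (hm : 2 ≤ m) (hmv : m ≤ mv) {j : ℤ}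
    {φ ψ : CharMap n (S.X j)} (hφ : φ ∈ S.Φ j) (hψ : ψ ∈ S.Φ j) {a b : EuclideanSpace ℝ (Fin n)}
    (ha : a ∈ S.Y.closedCell j φ.cell) (hb : b ∈ S.Y.closedCell j ψ.cell)
    (hab : φ.toFun a = ψ.toFun b) :
    ∃ g, S.Y.IsGridMap j g ∧ g a = b ∧
      ∀ p ∈ S.Y.closedCell j φ.cell, (∀ k, p k ≠ a k → ¬ S.Y.LatCoord j k (a k)) →
        g p ∈ S.Y.closedCell j ψ.cell ∧ ψ.toFun (g p) = φ.toFun p := by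
  obtain ⟨e, hed, hea, hec, -, hel⟩ := S.Y.exists_carrier hm hmv ha
  obtain ⟨f, hfd, hfb, hfc, -, hfl⟩ := S.Y.exists_carrier hm hmv hb
  have hesub : S.Y.closedCell j e ⊆ S.Y.closedCell j φ.cell := by rw [hec]; exact fun p hp => hp.1
  have hfsub : S.Y.closedCell j f ⊆ S.Y.closedCell j ψ.cell := by rw [hfc]; exact fun p hp => hp.1
  have he := hS.compat_face j φ hφ e hesub
  have hf := hS.compat_face j ψ hψ f hfsub
  have hpart := (hS.complex j).partition
  have heq : S.Y.openImage j ⟨e, φ.toFun⟩ = S.Y.openImage j ⟨f, ψ.toFun⟩ := by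
    rcases hpart _ he _ hf with h | h
    · exact h.1
    · exact absurd (hab ▸ mem_openImage hfb) (Set.disjoint_left.1 h (mem_openImage hea))
  obtain ⟨g, hg, himg, hEq⟩ := hS.compat_group j _ he _ hf heq
  have hga : g a ∈ S.Y.closedCell j f := by
    rw [← himg]
    exact mem_image_of_mem _ (S.Y.openCell_subset j e hea)
  have hψ' : ψ.toFun (g a) = φ.toFun a := (hEq (S.Y.openCell_subset j e hea)).symm
  -- The image of `a` lies in the open face carrying `b`, for dimension reasons.
  have hgo : g a ∈ S.Y.openCell j f := by
    obtain ⟨f', hd', ha', hc', hcard, -⟩ := S.Y.exists_carrier hm hmv hga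
    refine hcard ?_
    have hf' := hS.compat_face j _ hf f' (by rw [hc']; exact fun p hp => hp.1)
    rcases hpart _ hf' _ hf with h | h
    · exact h.2
    · exact absurd (hψ' ▸ hab ▸ mem_openImage hfb)
        (Set.disjoint_left.1 h (mem_openImage (f := ψ.toFun) ha'))
  refine ⟨g, S.Y.isGridMap_of_mem_G hm hmv hg,
    (hS.complex j).injOn _ hf hgo hfb (by rw [← hab, ← hψ']), fun p hp hpa => ?_⟩
  have hpe : p ∈ S.Y.closedCell j e := by
    rw [hec]
    exact ⟨hp, fun k hk => by_contra fun h => hpa k h (hel k hk)⟩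
  exact ⟨hfsub (himg ▸ mem_image_of_mem _ hpe), (hEq hpe).symm⟩

end System

/-! ### Lifting chains of cells -/

namespace Tilings.IsGridMap

variable {n m mv : ℕ} [NeZero n] {Y : Tilings n m mv} {j : ℤ}
  {g : EuclideanSpace ℝ (Fin n) → EuclideanSpace ℝ (Fin n)}

theorem bound (hg : Y.IsGridMap j g) {i : ℤ} {p q : EuclideanSpace ℝ (Fin n)} {θ : ℝ}
    (h : ∀ k : Fin n, k ≠ 0 → |p k - q k| ≤ θ * side m mv i k) (k : Fin n) (hk : k ≠ 0) :
    |g p k - g q k| ≤ θ * side m mv i k := by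
  obtain ⟨τ, ε, h0, hε, H⟩ := hg.signedPerm
  obtain ⟨k, rfl⟩ := τ.surjective k
  have hk' : k ≠ 0 := fun h => hk (h ▸ h0)
  rw [H, side_perm h0, abs_mul]
  have : |ε k| = 1 := by rcases hε k with h | h <;> simp [h]
  rw [this, one_mul]
  exact h k hk'

theorem bound_lt (hg : Y.IsGridMap j g) {i : ℤ} {p q : EuclideanSpace ℝ (Fin n)} {θ : ℝ}
    (h : ∀ k : Fin n, k ≠ 0 → |p k - q k| < θ * side m mv i k) (k : Fin n) (hk : k ≠ 0) :
    |g p k - g q k| < θ * side m mv i k := by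
  obtain ⟨τ, ε, h0, hε, H⟩ := hg.signedPerm
  obtain ⟨k, rfl⟩ := τ.surjective k
  have hk' : k ≠ 0 := fun h => hk (h ▸ h0)
  rw [H, side_perm h0, abs_mul]
  have : |ε k| = 1 := by rcases hε k with h | h <;> simp [h]
  rw [this, one_mul]
  exact h k hk'

theorem eq_of_eq (hg : Y.IsGridMap j g) {p q : EuclideanSpace ℝ (Fin n)}
    (h : ∀ k : Fin n, k ≠ 0 → p k = q k) (k : Fin n) (hk : k ≠ 0) : g p k = g q k := by
  have := hg.bound (i := j) (p := p) (q := q) (θ := 0) (fun k hk => by simp [h k hk]) k hk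
  rw [zero_mul] at this
  linarith [abs_nonpos_iff.1 this]

end Tilings.IsGridMap

section

variable {n m mv : ℕ} [NeZero n]

/-- Two points lie in a common cell, at the same height of the first coordinate and at a distance
at most one side length of the next generation in the other directions. -/
def VStep (Y : Tilings n m mv) (i : ℤ) {X : Type u} (Φ : Set (CharMap n X)) (y y' : X) : Prop :=
  ∃ φ ∈ Φ, ∃ a ∈ Y.closedCell i φ.cell, ∃ b ∈ Y.closedCell i φ.cell, φ.toFun a = y ∧
    φ.toFun b = y' ∧ a 0 = b 0 ∧ ∀ k : Fin n, k ≠ 0 → |a k - b k| ≤ side m mv (i + 1) k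

/-- The part of the structure of an admissible direct system used for lifting chains of cells,
together with a limit `L` of the system and an extended distance `d` on it, which is the largest
one for which the cells of generation `g` have diameter at most `m ^ (-g)`. The latter is
expressed by `d_cell` and `d_lower`. -/
structure LiftSystem (n m mv : ℕ) [NeZero n] (H : ℕ) where
  Y : Tilings n m mv
  X : ℤ → Type u
  π : ∀ i j : ℤ, i ≤ j → X i → X j
  π_self : ∀ i p, π i i le_rfl p = p
  π_π : ∀ i j k (hij : i ≤ j) (hjk : j ≤ k) p, π j k hjk (π i j hij p) = π i k (hij.trans hjk) p
  Φ : ∀ i, Set (CharMap n (X i))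
  cover : ∀ i p, ∃ φ ∈ Φ i, ∃ a ∈ Y.closedCell i φ.cell, φ.toFun a = p
  face : ∀ i, ∀ φ ∈ Φ i, ∀ c : GridCell n, Y.closedCell i c ⊆ Y.closedCell i φ.cell →
    ⟨c, φ.toFun⟩ ∈ Φ i
  transfer : ∀ i, ∀ φ ∈ Φ i, ∀ ψ ∈ Φ i, ∀ a ∈ Y.closedCell i φ.cell, ∀ b ∈ Y.closedCell i ψ.cell,
    φ.toFun a = ψ.toFun b → ∃ g, Y.IsGridMap i g ∧ g a = b ∧ ∀ w ∈ Y.closedCell i φ.cell,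
      Y.IsLat i w → (∀ k, |a k - w k| < side m mv i k) →
        g w ∈ Y.closedCell i ψ.cell ∧ ψ.toFun (g w) = φ.toFun w
  subdiv : ∀ i, ∀ φ ∈ Φ i, ∀ c : GridCell n, Y.closedCell (i + 1) c ⊆ Y.closedCell i φ.cell →
    ⟨c, fun p => π i (i + 1) (by lia) (φ.toFun p)⟩ ∈ Φ (i + 1)
  subdiv_surj : ∀ i, ∀ ψ ∈ Φ (i + 1), ∃ φ ∈ Φ i,
    Y.closedCell (i + 1) ψ.cell ⊆ Y.closedCell i φ.cell ∧
      ∀ a ∈ Y.closedCell (i + 1) ψ.cell, ψ.toFun a = π i (i + 1) (by lia) (φ.toFun a)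
  fiber : ∀ i, ∀ ψ ∈ Φ (i + 1), ∀ w ∈ Y.closedCell (i + 1) ψ.cell, Y.IsLat (i + 1) w →
    ∀ y y' : X i, π i (i + 1) (by lia) y = ψ.toFun w → π i (i + 1) (by lia) y' = ψ.toFun w →
      ∃ l ≤ H, ∃ v : ℕ → X i, v 0 = y ∧ v l = y' ∧ ∀ t < l, VStep Y i (Φ i) (v t) (v (t + 1))
  L : Type u
  toL : ∀ i, X i → L
  toL_π : ∀ i j h p, toL j (π i j h p) = toL i p
  toL_eq : ∀ i p q, toL i p = toL i q → ∃ j h, π i j h p = π i j h q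
  d : L → L → ℝ≥0∞
  d_cell : ∀ i, ∀ φ ∈ Φ i, ∀ a ∈ Y.closedCell i φ.cell, ∀ b ∈ Y.closedCell i φ.cell,
    d (toL i (φ.toFun a)) (toL i (φ.toFun b)) ≤ size m i
  d_lower : ∀ h : L → ℝ, (∀ i, ∀ φ ∈ Φ i, ∀ a ∈ Y.closedCell i φ.cell,
    ∀ b ∈ Y.closedCell i φ.cell,
      |h (toL i (φ.toFun a)) - h (toL i (φ.toFun b))| ≤ (m : ℝ) ^ (-i)) →
    ∀ p q, ENNReal.ofReal |h p - h q| ≤ d p q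

end

namespace LiftSystem

variable {n m mv H : ℕ} [NeZero n] (T : LiftSystem.{u} n m mv H)

/-- The point `ψ b` is close to the set `Z` of points of `X i`, in the coordinates of `ψ`: there is
a vertex in `Z` at a distance of at most `θ` sides in the vertical directions, and in the
horizontal direction, either this vertex is at a distance of at most `s` sides, or also the
horizontally opposite vertex lies in `Z`. -/
def NearAt (i : ℤ) (Z : Set (T.X i)) (s θ : ℝ) (ψ : CharMap n (T.X i))
    (b : EuclideanSpace ℝ (Fin n)) : Prop :=
  ∃ w ∈ T.Y.closedCell i ψ.cell, T.Y.IsLat i w ∧ ψ.toFun w ∈ Z ∧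
    (∀ k : Fin n, k ≠ 0 → |b k - w k| ≤ θ * side m mv i k) ∧
    (|b 0 - w 0| ≤ s * side (n := n) m mv i 0 ∨
      ∃ w' ∈ T.Y.closedCell i ψ.cell, T.Y.IsLat i w' ∧ ψ.toFun w' ∈ Z ∧
        (∀ k : Fin n, k ≠ 0 → w' k = w k) ∧ w' 0 ≠ w 0)

/-- `NearAt` in some representation of the point `y`. -/
def Near (i : ℤ) (Z : Set (T.X i)) (s θ : ℝ) (y : T.X i) : Prop :=
  ∃ φ ∈ T.Φ i, ∃ a ∈ T.Y.closedCell i φ.cell, φ.toFun a = y ∧ T.NearAt i Z s θ φ a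

variable {T}

/-- The notion `Near` does not depend on the representation of the point: symmetries of the tiling
preserve it, and for `s, θ < 1` the vertices concerned lie in the carrier of the point. -/
theorem Near.nearAt (hm : 2 ≤ m) (hmv : m ≤ mv) {i : ℤ} {Z : Set (T.X i)} {s θ : ℝ} {y : T.X i}
    (h : T.Near i Z s θ y) (hs0 : 0 ≤ s) (hs : s < 1) (hθ : θ < 1) {ψ : CharMap n (T.X i)}
    (hψ : ψ ∈ T.Φ i) {b : EuclideanSpace ℝ (Fin n)} (hb : b ∈ T.Y.closedCell i ψ.cell)
    (hby : ψ.toFun b = y) : T.NearAt i Z s θ ψ b := by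
  obtain ⟨φ, hφ, a, ha, hay, w, hw, hwl, hwZ, hwv, hwh⟩ := h
  obtain ⟨g, hg, hga, htr⟩ := T.transfer i φ hφ ψ hψ a ha b hb (hay.trans hby.symm)
  have hsp := side_pos (n := n) hm hmv i
  have hlt : ∀ {x c : ℝ} {k}, |x| ≤ c * side m mv i k → c < 1 → |x| < side m mv i k :=
    fun h1 h2 => h1.trans_lt (by nlinarith [hsp (by assumption)])
  have hvert : ∀ k : Fin n, k ≠ 0 → |a k - w k| < side m mv i k := fun k hk => hlt (hwv k hk) hθ
  have single : ∀ v ∈ T.Y.closedCell i φ.cell, T.Y.IsLat i v → φ.toFun v ∈ Z →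
      (∀ k : Fin n, k ≠ 0 → v k = w k) → |a 0 - v 0| ≤ s * side (n := n) m mv i 0 → T.NearAt i Z s θ ψ b := by
    intro v hv hvl hvZ hvw hv0
    obtain ⟨h1, h2⟩ := htr v hv hvl fun k => by
      by_cases hk : k = 0
      · subst hk; exact hlt hv0 hs
      · rw [hvw k hk]; exact hvert k hk
    refine ⟨g v, h1, hg.isLat _ hvl, h2 ▸ hvZ, fun k hk => ?_, Or.inl ?_⟩
    · rw [← hga]
      exact hg.bound (fun k hk => by rw [hvw k hk]; exact hwv k hk) k hk
    · rw [← hga, hg.fst, hg.fst]; exact hv0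
  rcases hwh with hwh | ⟨w', hw', hwl', hwZ', hww, hne⟩
  · exact single w hw hwl hwZ (fun _ _ => rfl) hwh
  · by_cases h0 : a 0 = w 0
    · exact single w hw hwl hwZ (fun _ _ => rfl) (by rw [h0]; simpa using mul_nonneg hs0 (hsp 0).le)
    by_cases h0' : a 0 = w' 0
    · exact single w' hw' hwl' hwZ' hww (by rw [h0']; simpa using mul_nonneg hs0 (hsp 0).le)
    have key : ∀ v ∈ T.Y.closedCell i φ.cell, T.Y.IsLat i v → (∀ k : Fin n, k ≠ 0 → v k = w k) →
        (∀ k : Fin n, k ≠ 0 → |a k - v k| < side m mv i k) := fun v _ _ h k hk => by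
      rw [h k hk]; exact hvert k hk
    have hA := T.Y.mem_closedCell.1 ha 0
    have hW := T.Y.mem_closedCell.1 hw 0
    have hW' := T.Y.mem_closedCell.1 hw' 0
    have hdist := T.Y.abs_sub_le_side hw hw' hm hmv 0
    have hhi : T.Y.hi i φ.cell 0 ≤ T.Y.lo i φ.cell 0 + side (n := n) m mv i 0 := by
      unfold Tilings.hi; split_ifs <;> linarith [hsp 0]
    have hends : ∀ v ∈ T.Y.closedCell i φ.cell, T.Y.IsLat i v → a 0 ≠ v 0 →
        |a 0 - v 0| < side (n := n) m mv i 0 := by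
      intro v hv hvl hav
      refine lt_of_le_of_ne (T.Y.abs_sub_le_side ha hv hm hmv 0) fun he => ?_
      have hV := T.Y.mem_closedCell.1 hv 0
      rcases lt_or_gt_of_ne hne with hlt | hlt
      · have := (hwl' 0).gap (hsp 0) (hwl 0) hlt
        rcases abs_cases (a 0 - v 0) with h | h
        · exact h0 (by linarith)
        · exact h0' (by linarith)
      · have := (hwl 0).gap (hsp 0) (hwl' 0) hlt
        rcases abs_cases (a 0 - v 0) with h | h
        · exact h0' (by linarith)
        · exact h0 (by linarith)
    have hall : ∀ v ∈ T.Y.closedCell i φ.cell, T.Y.IsLat i v → (∀ k : Fin n, k ≠ 0 → v k = w k) →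
        a 0 ≠ v 0 → ∀ k, |a k - v k| < side m mv i k := by
      intro v hv hvl hvw hav k
      by_cases hk : k = 0
      · subst hk; exact hends v hv hvl hav
      · exact key v hv hvl hvw k hk
    obtain ⟨h1, h2⟩ := htr w hw hwl (hall w hw hwl (fun _ _ => rfl) h0)
    obtain ⟨h1', h2'⟩ := htr w' hw' hwl' (hall w' hw' hwl' hww h0')
    refine ⟨g w, h1, hg.isLat _ hwl, h2 ▸ hwZ, fun k hk => ?_, Or.inr ⟨g w', h1', hg.isLat _ hwl',
      h2' ▸ hwZ', hg.eq_of_eq hww, by rwa [hg.fst, hg.fst]⟩⟩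
    rw [← hga]
    exact hg.bound hwv k hk

theorem Near.step (hm : 2 ≤ m) (hmv : m ≤ mv) {i : ℤ} {Z : Set (T.X i)} {s θ σ δ : ℝ}
    {ψ : CharMap n (T.X i)} (hψ : ψ ∈ T.Φ i) {b b' : EuclideanSpace ℝ (Fin n)}
    (hb : b ∈ T.Y.closedCell i ψ.cell) (hb' : b' ∈ T.Y.closedCell i ψ.cell)
    (h : T.Near i Z s θ (ψ.toFun b)) (hs0 : 0 ≤ s) (hs : s < 1) (hθ : θ < 1)
    (hδ : ∀ k : Fin n, k ≠ 0 → |b' k - b k| ≤ δ * side m mv i k)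
    (hσ : |b' 0 - b 0| ≤ σ * side (n := n) m mv i 0) : T.Near i Z (s + σ) (θ + δ) (ψ.toFun b') := by
  obtain ⟨w, hw, hwl, hwZ, hwv, hwh⟩ := h.nearAt hm hmv hs0 hs hθ hψ hb rfl
  refine ⟨ψ, hψ, b', hb', rfl, w, hw, hwl, hwZ, fun k hk => ?_, hwh.imp_left fun h => ?_⟩
  · have := abs_sub_le (b' k) (b k) (w k)
    linarith [hδ k hk, hwv k hk]
  · have := abs_sub_le (b' 0) (b 0) (w 0)
    linarith

theorem Near.mono {i : ℤ} (hm : 2 ≤ m) (hmv : m ≤ mv) {Z Z' : Set (T.X i)} {s s' θ θ' : ℝ}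
    {y : T.X i} (h : T.Near i Z s θ y) (hZ : Z ⊆ Z') (hs : s ≤ s') (hθ : θ ≤ θ') :
    T.Near i Z' s' θ' y := by
  obtain ⟨φ, hφ, a, ha, hay, w, hw, hwl, hwZ, hwv, hwh⟩ := h
  have hsp := side_pos (n := n) hm hmv i
  refine ⟨φ, hφ, a, ha, hay, w, hw, hwl, hZ hwZ, fun k hk => (hwv k hk).trans ?_, hwh.imp ?_ ?_⟩
  · exact mul_le_mul_of_nonneg_right hθ (hsp k).le
  · exact fun h => h.trans (mul_le_mul_of_nonneg_right hs (hsp 0).le)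
  · rintro ⟨w', h1, h2, h3, h4⟩
    exact ⟨w', h1, h2, hZ h3, h4⟩

/-- All points of a cell with all its points in `Z` are near `Z`. -/
theorem near_of_cell (hm : 2 ≤ m) (hmv : m ≤ mv) {i : ℤ} {Z : Set (T.X i)}
    {φ : CharMap n (T.X i)} (hφ : φ ∈ T.Φ i)
    (hZ : ∀ a ∈ T.Y.closedCell i φ.cell, φ.toFun a ∈ Z) {a : EuclideanSpace ℝ (Fin n)}
    (ha : a ∈ T.Y.closedCell i φ.cell) : T.Near i Z 0 (1 / 2) (φ.toFun a) := by
  obtain ⟨w, hw, hwl, haw⟩ := T.Y.exists_near_vertex hm hmv le_rfl ha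
  refine ⟨φ, hφ, a, ha, rfl, w, hw, hwl, hZ _ hw, fun k _ => by linarith [haw k], ?_⟩
  by_cases h0 : (0 : Fin n) ∈ φ.cell.dirs
  · right
    have hsp := side_pos (n := n) hm hmv i 0
    -- The vertex horizontally opposite to `w`.
    let w' : EuclideanSpace ℝ (Fin n) := WithLp.toLp 2 (Function.update w 0
      (T.Y.lo i φ.cell 0 + T.Y.hi i φ.cell 0 - w 0))
    have hw0 : w' 0 = T.Y.lo i φ.cell 0 + T.Y.hi i φ.cell 0 - w 0 := by simp [w']
    have hwk : ∀ k : Fin n, k ≠ 0 → w' k = w k := fun k hk => by simp [w', hk]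
    have hW := T.Y.mem_closedCell.1 hw
    have hends : w 0 = T.Y.lo i φ.cell 0 ∨ w 0 = T.Y.hi i φ.cell 0 := by
      rcases (hW 0).1.eq_or_lt with h | h
      · exact Or.inl h.symm
      · right
        have := (T.Y.latCoord_lo i φ.cell 0).gap hsp (hwl 0) h
        refine le_antisymm (hW 0).2 ?_
        simpa [Tilings.hi, h0] using this
    have hlh : T.Y.lo i φ.cell 0 < T.Y.hi i φ.cell 0 := by simp [Tilings.hi, h0, hsp]
    refine ⟨w', T.Y.mem_closedCell.2 fun k => ?_, fun k => ?_, hZ w' ?_, hwk, ?_⟩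
    · by_cases hk : k = 0
      · subst hk; rw [hw0]; constructor <;> linarith [(hW 0).1, (hW 0).2]
      · rw [hwk k hk]; exact hW k
    · by_cases hk : k = 0
      · subst hk
        rw [hw0]
        rcases hends with h | h
        · rw [h, add_sub_cancel_left]; exact T.Y.latCoord_hi i φ.cell 0
        · rw [h, add_sub_cancel_right]; exact T.Y.latCoord_lo i φ.cell 0
      · rw [hwk k hk]; exact hwl k
    · refine T.Y.mem_closedCell.2 fun k => ?_
      by_cases hk : k = 0
      · subst hk; rw [hw0]; constructor <;> linarith [(hW 0).1, (hW 0).2]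
      · rw [hwk k hk]; exact hW k
    · rw [hw0]
      rcases hends with h | h <;> rw [h] <;> linarith
  · left
    rw [(ha 0).2 h0, (hw 0).2 h0]
    simp

/-- A vertical path of `l` small steps increases the vertical distance by at most `l / mv` sides. -/
theorem Near.path (hm : 2 ≤ m) (hmv : m ≤ mv) {i : ℤ} {Z : Set (T.X i)} {s θ : ℝ}
    (hs0 : 0 ≤ s) (hs : s < 1) {v : ℕ → T.X i} {l : ℕ} (hθ : θ + l / mv < 1)
    (h : T.Near i Z s θ (v 0)) (hv : ∀ t < l, VStep T.Y i (T.Φ i) (v t) (v (t + 1))) :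
    T.Near i Z s (θ + l / mv) (v l) := by
  have hmv0 : (0 : ℝ) < mv := by exact_mod_cast (by lia : 0 < mv)
  induction l with
  | zero => simpa using h
  | succ l ih =>
    obtain ⟨φ, hφ, a, ha, b, hb, hal, hbl, h0, hk⟩ := hv l (Nat.lt_succ_self l)
    have hl : θ + (l : ℝ) / mv < 1 := by
      refine lt_of_le_of_lt ?_ hθ
      push_cast
      gcongr
      linarith
    have h1 := ih hl fun t ht => hv t (ht.trans (Nat.lt_succ_self l))
    rw [← hal] at h1
    have h2 := Near.step (σ := 0) (δ := 1 / mv) hm hmv hφ ha hb h1 hs0 hs hl (fun k hk' => ?_) (by simp [h0])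
    · rw [← hbl]
      convert h2 using 1
      · simp
      · push_cast; ring
    · rw [abs_sub_comm, side_succ hm hmv i k]
      simp only [ratio, hk', if_false]
      rw [← mul_assoc, one_div, inv_mul_cancel₀ hmv0.ne', one_mul]
      exact hk k hk'

/-- Two points over the same vertex of generation `i + 1` are joined by a vertical path of at most
`H` steps, so both are near `Z` if one of them is. -/
theorem Near.fiber (hm : 2 ≤ m) (hmv : m ≤ mv) {i : ℤ} {Z : Set (T.X i)} {s θ : ℝ}
    (hs0 : 0 ≤ s) (hs : s < 1) (hθ : θ + H / mv < 1) {ψ : CharMap n (T.X (i + 1))}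
    (hψ : ψ ∈ T.Φ (i + 1)) {w : EuclideanSpace ℝ (Fin n)}
    (hw : w ∈ T.Y.closedCell (i + 1) ψ.cell) (hwl : T.Y.IsLat (i + 1) w) {y y' : T.X i}
    (hy : T.π i (i + 1) (by lia) y = ψ.toFun w) (hy' : T.π i (i + 1) (by lia) y' = ψ.toFun w)
    (h : T.Near i Z s θ y) : T.Near i Z s (θ + H / mv) y' := by
  obtain ⟨l, hl, v, hv0, hvl, hv⟩ := T.fiber i ψ hψ w hw hwl y y' hy hy'
  have hle : θ + (l : ℝ) / mv ≤ θ + H / mv := by gcongr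
  rw [← hv0] at h
  rw [← hvl]
  exact (Near.path hm hmv hs0 hs (hle.trans_lt hθ) h hv).mono hm hmv subset_rfl le_rfl hle

theorem subdiv_of_le (hm : 2 ≤ m) (hmv : m ≤ mv) {g i : ℤ} (hgi : g ≤ i) {φ : CharMap n (T.X g)}
    (hφ : φ ∈ T.Φ g) {c : GridCell n} (hc : T.Y.closedCell i c ⊆ T.Y.closedCell g φ.cell) :
    ⟨c, fun p => T.π g i hgi (φ.toFun p)⟩ ∈ T.Φ i := by
  induction i, hgi using Int.leInduction generalizing c with
  | base =>
    simpa only [T.π_self] using T.face g φ hφ c hc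
  | succ i hgi ih =>
    obtain ⟨e, h1, h2⟩ := T.Y.exists_between hm hmv hgi (by lia : i ≤ i + 1) hc
    have := T.subdiv i _ (ih h2) c h1
    simpa only [T.π_π] using this

end LiftSystem

/-! ### Intersections of cells with nearby points -/

namespace LiftSystem

variable {n m mv H : ℕ} [NeZero n] (T : LiftSystem.{u} n m mv H)

/-- The points of `X K` that can be reached from `A` by a chain of images of cells of generations
at most `K` of total cost `c`, where a cell of generation `g` costs `m ^ (K - g)`. -/
inductive Reach (K : ℤ) (A : Set (T.X K)) : ℕ → T.X K → Prop
  | base {p : T.X K} (hp : p ∈ A) : Reach K A 0 p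
  | step {c : ℕ} {g : ℤ} (hg : g ≤ K) {φ : CharMap n (T.X g)} (hφ : φ ∈ T.Φ g)
      {a b : EuclideanSpace ℝ (Fin n)} (ha : a ∈ T.Y.closedCell g φ.cell)
      (hb : b ∈ T.Y.closedCell g φ.cell) (h : Reach K A c (T.π g K hg (φ.toFun a))) :
      Reach K A (c + m ^ (K - g).toNat) (T.π g K hg (φ.toFun b))

/-- There is a vertex `v` of the carrier of the point `z` of `X (i + 1)` such that all points of
`X i` over `v` are near `Z`. -/
def Anchored (i : ℤ) (Z : Set (T.X i)) (s θ : ℝ) (z : T.X (i + 1)) : Prop :=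
  ∃ ψ ∈ T.Φ (i + 1), ∃ b ∈ T.Y.closedCell (i + 1) ψ.cell, ψ.toFun b = z ∧
    ∃ v ∈ T.Y.closedCell (i + 1) ψ.cell, T.Y.IsLat (i + 1) v ∧
      (∀ k, |b k - v k| < side m mv (i + 1) k) ∧
      ∀ y, T.π i (i + 1) (by lia) y = ψ.toFun v → T.Near i Z s θ y

variable {T}

theorem Anchored.exists_vertex {i : ℤ} {Z : Set (T.X i)} {s θ : ℝ} {z : T.X (i + 1)}
    (h : T.Anchored i Z s θ z) {ψ : CharMap n (T.X (i + 1))} (hψ : ψ ∈ T.Φ (i + 1))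
    {b : EuclideanSpace ℝ (Fin n)} (hb : b ∈ T.Y.closedCell (i + 1) ψ.cell)
    (hbz : ψ.toFun b = z) : ∃ v ∈ T.Y.closedCell (i + 1) ψ.cell, T.Y.IsLat (i + 1) v ∧
      ∀ y, T.π i (i + 1) (by lia) y = ψ.toFun v → T.Near i Z s θ y := by
  obtain ⟨ψ₀, hψ₀, b₀, hb₀, hz₀, v₀, hv₀, hvl, hbv, hnear⟩ := h
  obtain ⟨g, hg, -, htr⟩ := T.transfer _ ψ₀ hψ₀ ψ hψ b₀ hb₀ b hb (hz₀.trans hbz.symm)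
  obtain ⟨h1, h2⟩ := htr v₀ hv₀ hvl hbv
  exact ⟨g v₀, h1, hg.isLat _ hvl, fun y hy => hnear y (hy.trans h2)⟩

theorem Anchored.mono (hm : 2 ≤ m) (hmv : m ≤ mv) {i : ℤ} {Z Z' : Set (T.X i)} {s s' θ θ' : ℝ}
    {z : T.X (i + 1)} (h : T.Anchored i Z s θ z) (hZ : Z ⊆ Z') (hs : s ≤ s') (hθ : θ ≤ θ') :
    T.Anchored i Z' s' θ' z := by
  obtain ⟨ψ₀, hψ₀, b₀, hb₀, hz₀, v₀, hv₀, hvl, hbv, hnear⟩ := h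
  exact ⟨ψ₀, hψ₀, b₀, hb₀, hz₀, v₀, hv₀, hvl, hbv, fun y hy => (hnear y hy).mono hm hmv hZ hs hθ⟩

theorem half_lt_side (hm : 2 ≤ m) (hmv : m ≤ mv) {i : ℤ} {a v : EuclideanSpace ℝ (Fin n)}
    (h : ∀ k, |a k - v k| ≤ side m mv i k / 2) (k : Fin n) : |a k - v k| < side m mv i k :=
  (h k).trans_lt (by linarith [side_pos hm hmv i k])

theorem anchored_of_cell (hm : 2 ≤ m) (hmv : m ≤ mv) (hH : (1 : ℝ) / 2 + H / mv < 1) {i : ℤ}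
    {Z : Set (T.X i)} {φ : CharMap n (T.X i)} (hφ : φ ∈ T.Φ i)
    (hZ : ∀ a ∈ T.Y.closedCell i φ.cell, φ.toFun a ∈ Z) {a : EuclideanSpace ℝ (Fin n)}
    (ha : a ∈ T.Y.closedCell i φ.cell) :
    T.Anchored i Z 0 (1 / 2 + H / mv) (T.π i (i + 1) (by lia) (φ.toFun a)) := by
  obtain ⟨c, -, hc, hac⟩ := T.Y.exists_subcell hm hmv (by lia : i ≤ i + 1) ha
  have hψ := T.subdiv i φ hφ c hc
  obtain ⟨v, hv, hvl, hav⟩ := T.Y.exists_near_vertex hm hmv (le_refl (i + 1)) hac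
  refine ⟨_, hψ, a, hac, rfl, v, hv, hvl, half_lt_side hm hmv hav, fun y hy => ?_⟩
  exact Near.fiber hm hmv le_rfl one_pos hH hψ hv hvl rfl hy
    (near_of_cell hm hmv hφ hZ (hc hv))

/-- A chain of cost `c` in `X (i + 1)` is lifted to `X i`: up to a vertical error it follows a chain
of cost `c / m`, whose last vertex is at a horizontal distance of at most `(c % m) / m` sides. The
vertical error grows by at most `(H + 1) / mv` with each cell of generation `i + 1`; it starts at
`1 / 2` anew whenever a whole cell of generation `i` has been reached, and `2 (m + 1) (H + 1) < mv`
keeps it below `1`. -/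
theorem Reach.anchored (hm : 2 ≤ m) (hmv : m ≤ mv) (hH : 2 * (m + 1) * (H + 1) < mv) {i : ℤ}
    {A : Set (T.X i)}
    (hA : ∀ p ∈ A, ∃ φ ∈ T.Φ i, (∃ a ∈ T.Y.closedCell i φ.cell, φ.toFun a = p) ∧
      ∀ a ∈ T.Y.closedCell i φ.cell, φ.toFun a ∈ A) {c : ℕ} {z : T.X (i + 1)}
    (h : T.Reach (i + 1) (T.π i (i + 1) (by lia) '' A) c z) :
    T.Anchored i {p | T.Reach i A (c / m) p} ((c % m : ℕ) / m)
      (1 / 2 + ((c % m : ℕ) + 1) * ((H + 1) / mv)) z := by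
  have hm0 : (0 : ℝ) < m := by exact_mod_cast (by lia : 0 < m)
  have hmv0 : (0 : ℝ) < mv := by exact_mod_cast (by lia : 0 < mv)
  have hH' : 2 * ((m : ℝ) + 1) * (H + 1) < mv := by exact_mod_cast hH
  have hκ : 0 ≤ ((H : ℝ) + 1) / mv := by positivity
  have hHκ : (H : ℝ) / mv ≤ (H + 1) / mv := by gcongr; linarith
  have hmκ : ((m : ℝ) + 1) * ((H + 1) / mv) < 1 / 2 := by
    rw [← mul_div_assoc, div_lt_iff₀ hmv0]; linarith
  have hmod : ∀ c : ℕ, ((c % m : ℕ) : ℝ) + 1 ≤ m := fun c => by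
    exact_mod_cast Nat.mod_lt c (by lia : 0 < m)
  have hsc : ∀ c : ℕ, ((c % m : ℕ) : ℝ) / m < 1 := fun c => by
    rw [div_lt_one hm0]; linarith [hmod c]
  have hθc : ∀ c : ℕ, 1 / 2 + (((c % m : ℕ) : ℝ) + 1) * ((H + 1) / mv) + (H + 1) / mv < 1 := by
    intro c
    nlinarith [hmod c]
  have hθ0 : (1 : ℝ) / 2 + H / mv < 1 := by nlinarith
  have hs0 : ∀ c : ℕ, 0 ≤ ((c % m : ℕ) : ℝ) / m := fun c => by positivity
  have hθ1 : ∀ c : ℕ, 1 / 2 + (H : ℝ) / mv ≤ 1 / 2 + (((c % m : ℕ) : ℝ) + 1) * ((H + 1) / mv) := by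
    intro c
    have : (0 : ℝ) ≤ (c % m : ℕ) := Nat.cast_nonneg _
    nlinarith
  induction h with
  | base hp =>
    obtain ⟨p, hp, rfl⟩ := hp
    obtain ⟨φ, hφ, ⟨a, ha, rfl⟩, hφA⟩ := hA p hp
    exact (anchored_of_cell hm hmv hθ0 hφ hφA ha).mono hm hmv
      (fun q hq => by simpa using Reach.base hq) (hs0 0) (hθ1 0)
  | @step c g hg φ hφ a b ha hb h ih =>
    rcases eq_or_lt_of_le hg with rfl | hlt
    · simp only [T.π_self, sub_self, Int.toNat_zero, pow_zero] at ih ⊢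
      obtain ⟨v, hv, hvl, hnear⟩ := ih.exists_vertex hφ ha rfl
      obtain ⟨φ₀, hφ₀, hsub, hφφ⟩ := T.subdiv_surj i φ hφ
      have h1 := hnear (φ₀.toFun v) (hφφ v hv).symm
      obtain ⟨v', hv', hvl', hbv⟩ := T.Y.exists_near_vertex hm hmv (le_refl (i + 1)) hb
      refine ⟨φ, hφ, b, hb, rfl, v', hv', hvl', half_lt_side hm hmv hbv, fun y hy => ?_⟩
      have hle : c % m + 1 ≤ m := Nat.mod_lt c (by lia : 0 < m)
      rcases lt_or_eq_of_le hle with hlt | heq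
      · have e1 : (c + 1) % m = c % m + 1 := by
          rw [Nat.add_mod, Nat.mod_eq_of_lt (a := 1) (by lia), Nat.mod_eq_of_lt hlt]
        have e2 : (c + 1) / m = c / m := Nat.succ_div_of_not_dvd fun hd => by
          have := Nat.mod_eq_zero_of_dvd hd
          lia
        have hd := fun k => T.Y.abs_sub_le_side hv' hv hm hmv k
        have h2 := Near.step (σ := 1 / m) (δ := 1 / mv) hm hmv hφ₀ (hsub hv) (hsub hv') h1
          (hs0 c) (hsc c) (by linarith [hθc c]) (fun k hk => by
            refine (hd k).trans_eq ?_
            rw [side_succ hm hmv i k]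
            simp only [ratio, hk, if_false]
            field_simp) (by
            refine (hd 0).trans_eq ?_
            rw [side_succ hm hmv i 0]
            simp only [ratio, if_true]
            field_simp)
        by_cases hlast : ((c % m : ℕ) : ℝ) / m + 1 / m < 1
        · have h3 := Near.fiber hm hmv (by have := hs0 c; positivity) hlast (by
            have := hθc c
            rw [add_div] at this ⊢
            linarith) hφ hv' hvl' (hφφ v' hv').symm hy h2
          rw [e1, e2]
          convert h3 using 1 <;> push_cast <;> ring
        · exfalso
          apply hlast
          rw [← add_div, div_lt_one hm0]
          exact_mod_cast hlt
      · -- After `m` steps, the current cell of generation `i` is used to start afresh.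
        have e2 : (c + 1) / m = c / m + 1 := Nat.succ_div_of_dvd (by
          rw [← Nat.div_add_mod c m, add_assoc, heq]
          exact (Dvd.intro _ rfl).add dvd_rfl)
        obtain ⟨w, hw, -, hwZ, -⟩ := h1.nearAt hm hmv (hs0 c) (hsc c) (by linarith [hθc c]) hφ₀
          (hsub hv) rfl
        have hall : ∀ x ∈ T.Y.closedCell i φ₀.cell, φ₀.toFun x ∈
            {p | T.Reach i A ((c + 1) / m) p} := by
          intro x hx
          have := Reach.step (T := T) (A := A) (c := c / m) le_rfl hφ₀ hw hx
            (by rw [T.π_self]; exact hwZ)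
          simpa only [T.π_self, sub_self, Int.toNat_zero, pow_zero, e2, mem_ofPred_eq] using this
        exact (Near.fiber hm hmv le_rfl one_pos hθ0 hφ hv' hvl' (hφφ v' hv').symm hy
          (near_of_cell hm hmv hφ₀ hall (hsub hv'))).mono hm hmv subset_rfl (hs0 _) (hθ1 _)
    · have hgi : g ≤ i := by lia
      obtain ⟨c₁, -, hc₁, hac₁⟩ := T.Y.exists_subcell hm hmv hgi ha
      obtain ⟨c₂, -, hc₂, hac₂⟩ := T.Y.exists_subcell hm hmv (by lia : i ≤ i + 1) hac₁
      have hφ₁ := T.subdiv_of_le hm hmv hgi hφ hc₁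
      obtain ⟨v, hv, -, hnear⟩ := ih.exists_vertex (T.subdiv i _ hφ₁ c₂ hc₂) hac₂ (T.π_π ..)
      obtain ⟨w, hw, -, hwZ, -⟩ := (hnear _ rfl).nearAt hm hmv (hs0 c) (hsc c)
        (by linarith [hθc c]) hφ₁ (hc₂ hv) rfl
      have e : m ^ (i + 1 - g).toNat = m ^ (i - g).toNat * m := by
        rw [← pow_succ]; congr 1; lia
      have e1 : (c + m ^ (i + 1 - g).toNat) % m = c % m := by rw [e, Nat.add_mul_mod_self_right]
      have e2 : (c + m ^ (i + 1 - g).toNat) / m = c / m + m ^ (i - g).toNat := by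
        rw [e, Nat.add_mul_div_right _ _ (by lia)]
      obtain ⟨c₃, -, hc₃, hbc₃⟩ := T.Y.exists_subcell hm hmv hgi hb
      have h2 := anchored_of_cell (Z := {p | T.Reach i A (c / m + m ^ (i - g).toNat) p}) hm hmv hθ0
        (T.subdiv_of_le hm hmv hgi hφ hc₃)
        (fun x hx => Reach.step hgi hφ (hc₁ hw) (hc₃ hx) hwZ) hbc₃
      rw [e1, e2]
      simp only [T.π_π] at h2
      exact h2.mono hm hmv subset_rfl (hs0 c) (hθ1 c)

/-- The image in `X K` of the closed cell of `X i` with characteristic map `φ`. -/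
def cellImage (T : LiftSystem.{u} n m mv H) {i : ℤ} (φ : CharMap n (T.X i)) {K : ℤ} (h : i ≤ K) :
    Set (T.X K) := {p | ∃ a ∈ T.Y.closedCell i φ.cell, T.π i K h (φ.toFun a) = p}

theorem exists_subcell_cellImage (hm : 2 ≤ m) (hmv : m ≤ mv) {i : ℤ} {φ : CharMap n (T.X i)}
    (hφ : φ ∈ T.Φ i) {K : ℤ} (h : i ≤ K) {p : T.X K} (hp : p ∈ T.cellImage φ h) :
    ∃ ψ ∈ T.Φ K, (∃ a ∈ T.Y.closedCell K ψ.cell, ψ.toFun a = p) ∧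
      ∀ a ∈ T.Y.closedCell K ψ.cell, ψ.toFun a ∈ T.cellImage φ h := by
  obtain ⟨a, ha, rfl⟩ := hp
  obtain ⟨c, -, hc, hac⟩ := T.Y.exists_subcell hm hmv h ha
  exact ⟨_, T.subdiv_of_le hm hmv h hφ hc, ⟨a, hac, rfl⟩, fun b hb => ⟨b, hc hb, rfl⟩⟩

theorem cellImage_succ {i : ℤ} (φ : CharMap n (T.X i)) {K : ℤ} (h : i ≤ K) :
    T.cellImage φ (h.trans (by lia : K ≤ K + 1)) = T.π K (K + 1) (by lia) '' T.cellImage φ h := by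
  ext p
  constructor
  · rintro ⟨a, ha, rfl⟩
    exact ⟨_, ⟨a, ha, rfl⟩, T.π_π ..⟩
  · rintro ⟨_, ⟨a, ha, rfl⟩, rfl⟩
    exact ⟨a, ha, (T.π_π ..).symm⟩

/-- Cells of `X i` whose images are joined by a chain of cost less than one cell of generation `i`
intersect. -/
theorem Reach.meet (hm : 2 ≤ m) (hmv : m ≤ mv) (hH : 2 * (m + 1) * (H + 1) < mv) {i : ℤ}
    {φ ψ : CharMap n (T.X i)} (hφ : φ ∈ T.Φ i) (hψ : ψ ∈ T.Φ i) {K : ℤ} (hK : i ≤ K) {c : ℕ}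
    (hc : c < m ^ (K - i).toNat) {z : T.X K} (h : T.Reach K (T.cellImage φ hK) c z)
    (hz : z ∈ T.cellImage ψ hK) :
    ∃ a ∈ T.Y.closedCell i φ.cell, ∃ b ∈ T.Y.closedCell i ψ.cell, φ.toFun a = ψ.toFun b := by
  have hm0 : (0 : ℝ) < m := by exact_mod_cast (by lia : 0 < m)
  have hmv0 : (0 : ℝ) < mv := by exact_mod_cast (by lia : 0 < mv)
  induction K, hK using Int.leInduction generalizing c with
  | base =>
    obtain rfl : c = 0 := by simpa using hc
    have : z ∈ T.cellImage φ le_rfl := by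
      generalize hc0 : 0 = c at h
      cases h with
      | base hp => exact hp
      | @step _ g hg =>
        have : 0 < m ^ (i - g).toNat := Nat.pow_pos (by lia)
        exact absurd hc0 (by lia)
    obtain ⟨a, ha, rfl⟩ := this
    obtain ⟨b, hb, hab⟩ := hz
    rw [T.π_self, T.π_self] at hab
    exact ⟨a, ha, b, hb, hab.symm⟩
  | succ K hK ih =>
    have hanch := Reach.anchored hm hmv hH
      (fun p hp => exists_subcell_cellImage hm hmv hφ hK hp) (cellImage_succ φ hK ▸ h)
    obtain ⟨b, hb, rfl⟩ := hz
    obtain ⟨c₁, -, hc₁, hbc₁⟩ := T.Y.exists_subcell hm hmv hK hb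
    obtain ⟨c₂, -, hc₂, hbc₂⟩ := T.Y.exists_subcell hm hmv (by lia : K ≤ K + 1) hbc₁
    have hψ₁ := T.subdiv_of_le hm hmv hK hψ hc₁
    obtain ⟨v, hv, -, hnear⟩ := hanch.exists_vertex (T.subdiv K _ hψ₁ c₂ hc₂) hbc₂ (T.π_π ..)
    have hmod : ((c % m : ℕ) : ℝ) + 1 ≤ m := by exact_mod_cast Nat.mod_lt c (by lia : 0 < m)
    obtain ⟨w, hw, -, hwZ, -⟩ := (hnear _ rfl).nearAt hm hmv (by positivity)
      (by rw [div_lt_one hm0]; linarith) (by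
        have hH' : 2 * ((m : ℝ) + 1) * (H + 1) < mv := by exact_mod_cast hH
        have hmκ : ((m : ℝ) + 1) * ((H + 1) / mv) < 1 / 2 := by
          rw [← mul_div_assoc, div_lt_iff₀ hmv0]; linarith
        have hκ : 0 ≤ ((H : ℝ) + 1) / mv := by positivity
        nlinarith) hψ₁ (hc₂ hv) rfl
    refine ih (c := c / m) ?_ hwZ ⟨w, hc₁ hw, rfl⟩
    rw [Nat.div_lt_iff_lt_mul (by lia), ← pow_succ]
    convert hc using 2
    lia

theorem Reach.push {i : ℤ} {φ : CharMap n (T.X i)} {K : ℤ} (hK : i ≤ K) {c : ℕ} {z : T.X K}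
    (h : T.Reach K (T.cellImage φ hK) c z) {j : ℤ} (hj : K ≤ j) :
    T.Reach j (T.cellImage φ (hK.trans hj)) (c * m ^ (j - K).toNat) (T.π K j hj z) := by
  induction h with
  | base hp =>
    obtain ⟨a, ha, rfl⟩ := hp
    rw [zero_mul]
    exact Reach.base ⟨a, ha, (T.π_π ..).symm⟩
  | @step c g hg χ hχ a b ha hb h ih =>
    rw [T.π_π] at ih ⊢
    convert Reach.step (hg.trans hj) hχ ha hb ih using 1
    rw [add_mul, ← pow_add]
    congr 2
    lia

theorem pow_toNat_mul (hm : 2 ≤ m) {K j : ℤ} (h : K ≤ j) :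
    (m : ℝ) ^ (j - K).toNat * (m : ℝ) ^ (-j) = (m : ℝ) ^ (-K) := by
  have hm0 : (m : ℝ) ≠ 0 := by exact_mod_cast (by lia : m ≠ 0)
  rw [← zpow_natCast, ← zpow_add₀ hm0]
  congr 1
  lia

/-- Cells of `X i` which contain points at distance less than `m ^ (-i)` in the limit
intersect. -/
theorem exists_meet (hm : 2 ≤ m) (hmv : m ≤ mv) (hH : 2 * (m + 1) * (H + 1) < mv) {i : ℤ}
    {φ ψ : CharMap n (T.X i)} (hφ : φ ∈ T.Φ i) (hψ : ψ ∈ T.Φ i) {a b : EuclideanSpace ℝ (Fin n)}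
    (ha : a ∈ T.Y.closedCell i φ.cell) (hb : b ∈ T.Y.closedCell i ψ.cell)
    (hd : T.d (T.toL i (φ.toFun a)) (T.toL i (ψ.toFun b)) < size m i) :
    ∃ a ∈ T.Y.closedCell i φ.cell, ∃ b ∈ T.Y.closedCell i ψ.cell, φ.toFun a = ψ.toFun b := by
  have hm1 : (1 : ℝ) ≤ m := by exact_mod_cast (by lia : 1 ≤ m)
  have hm0 : (0 : ℝ) < m := by linarith
  -- The truncated cost of reaching a point of the limit from the cell of `φ`.
  let V : T.L → Set ℝ := fun q => insert ((m : ℝ) ^ (-i))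
    {r | ∃ (K : ℤ) (hK : i ≤ K) (c : ℕ) (z : T.X K), T.Reach K (T.cellImage φ hK) c z ∧
      T.toL K z = q ∧ r = c * (m : ℝ) ^ (-K)}
  have hV0 : ∀ q, ∀ r ∈ V q, 0 ≤ r := by
    rintro q r (rfl | ⟨K, hK, c, z, -, -, rfl⟩) <;> positivity
  have hVb : ∀ q, BddBelow (V q) := fun q => ⟨0, hV0 q⟩
  have hVn : ∀ q, (V q).Nonempty := fun q => ⟨_, mem_insert _ _⟩
  let h : T.L → ℝ := fun q => sInf (V q)
  have h0 : ∀ q, 0 ≤ h q := fun q => le_csInf (hVn q) (hV0 q)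
  have h1 : ∀ q, h q ≤ (m : ℝ) ^ (-i) := fun q => csInf_le (hVb q) (mem_insert _ _)
  have hosc : ∀ g, ∀ χ ∈ T.Φ g, ∀ a ∈ T.Y.closedCell g χ.cell, ∀ b ∈ T.Y.closedCell g χ.cell,
      h (T.toL g (χ.toFun b)) ≤ h (T.toL g (χ.toFun a)) + (m : ℝ) ^ (-g) := by
    intro g χ hχ a ha b hb
    rcases le_total g i with hgi | hgi
    · have : (m : ℝ) ^ (-i) ≤ (m : ℝ) ^ (-g) := zpow_le_zpow_right₀ hm1 (by lia)
      linarith [h1 (T.toL g (χ.toFun b)), h0 (T.toL g (χ.toFun a))]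
    · rw [← sub_le_iff_le_add]
      refine le_csInf (hVn _) ?_
      rintro r (rfl | ⟨K, hK, c, z, hR, hz, rfl⟩)
      · have : 0 ≤ (m : ℝ) ^ (-g) := by positivity
        linarith [h1 (T.toL g (χ.toFun b))]
      · obtain ⟨j, hj, hjz⟩ := T.toL_eq (max K g) (T.π K _ (le_max_left _ _) z)
          (T.π g _ (le_max_right _ _) (χ.toFun a)) (by rw [T.toL_π, T.toL_π, hz])
        rw [T.π_π, T.π_π] at hjz
        have hKj : K ≤ j := (le_max_left _ _).trans hj
        have hgj : g ≤ j := (le_max_right _ _).trans hj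
        have hR' := hR.push hK hKj
        rw [hjz] at hR'
        have hR'' := Reach.step hgj hχ ha hb hR'
        have : h (T.toL g (χ.toFun b)) ≤
            ((c * m ^ (j - K).toNat + m ^ (j - g).toNat : ℕ) : ℝ) * (m : ℝ) ^ (-j) :=
          csInf_le (hVb _) (mem_insert_of_mem _ ⟨j, hK.trans hKj, _, _, hR'', T.toL_π .., rfl⟩)
        push_cast at this
        rw [add_mul, mul_assoc, pow_toNat_mul hm hKj, pow_toNat_mul hm hgj] at this
        linarith
  have hlow := T.d_lower h (fun g χ hχ a ha b hb => by
    rw [abs_le]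
    constructor <;> linarith [hosc g χ hχ a ha b hb, hosc g χ hχ b hb a ha])
    (T.toL i (φ.toFun a)) (T.toL i (ψ.toFun b))
  have hzero : h (T.toL i (φ.toFun a)) = 0 := by
    refine le_antisymm ?_ (h0 _)
    refine csInf_le (hVb _) (mem_insert_of_mem _ ⟨i, le_rfl, 0, φ.toFun a,
      Reach.base ⟨a, ha, T.π_self ..⟩, rfl, by simp⟩)
  have hlt := hlow.trans_lt hd
  rw [hzero, zero_sub, abs_neg, abs_of_nonneg (h0 _), size,
    ENNReal.ofReal_lt_ofReal_iff (by positivity)] at hlt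
  obtain ⟨r, hr, hrlt⟩ := exists_lt_of_csInf_lt (hVn _) hlt
  rcases hr with rfl | ⟨K, hK, c, z, hR, hz, rfl⟩
  · exact absurd hrlt (lt_irrefl _)
  · obtain ⟨j, hj, hjz⟩ := T.toL_eq K z (T.π i K hK (ψ.toFun b)) (by rw [T.toL_π, hz])
    rw [T.π_π] at hjz
    refine Reach.meet hm hmv hH hφ hψ (hK.trans hj) ?_ (hR.push hK hj) ⟨b, hb, hjz.symm⟩
    have hj0 : (0 : ℝ) < (m : ℝ) ^ (-j) := by positivity
    have : ((c * m ^ (j - K).toNat : ℕ) : ℝ) < ((m ^ (j - i).toNat : ℕ) : ℝ) := by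
      push_cast
      refine lt_of_mul_lt_mul_right ?_ hj0.le
      rwa [mul_assoc, pow_toNat_mul hm hj, pow_toNat_mul hm (hK.trans hj)]
    exact_mod_cast this

end LiftSystem

/-! ### The lift systems of the limit space and of the spaces `X j` -/

section PseudoDist

variable {X : Type*}

theorem largestPseudoDist_le {P : (X → X → ℝ≥0∞) → Prop} {x y : X} {r : ℝ≥0∞}
    (h : ∀ ρ, IsPseudoDist ρ → P ρ → ρ x y ≤ r) : largestPseudoDist P x y ≤ r :=
  iSup_le fun ρ => h ρ.1 ρ.2.1 ρ.2.2

theorem le_largestPseudoDist {P : (X → X → ℝ≥0∞) → Prop} {ρ : X → X → ℝ≥0∞}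
    (h : IsPseudoDist ρ) (hP : P ρ) (x y : X) : ρ x y ≤ largestPseudoDist P x y :=
  le_iSup (fun ρ : {ρ : X → X → ℝ≥0∞ // IsPseudoDist ρ ∧ P ρ} => ρ.1 x y) ⟨ρ, h, hP⟩

theorem isPseudoDist_edist_comp {Z : Type*} [PseudoEMetricSpace Z] (f : X → Z) :
    IsPseudoDist fun p q => edist (f p) (f q) :=
  ⟨fun _ => edist_self _, fun _ _ => edist_comm _ _, fun _ _ _ => edist_triangle _ _ _⟩

end PseudoDist

namespace System

variable {n m mv : ℕ} [NeZero n] (S : System.{u} n m mv) {Δ H : ℕ}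

theorem π_self (i : ℤ) (p : S.X i) : S.π i i le_rfl p = p := DirectedSystem.map_self' S.π p

theorem π_π {i j k : ℤ} (hij : i ≤ j) (hjk : j ≤ k) (p : S.X i) :
    S.π j k hjk (S.π i j hij p) = S.π i k (hij.trans hjk) p := DirectedSystem.map_map' S.π hij hjk p

/-- The characteristic maps of the cells of the subdivision of `X a` into cells of generation
`i`. -/
def subAt (a i : ℤ) : Set (CharMap n (S.X a)) :=
  {ψ | ∃ φ ∈ S.Φ a, S.Y.closedCell i ψ.cell ⊆ S.Y.closedCell a φ.cell ∧ ψ.toFun = φ.toFun}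

variable {S}

theorem IsAdmissible.subAt_self (hS : S.IsAdmissible Δ H) (a : ℤ) : S.subAt a a = S.Φ a := by
  ext ⟨c, f⟩
  constructor
  · rintro ⟨φ, hφ, hc, rfl⟩
    exact hS.compat_face a φ hφ c hc
  · exact fun h => ⟨_, h, subset_rfl, rfl⟩

theorem IsAdmissible.exists_mem_subAt (hS : S.IsAdmissible Δ H) (hm : 2 ≤ m) (hmv : m ≤ mv)
    {a i : ℤ} (hai : a ≤ i) (p : S.X a) :
    ∃ φ ∈ S.subAt a i, φ.cell.dirs = Finset.univ ∧ ∃ x ∈ S.Y.closedCell i φ.cell, φ.toFun x = p := by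
  obtain ⟨φ, ⟨hφ, hd⟩, x, hx, rfl⟩ := hS.union_topCells a p
  obtain ⟨c, hcd, hc, hxc⟩ := S.Y.exists_subcell hm hmv hai hx
  exact ⟨⟨c, φ.toFun⟩, ⟨φ, hφ, hc, rfl⟩, hcd.trans hd, x, hxc, rfl⟩

theorem subAt_face {a i : ℤ} {φ : CharMap n (S.X a)} (hφ : φ ∈ S.subAt a i) {c : GridCell n}
    (hc : S.Y.closedCell i c ⊆ S.Y.closedCell i φ.cell) : ⟨c, φ.toFun⟩ ∈ S.subAt a i := by
  obtain ⟨ψ, hψ, h1, h2⟩ := hφ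
  exact ⟨ψ, hψ, hc.trans h1, h2⟩

theorem subAt_sub {a i i' : ℤ} {φ : CharMap n (S.X a)} (hφ : φ ∈ S.subAt a i) {c : GridCell n}
    (hc : S.Y.closedCell i' c ⊆ S.Y.closedCell i φ.cell) : ⟨c, φ.toFun⟩ ∈ S.subAt a i' := by
  obtain ⟨ψ, hψ, h1, h2⟩ := hφ
  exact ⟨ψ, hψ, hc.trans h1, h2⟩

/-- The conclusion of `IsAdmissible.exists_gridMap` for cells of the subdivisions of `X a`, and for
the vertices in the carrier of `x`. -/
theorem IsAdmissible.transfer (hS : S.IsAdmissible Δ H) (hm : 2 ≤ m) (hmv : m ≤ mv)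
    {a i : ℤ} (hai : a ≤ i) {φ ψ : CharMap n (S.X a)} (hφ : φ ∈ S.subAt a i)
    (hψ : ψ ∈ S.subAt a i) {x y : EuclideanSpace ℝ (Fin n)} (hx : x ∈ S.Y.closedCell i φ.cell)
    (hy : y ∈ S.Y.closedCell i ψ.cell) (hxy : φ.toFun x = ψ.toFun y) :
    ∃ g, S.Y.IsGridMap i g ∧ g x = y ∧ ∀ w ∈ S.Y.closedCell i φ.cell,
      S.Y.IsLat i w → (∀ k, |x k - w k| < side m mv i k) →
        g w ∈ S.Y.closedCell i ψ.cell ∧ ψ.toFun (g w) = φ.toFun w := by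
  obtain ⟨φ', hφ', h1, h2⟩ := hφ
  obtain ⟨ψ', hψ', h3, h4⟩ := hψ
  rw [h2, h4] at hxy
  obtain ⟨g, hg, hgx, htr⟩ := hS.exists_gridMap hm hmv hφ' hψ' (h1 hx) (h3 hy) hxy
  have hgi := hg.of_le hm hmv hai
  refine ⟨g, hgi, hgx, fun w hw hwl hxw => ⟨?_, ?_⟩⟩
  · refine S.Y.mem_closedCell_of_near hm hmv hy (hgi.isLat w hwl) fun k => ?_
    rw [← hgx]
    by_cases hk : k = 0
    · subst hk; rw [hg.fst, hg.fst]; exact hxw 0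
    · simpa using hg.bound_lt (θ := 1) (i := i) (fun k _ => by simpa using hxw k) k hk
  · rw [h2, h4]
    refine (htr w (h1 hw) fun k hne hlat => hne ?_).2
    have hs := side_pos hm hmv i k
    have hl := S.Y.latCoord_of_le hm hmv hai hlat
    have := abs_lt.1 (hxw k)
    exact le_antisymm ((hwl k).le_of_lt_add hs hl (by linarith))
      (hl.le_of_lt_add hs (hwl k) (by linarith))

/-- `b` follows `a` in a truncation of the direct system at generation `i`: either the space does
not change, or it changes from `X i` to `X (i + 1)`. -/
def IsNext (i a b : ℤ) : Prop := b = a ∨ (a = i ∧ b = i + 1)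

theorem IsAdmissible.subAt_next (hS : S.IsAdmissible Δ H) {a b i : ℤ} (hab : a ≤ b)
    (h : IsNext i a b) {φ : CharMap n (S.X a)} (hφ : φ ∈ S.subAt a i) {c : GridCell n}
    (hc : S.Y.closedCell (i + 1) c ⊆ S.Y.closedCell i φ.cell) :
    ⟨c, fun p => S.π a b hab (φ.toFun p)⟩ ∈ S.subAt b (i + 1) := by
  rcases h with rfl | ⟨rfl, rfl⟩
  · simp only [S.π_self]
    exact subAt_sub hφ hc
  · rw [hS.subAt_self] at hφ ⊢
    exact hS.compat_subdiv _ φ hφ c hc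

theorem IsAdmissible.subAt_next_surj (hS : S.IsAdmissible Δ H) (hm : 2 ≤ m) (hmv : m ≤ mv)
    {a b i : ℤ} (hab : a ≤ b) (hai : a ≤ i) (h : IsNext i a b) {ψ : CharMap n (S.X b)}
    (hψ : ψ ∈ S.subAt b (i + 1)) : ∃ φ ∈ S.subAt a i,
      S.Y.closedCell (i + 1) ψ.cell ⊆ S.Y.closedCell i φ.cell ∧
      ∀ p ∈ S.Y.closedCell (i + 1) ψ.cell, ψ.toFun p = S.π a b hab (φ.toFun p) := by
  rcases h with rfl | ⟨rfl, rfl⟩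
  · obtain ⟨φ, hφ, h1, h2⟩ := hψ
    obtain ⟨e, h3, h4⟩ := S.Y.exists_between hm hmv hai (by lia : i ≤ i + 1) h1
    refine ⟨⟨e, φ.toFun⟩, ⟨φ, hφ, h4, rfl⟩, h3, fun p _ => ?_⟩
    rw [S.π_self, h2]
  · rw [hS.subAt_self] at hψ ⊢
    obtain ⟨φ, hφ, h1, h2⟩ := hS.compat_subdiv_surj _ ψ hψ
    exact ⟨φ, hφ, h1, fun p hp => h2 hp⟩

/-- The condition on fibres, in the form used for lift systems. -/
theorem IsAdmissible.fiber_path (hS : S.IsAdmissible Δ H) (hm : 2 ≤ m) (hmv : m ≤ mv)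
    {a b i : ℤ} (hab : a ≤ b) (h : IsNext i a b) {ψ : CharMap n (S.X b)}
    (hψ : ψ ∈ S.subAt b (i + 1)) {w : EuclideanSpace ℝ (Fin n)}
    (hw : w ∈ S.Y.closedCell (i + 1) ψ.cell) (hwl : S.Y.IsLat (i + 1) w) {y y' : S.X a}
    (hy : S.π a b hab y = ψ.toFun w) (hy' : S.π a b hab y' = ψ.toFun w) :
    ∃ l ≤ H, ∃ v : ℕ → S.X a, v 0 = y ∧ v l = y' ∧
      ∀ t < l, VStep S.Y i (S.subAt a i) (v t) (v (t + 1)) := by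
  rcases h with rfl | ⟨rfl, rfl⟩
  · rw [S.π_self] at hy hy'
    exact ⟨0, Nat.zero_le _, fun _ => y, rfl, hy.trans hy'.symm, fun t ht => absurd ht (by lia)⟩
  · rw [hS.subAt_self] at hψ
    obtain ⟨e, hed, hec, -⟩ := S.Y.exists_vertexCell hwl
    obtain ⟨l, hl, v, hv0, hvl, -, hv⟩ := hS.fiber a (ψ.toFun w)
      ⟨_, hS.compat_face _ ψ hψ e (by rw [hec]; simpa using hw), hed, w, by simp [hec], rfl⟩ y y' hy hy'
    refine ⟨l, hl, v, hv0, hvl, fun t ht => ?_⟩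
    obtain ⟨ε, ⟨φ, hφ, hsub, htf⟩, -, hvert, ⟨x, hx, hxv⟩, ⟨x', hx', hxv'⟩⟩ := hv t ht
    have hsub' : S.Y.closedCell (a + 1) ε.cell ⊆ S.Y.closedCell a φ.cell := hsub
    refine ⟨φ, hS.subAt_self a ▸ hφ, x, hsub' hx, x', hsub' hx', by rw [← htf, hxv],
      by rw [← htf, hxv'], ?_, fun k _ => S.Y.abs_sub_le_side hx hx' hm hmv k⟩
    rw [(hx 0).2 hvert, (hx' 0).2 hvert]

/-! #### The limit space -/

theorem edist_toLimit_le {i : ℤ} {φ : CharMap n (S.X i)} (hφ : φ ∈ S.Φ i) {p q : S.X i}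
    (hp : p ∈ S.Y.closedImage i φ) (hq : q ∈ S.Y.closedImage i φ) :
    edist (S.toLimit i p) (S.toLimit i q) ≤ size m i :=
  largestPseudoDist_le fun _ _ h => h i φ hφ p hp q hq

theorem toLimit_π {i j : ℤ} (h : i ≤ j) (p : S.X i) : S.toLimit j (S.π i j h p) = S.toLimit i p :=
  DirectLimit.mk_apply i j p h

theorem toLimit_eq {i : ℤ} {p q : S.X i} (h : S.toLimit i p = S.toLimit i q) :
    ∃ j, ∃ h : i ≤ j, S.π i j h p = S.π i j h q := by
  obtain ⟨j, h1, _, h2⟩ := Quotient.eq.1 h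
  exact ⟨j, h1, h2⟩

/-- The lift system of the limit space. -/
noncomputable def limitSystem (hm : 2 ≤ m) (hmv : m ≤ mv) (hS : S.IsAdmissible Δ H) :
    LiftSystem.{u} n m mv H where
  Y := S.Y
  X := S.X
  π i j h := S.π i j h
  π_self := S.π_self
  π_π _ _ _ := S.π_π
  Φ := S.Φ
  cover i p := by
    obtain ⟨φ, hφ, -, h⟩ := hS.exists_mem_subAt hm hmv (le_refl i) p
    exact ⟨φ, hS.subAt_self i ▸ hφ, h⟩
  face := hS.compat_face
  transfer i φ hφ ψ hψ x hx y hy hxy := hS.transfer hm hmv le_rfl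
    (hS.subAt_self i ▸ hφ) (hS.subAt_self i ▸ hψ) hx hy hxy
  subdiv := hS.compat_subdiv
  subdiv_surj i ψ hψ := by
    obtain ⟨φ, hφ, h1, h2⟩ := hS.compat_subdiv_surj _ ψ hψ
    exact ⟨φ, hφ, h1, fun p hp => h2 hp⟩
  fiber i ψ hψ w hw hwl y y' hy hy' := by
    have := hS.fiber_path hm hmv (by lia) (Or.inr ⟨rfl, rfl⟩) (hS.subAt_self _ ▸ hψ) hw hwl hy hy'
    rwa [hS.subAt_self] at this
  L := S.Limit
  toL := S.toLimit
  toL_π _ _ := toLimit_π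
  toL_eq _ _ _ := toLimit_eq
  d := edist
  d_cell i φ hφ a ha b hb := edist_toLimit_le hφ ⟨a, ha, rfl⟩ ⟨b, hb, rfl⟩
  d_lower h hh p q := by
    refine (le_of_eq ?_).trans (le_largestPseudoDist (isPseudoDist_edist_comp h) ?_ p q)
    · rw [edist_dist, Real.dist_eq]
    · rintro j φ hφ _ ⟨a, ha, rfl⟩ _ ⟨b, hb, rfl⟩
      simp only [edist_dist, Real.dist_eq]
      exact ENNReal.ofReal_le_ofReal (hh j φ hφ a ha b hb)

/-! #### The space `X j` as the limit of the truncated system -/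

/-- The projection to `X j`, with the metric `d j`. -/
def toFine (j : ℤ) {i : ℤ} (h : i ≤ j) (p : S.X i) : S.Fine j := S.π i j h p

theorem edist_fine_le {j i : ℤ} (h : i ≤ j) {φ : CharMap n (S.X i)} (hφ : φ ∈ S.Φ i) {p q : S.X i}
    (hp : p ∈ S.Y.closedImage i φ) (hq : q ∈ S.Y.closedImage i φ) :
    edist (toFine j h p) (toFine j h q) ≤ size m i :=
  largestPseudoDist_le fun _ _ hρ => (hρ.1 _ _).trans
    (largestPseudoDist_le fun _ _ h' => h' i h φ hφ p hp q hq)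

theorem edist_fine_le_sub {j i : ℤ} (h : j ≤ i) {φ : CharMap n (S.X j)} (hφ : φ ∈ S.subAt j i)
    {p q : S.X j} (hp : p ∈ S.Y.closedImage i φ) (hq : q ∈ S.Y.closedImage i φ) :
    edist (toFine j le_rfl p) (toFine j le_rfl q) ≤ size m i := by
  obtain ⟨k, rfl⟩ := Int.le.dest h
  simp only [toFine, S.π_self]
  exact largestPseudoDist_le fun _ _ hρ => hρ.2 k φ hφ p hp q hq

/-- A function oscillating by at most `m ^ (-i)` on the cells of generation `i` is `1`-Lipschitz
for the metric of `X j`. -/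
theorem le_edist_fine {j : ℤ} {ρ : S.X j → S.X j → ℝ≥0∞} (hρ : IsPseudoDist ρ)
    (h1 : ∀ i, ∀ h : i ≤ j, ∀ φ ∈ S.Φ i, ∀ p ∈ S.Y.closedImage i φ,
      ∀ q ∈ S.Y.closedImage i φ, ρ (S.π i j h p) (S.π i j h q) ≤ size m i)
    (h2 : ∀ i, j ≤ i → ∀ φ ∈ S.subAt j i, ∀ p ∈ S.Y.closedImage i φ,
      ∀ q ∈ S.Y.closedImage i φ, ρ p q ≤ size m i) (p q : S.Fine j) : ρ p q ≤ edist p q :=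
  le_largestPseudoDist hρ ⟨le_largestPseudoDist hρ h1, fun k φ hφ p hp q hq =>
    h2 (j + k) (by lia) φ hφ p hp q hq⟩ p q

theorem isNext_min (i j : ℤ) : IsNext i (min i j) (min (i + 1) j) := by
  unfold IsNext
  lia

/-- The lift system of `X j`, which is the limit of the direct system consisting of the spaces `X i`
for `i ≤ j` and the subdivisions of `X j`. -/
noncomputable def truncSystem (hm : 2 ≤ m) (hmv : m ≤ mv) (hS : S.IsAdmissible Δ H) (j : ℤ) :
    LiftSystem.{u} n m mv H where
  Y := S.Y
  X i := S.X (min i j)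
  π i i' h := S.π (min i j) (min i' j) (min_le_min_right j h)
  π_self i := S.π_self _
  π_π _ _ _ h h' := S.π_π (min_le_min_right j h) (min_le_min_right j h')
  Φ i := S.subAt (min i j) i
  cover i p := by
    obtain ⟨φ, hφ, -, h⟩ := hS.exists_mem_subAt hm hmv (min_le_left i j) p
    exact ⟨φ, hφ, h⟩
  face i φ hφ c hc := subAt_face hφ hc
  transfer i φ hφ ψ hψ x hx y hy hxy := hS.transfer hm hmv (min_le_left i j) hφ hψ hx hy hxy
  subdiv i φ hφ c hc := hS.subAt_next (by lia) (isNext_min i j) hφ hc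
  subdiv_surj i ψ hψ := hS.subAt_next_surj hm hmv (by lia) (by lia) (isNext_min i j) hψ
  fiber i ψ hψ w hw hwl y y' hy hy' := hS.fiber_path hm hmv _ (isNext_min i j) hψ hw hwl hy hy'
  L := S.Fine j
  toL i p := toFine j (min_le_right i j) p
  toL_π i i' h p := S.π_π _ _ p
  toL_eq i p q h := by
    refine ⟨max i j, le_max_left _ _, ?_⟩
    have key : ∀ b, ∀ hb : min i j ≤ b, b = j → S.π _ b hb p = S.π _ b hb q := by
      rintro b hb rfl
      exact h
    exact key _ _ (by lia)
  d := edist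
  d_cell i φ hφ a ha b hb := by
    have key : ∀ l, ∀ hl : l ≤ j, (i ≤ j ∧ l = i) ∨ (j ≤ i ∧ l = j) → ∀ φ ∈ S.subAt l i,
        ∀ a ∈ S.Y.closedCell i φ.cell, ∀ b ∈ S.Y.closedCell i φ.cell,
        edist (toFine j hl (φ.toFun a)) (toFine j hl (φ.toFun b)) ≤ size m i := by
      rintro l hl (⟨h, rfl⟩ | ⟨h, rfl⟩) φ hφ a ha b hb
      · rw [hS.subAt_self] at hφ
        exact edist_fine_le hl hφ ⟨a, ha, rfl⟩ ⟨b, hb, rfl⟩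
      · exact edist_fine_le_sub h hφ ⟨a, ha, rfl⟩ ⟨b, hb, rfl⟩
    exact key _ _ (by lia) φ hφ a ha b hb
  d_lower h hh p q := by
    have key : ∀ i l, ∀ hl : l ≤ j, l = min i j → ∀ φ ∈ S.subAt l i,
        ∀ a ∈ S.Y.closedCell i φ.cell, ∀ b ∈ S.Y.closedCell i φ.cell,
        edist (h (toFine j hl (φ.toFun a))) (h (toFine j hl (φ.toFun b))) ≤ size m i := by
      rintro i l hl rfl φ hφ a ha b hb
      rw [edist_dist, Real.dist_eq]
      exact ENNReal.ofReal_le_ofReal (hh i φ hφ a ha b hb)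
    refine (le_of_eq ?_).trans (le_edist_fine (isPseudoDist_edist_comp h) ?_ ?_ p q)
    · rw [edist_dist, Real.dist_eq]
    · rintro i hi φ hφ _ ⟨a, ha, rfl⟩ _ ⟨b, hb, rfl⟩
      exact key i i hi (by lia) φ (hS.subAt_self i ▸ hφ) a ha b hb
    · rintro i hi φ hφ _ ⟨a, ha, rfl⟩ _ ⟨b, hb, rfl⟩
      have := key i j le_rfl (by lia) φ hφ a ha b hb
      simpa only [toFine, S.π_self] using this

end System

namespace System

variable {n m mv : ℕ} [NeZero n] {S : System.{u} n m mv} {Δ H : ℕ}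

/-- Cells of `X i` which contain points at distance less than `m ^ (-i)` in the limit space
intersect. -/
theorem IsAdmissible.meet_of_edist_limit (hS : S.IsAdmissible Δ H) (hm : 2 ≤ m) (hmv : m ≤ mv)
    (hH : 2 * (m + 1) * (H + 1) < mv) {i : ℤ} {φ ψ : CharMap n (S.X i)} (hφ : φ ∈ S.Φ i)
    (hψ : ψ ∈ S.Φ i) {p q : S.X i} (hp : p ∈ S.Y.closedImage i φ) (hq : q ∈ S.Y.closedImage i ψ)
    (h : edist (S.toLimit i p) (S.toLimit i q) < size m i) :
    (S.Y.closedImage i φ ∩ S.Y.closedImage i ψ).Nonempty := by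
  obtain ⟨a, ha, rfl⟩ := hp
  obtain ⟨b, hb, rfl⟩ := hq
  obtain ⟨a', ha', b', hb', hab⟩ := (limitSystem hm hmv hS).exists_meet hm hmv hH hφ hψ ha hb h
  exact ⟨_, ⟨a', ha', rfl⟩, ⟨b', hb', hab.symm⟩⟩

/-- Cells of generation `i`, of `X i` if `i ≤ j` and of the subdivision of `X j` if `j ≤ i`,
intersect if they contain points whose images in `X j` have distance less than `m ^ (-i)`. -/
theorem IsAdmissible.meet_of_edist_fine (hS : S.IsAdmissible Δ H) (hm : 2 ≤ m) (hmv : m ≤ mv)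
    (hH : 2 * (m + 1) * (H + 1) < mv) {i j a : ℤ} (haj : a ≤ j) (ha : a = min i j)
    {φ ψ : CharMap n (S.X a)} (hφ : φ ∈ S.subAt a i) (hψ : ψ ∈ S.subAt a i) {p q : S.X a}
    (hp : p ∈ S.Y.closedImage i φ) (hq : q ∈ S.Y.closedImage i ψ)
    (h : edist (toFine j haj p) (toFine j haj q) < size m i) :
    (S.Y.closedImage i φ ∩ S.Y.closedImage i ψ).Nonempty := by
  subst ha
  obtain ⟨x, hx, rfl⟩ := hp
  obtain ⟨y, hy, rfl⟩ := hq
  obtain ⟨a', ha', b', hb', hab⟩ := (truncSystem hm hmv hS j).exists_meet hm hmv hH hφ hψ hx hy h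
  exact ⟨_, ⟨a', ha', rfl⟩, ⟨b', hb', hab.symm⟩⟩

end System

/-! ### Counting cells -/

theorem _root_.Set.encard_biUnion_le_mul {α β : Type*} {T : Set β} {F : β → Set α} {a b : ℕ}
    (hT : T.encard ≤ a) (hF : ∀ x ∈ T, (F x).encard ≤ b) : (⋃ x ∈ T, F x).encard ≤ (a * b : ℕ) := by
  classical
  have hfin : T.Finite := finite_of_encard_le_coe hT
  have hF' : ∀ x ∈ T, (F x).Finite := fun x hx => finite_of_encard_le_coe (hF x hx)
  have h1 : ⋃ x ∈ T, F x = ↑(hfin.toFinset.attach.biUnion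
      fun x => (hF' x (hfin.mem_toFinset.1 x.2)).toFinset) := by
    ext y; simp
  rw [h1, encard_coe_eq_coe_finsetCard]
  norm_cast
  refine (Finset.card_biUnion_le_card_mul _ _ b fun x _ => ?_).trans ?_
  · have hx := hfin.mem_toFinset.1 x.2
    have := hF x hx
    rw [(hF' x hx).encard_eq_coe_toFinset_card] at this
    exact_mod_cast this
  · rw [Finset.card_attach]
    gcongr
    rw [hfin.encard_eq_coe_toFinset_card] at hT
    exact_mod_cast hT

theorem _root_.Set.encard_range_le {α : Type*} {ι : Type*} [Fintype ι] (f : ι → α) :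
    (range f).encard ≤ (Fintype.card ι : ℕ) := by
  rw [← image_univ]
  refine (encard_image_le f univ).trans ?_
  rw [encard_univ, ENat.card_eq_coe_fintype_card]

namespace Tilings

variable {n m mv : ℕ} [NeZero n]

theorem encard_vertices_le {Y : Tilings n m mv} (hm : 2 ≤ m) (hmv : m ≤ mv) (i : ℤ)
    (c : GridCell n) : {w | w ∈ Y.closedCell i c ∧ Y.IsLat i w}.encard ≤ (2 ^ n : ℕ) := by
  classical
  refine (encard_le_encard (t := range fun s : Fin n → Bool =>
    (WithLp.toLp 2 fun k => if s k then Y.lo i c k else Y.hi i c k : EuclideanSpace ℝ (Fin n))) ?_).trans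
    ((encard_range_le _).trans (by simp))
  rintro w ⟨hw, hwl⟩
  refine ⟨fun k => decide (w k = Y.lo i c k), ?_⟩
  ext k
  have h := Y.mem_closedCell.1 hw k
  by_cases hk : w k = Y.lo i c k
  · simp [hk]
  · have h1 := (Y.latCoord_lo i c k).gap (side_pos hm hmv i k) (hwl k)
      (lt_of_le_of_ne h.1 (Ne.symm hk))
    have h2 : Y.hi i c k ≤ Y.lo i c k + side m mv i k := by
      unfold Tilings.hi
      split_ifs <;> linarith [side_pos hm hmv i k]
    simp only [hk, decide_false, Bool.false_eq_true, if_false]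
    linarith [h.2]

theorem encard_topCells_le {Y : Tilings n m mv} (hm : 2 ≤ m) (hmv : m ≤ mv) {i : ℤ}
    {w : EuclideanSpace ℝ (Fin n)} (hw : Y.IsLat i w) :
    {c : GridCell n | c.dirs = Finset.univ ∧ w ∈ Y.closedCell i c}.encard ≤ (2 ^ n : ℕ) := by
  classical
  have h : ∀ s : Fin n → Bool, ∃ c : GridCell n, c.dirs = Finset.univ ∧
      ∀ k, Y.lo i c k = if s k then w k else w k - side m mv i k := fun s =>
    Y.exists_cell _ fun k => by
      split_ifs
      · exact hw k
      · exact (hw k).sub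
  choose f hf using h
  refine (encard_le_encard (t := range f) ?_).trans ((encard_range_le _).trans (by simp))
  rintro c ⟨hc, hwc⟩
  refine ⟨fun k => decide (Y.lo i c k = w k), Y.cell_eq hm hmv (j := i) ((hf _).1.trans hc.symm) fun k => ?_⟩
  rw [(hf _).2]
  by_cases hk : Y.lo i c k = w k
  · simp [hk]
  · simp only [hk, decide_false, Bool.false_eq_true, if_false]
    have h1 := (hwc k).1 (hc ▸ Finset.mem_univ k)
    have h2 := (Y.latCoord_lo i c k).gap (side_pos hm hmv i k) (hw k) (lt_of_le_of_ne h1.1 hk)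
    linarith

/-- The faces of a cell, indexed by which of lower end, upper end and interior is taken in each
direction. -/
theorem exists_faces {Y : Tilings n m mv} (hm : 2 ≤ m) (hmv : m ≤ mv) (i : ℤ)
    (c : GridCell n) : ∃ F : (Fin n → Fin 3) → GridCell n, ∀ x ∈ Y.closedCell i c,
      ∃ s, x ∈ Y.openCell i (F s) ∧ Y.closedCell i (F s) ⊆ Y.closedCell i c := by
  classical
  have h : ∀ s : Fin n → Fin 3, ∃ e : GridCell n, e.dirs = {k ∈ c.dirs | s k = 2} ∧
      ∀ k, Y.lo i e k = if s k = 1 then Y.hi i c k else Y.lo i c k := fun s =>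
    Y.exists_cell _ fun k => by
      split_ifs
      · exact Y.latCoord_hi i c k
      · exact Y.latCoord_lo i c k
  choose F hF using h
  refine ⟨F, fun x hx => ?_⟩
  let s : Fin n → Fin 3 := fun k => if x k = Y.lo i c k then 0 else if x k = Y.hi i c k then 1 else 2
  have hs : x ∈ Y.openCell i (F s) := by
    intro k
    have hxk := Y.mem_closedCell.1 hx k
    rw [(hF s).1, (hF s).2]
    by_cases h0 : x k = Y.lo i c k
    · simp [s, h0]
    · by_cases h1 : x k = Y.hi i c k
      · have : Y.hi i c k ≠ Y.lo i c k := h1 ▸ h0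
        simp [s, h1, this]
      · have hk : k ∈ c.dirs := by
          by_contra hk
          exact h0 ((hx k).2 hk)
        have hlt : x k < Y.hi i c k := lt_of_le_of_ne hxk.2 h1
        have hlt' : Y.lo i c k < x k := lt_of_le_of_ne hxk.1 (Ne.symm h0)
        rw [Tilings.hi, if_pos hk] at hlt
        simp [s, h0, h1, hk, hlt, hlt']
  exact ⟨s, hs, Y.closedCell_subset_of_mem hm hmv le_rfl hs hx⟩

end Tilings

namespace System

variable {n m mv : ℕ} [NeZero n] {S : System.{u} n m mv} {Δ H : ℕ}

/-- Each face of the cell contains at most one point over `u` in its interior, and there are at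
most `3 ^ n` faces. -/
theorem IsAdmissible.encard_preimage_le (hS : S.IsAdmissible Δ H) (hm : 2 ≤ m) (hmv : m ≤ mv)
    {a : ℤ} {φ : CharMap n (S.X a)} (hφ : φ ∈ S.Φ a) (u : S.X a) :
    {x | x ∈ S.Y.closedCell a φ.cell ∧ φ.toFun x = u}.encard ≤ (3 ^ n : ℕ) := by
  obtain ⟨F, hF⟩ := Tilings.exists_faces (Y := S.Y) hm hmv a φ.cell
  have hsub : {x | x ∈ S.Y.closedCell a φ.cell ∧ φ.toFun x = u} ⊆
      ⋃ s ∈ (univ : Set (Fin n → Fin 3)), {x | x ∈ S.Y.openCell a (F s) ∧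
        S.Y.closedCell a (F s) ⊆ S.Y.closedCell a φ.cell ∧ φ.toFun x = u} := by
    rintro x ⟨hx, hxu⟩
    obtain ⟨s, h1, h2⟩ := hF x hx
    exact mem_iUnion₂.2 ⟨s, mem_univ _, h1, h2, hxu⟩
  refine (encard_le_encard hsub).trans ((encard_biUnion_le_mul (a := 3 ^ n) (b := 1) ?_ ?_).trans (by simp))
  · rw [encard_univ, ENat.card_eq_coe_fintype_card]
    simp
  · rintro s -
    rw [Nat.cast_one, encard_le_one_iff]
    rintro x y ⟨hx, hsub, hxu⟩ ⟨hy, -, hyu⟩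
    exact (hS.complex a).injOn _ (hS.compat_face a φ hφ _ hsub) hx hy (hxu.trans hyu.symm)

/-- The open `n`-cells whose closure contains a given point. -/
theorem IsAdmissible.encard_openImages_le (hS : S.IsAdmissible Δ H) (hm : 2 ≤ m) (hmv : m ≤ mv)
    {a : ℤ} (u : S.X a) : {B | ∃ ψ ∈ S.topMaps a, B = S.Y.openImage a ψ ∧
      u ∈ S.Y.closedImage a ψ}.encard ≤ (Δ + 1 : ℕ) := by
  obtain ⟨χ, hχ, hu⟩ := (hS.complex a).cover u
  refine (encard_le_encard (t := insert (S.Y.openImage a χ) {B | B ≠ S.Y.openImage a χ ∧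
    ∃ ψ ∈ S.Φ a, B = S.Y.openImage a ψ ∧ S.Y.openImage a χ ⊆ S.Y.closedImage a ψ}) ?_).trans
    ((encard_insert_le _ _).trans ?_)
  · rintro B ⟨ψ, ⟨hψ, -⟩, rfl, x, hx, hxu⟩
    by_cases hB : S.Y.openImage a ψ = S.Y.openImage a χ
    · exact Or.inl hB
    · right
      refine ⟨hB, ψ, hψ, rfl, ?_⟩
      obtain ⟨f, -, hxf, hf, -⟩ := S.Y.exists_carrier hm hmv hx
      have hsub : S.Y.closedCell a f ⊆ S.Y.closedCell a ψ.cell := by rw [hf]; exact fun p hp => hp.1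
      rcases (hS.complex a).partition _ (hS.compat_face a ψ hψ f hsub) χ hχ with h | h
      · rw [← h.1]
        exact image_mono ((S.Y.openCell_subset a f).trans hsub)
      · exact absurd hu (disjoint_left.1 h ⟨x, hxf, hxu⟩)
  · push_cast
    gcongr
    exact hS.link a χ hχ

/-- Adjacent cells of the same generation share a vertex. -/
theorem IsAdmissible.exists_common_vertex (hS : S.IsAdmissible Δ H) (hm : 2 ≤ m) (hmv : m ≤ mv)
    {a i : ℤ} (hai : a ≤ i) {φ ψ : CharMap n (S.X a)} (hφ : φ ∈ S.subAt a i)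
    (hψ : ψ ∈ S.subAt a i) (h : (S.Y.closedImage i φ ∩ S.Y.closedImage i ψ).Nonempty) :
    ∃ w ∈ S.Y.closedCell i φ.cell, S.Y.IsLat i w ∧ ∃ w' ∈ S.Y.closedCell i ψ.cell,
      S.Y.IsLat i w' ∧ ψ.toFun w' = φ.toFun w := by
  obtain ⟨_, ⟨x, hx, rfl⟩, ⟨y, hy, hxy⟩⟩ := h
  obtain ⟨w, hw, hwl, hxw⟩ := S.Y.exists_near_vertex hm hmv (le_refl i) hx
  obtain ⟨g, hg, -, htr⟩ := hS.transfer hm hmv hai hφ hψ hx hy hxy.symm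
  obtain ⟨h1, h2⟩ := htr w hw hwl (LiftSystem.half_lt_side hm hmv hxw)
  exact ⟨w, hw, hwl, g w, h1, hg.isLat w hwl, h2⟩

/-- The open `n`-cells of `X a` adjacent to a given cell. -/
theorem IsAdmissible.encard_adjacent_le (hS : S.IsAdmissible Δ H) (hm : 2 ≤ m) (hmv : m ≤ mv)
    {a : ℤ} {φ : CharMap n (S.X a)} (hφ : φ ∈ S.Φ a) :
    {B | ∃ ψ ∈ S.topMaps a, B = S.Y.openImage a ψ ∧ S.Adjacent a φ ψ}.encard ≤
      (2 ^ n * (Δ + 1) : ℕ) := by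
  refine (encard_le_encard ?_).trans (encard_biUnion_le_mul
    (Tilings.encard_vertices_le (Y := S.Y) hm hmv a φ.cell)
    (F := fun w => {B | ∃ ψ ∈ S.topMaps a, B = S.Y.openImage a ψ ∧
      φ.toFun w ∈ S.Y.closedImage a ψ}) fun w _ => hS.encard_openImages_le hm hmv _)
  rintro B ⟨ψ, hψ, rfl, hadj⟩
  obtain ⟨w, hw, hwl, w', hw', -, hww⟩ := hS.exists_common_vertex hm hmv (le_refl a)
    (hS.subAt_self a ▸ hφ) (hS.subAt_self a ▸ hψ.1) hadj
  exact mem_iUnion₂.2 ⟨w, ⟨hw, hwl⟩, ψ, hψ, rfl, w', hw', hww⟩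

/-- A bound for the number of cells needed to cover the cells adjacent to a given one. -/
def starBound (n Δ : ℕ) : ℕ := 2 ^ n * ((Δ + 1) * (3 ^ n * 2 ^ n))

theorem dirs_eq_univ (hm : 2 ≤ m) (hmv : m ≤ mv) {Y : Tilings n m mv} {i j : ℤ} {c C : GridCell n}
    (h : Y.closedCell i c ⊆ Y.closedCell j C) (hc : c.dirs = Finset.univ) : C.dirs = Finset.univ := by
  rw [Finset.eq_univ_iff_forall]
  intro k
  by_contra hk
  have h1 : WithLp.toLp 2 (Y.lo i c) ∈ Y.closedCell i c :=
    Y.mem_closedCell.2 fun k => ⟨le_rfl, Y.lo_le_hi hm hmv i c k⟩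
  have h2 : WithLp.toLp 2 (Y.hi i c) ∈ Y.closedCell i c :=
    Y.mem_closedCell.2 fun k => ⟨Y.lo_le_hi hm hmv i c k, le_rfl⟩
  have e1 := (h h1 k).2 hk
  have e2 := (h h2 k).2 hk
  have e3 : Y.hi i c k = Y.lo i c k + side m mv i k := by simp [Tilings.hi, hc]
  have := side_pos hm hmv i k
  simp only at e1 e2
  linarith

/-- The `n`-cells of generation `i` of `X a` that are adjacent to a given one are covered by a
bounded number of such cells. -/
theorem IsAdmissible.exists_star_cover (hS : S.IsAdmissible Δ H) (hm : 2 ≤ m) (hmv : m ≤ mv)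
    {a i : ℤ} (hai : a ≤ i) {φ : CharMap n (S.X a)} (hφ : φ ∈ S.subAt a i) :
    ∃ t : Finset (CharMap n (S.X a)), t.card ≤ starBound n Δ ∧
      (∀ χ ∈ t, χ ∈ S.subAt a i ∧ χ.cell.dirs = Finset.univ ∧
        (S.Y.closedImage i φ ∩ S.Y.closedImage i χ).Nonempty) ∧
      ∀ ψ ∈ S.subAt a i, ψ.cell.dirs = Finset.univ →
        (S.Y.closedImage i φ ∩ S.Y.closedImage i ψ).Nonempty →
        S.Y.closedImage i ψ ⊆ ⋃ χ ∈ t, S.Y.closedImage i χ := by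
  classical
  let O : S.X a → Set (Set (S.X a)) := fun u =>
    {B | ∃ ψ ∈ S.topMaps a, B = S.Y.openImage a ψ ∧ u ∈ S.Y.closedImage a ψ}
  have hrep : ∀ B : Set (S.X a), ∃ ψ : CharMap n (S.X a), (∃ ψ ∈ S.topMaps a, B = S.Y.openImage a ψ) →
      ψ ∈ S.topMaps a ∧ B = S.Y.openImage a ψ := by
    intro B
    by_cases h : ∃ ψ ∈ S.topMaps a, B = S.Y.openImage a ψ
    · obtain ⟨ψ, h1, h2⟩ := h
      exact ⟨ψ, fun _ => ⟨h1, h2⟩⟩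
    · exact ⟨φ, fun h' => absurd h' h⟩
  choose rep hrep using hrep
  let W : Set (S.X a) → S.X a → Set (EuclideanSpace ℝ (Fin n)) := fun B u =>
    {x | x ∈ S.Y.closedCell a (rep B).cell ∧ (rep B).toFun x = u}
  let D : Set (S.X a) → EuclideanSpace ℝ (Fin n) → Set (CharMap n (S.X a)) := fun B w =>
    (fun c => ⟨c, (rep B).toFun⟩) '' {c : GridCell n | S.Y.IsLat i w ∧ (c.dirs = Finset.univ ∧
      w ∈ S.Y.closedCell i c) ∧ S.Y.closedCell i c ⊆ S.Y.closedCell a (rep B).cell}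
  let U : Set (CharMap n (S.X a)) :=
    ⋃ w ∈ {w | w ∈ S.Y.closedCell i φ.cell ∧ S.Y.IsLat i w}, ⋃ B ∈ O (φ.toFun w),
      ⋃ w' ∈ W B (φ.toFun w), D B w'
  have hU : U.encard ≤ starBound n Δ := by
    refine encard_biUnion_le_mul (Tilings.encard_vertices_le hm hmv i φ.cell) fun w hw =>
      encard_biUnion_le_mul (hS.encard_openImages_le hm hmv _) fun B hB =>
      encard_biUnion_le_mul (hS.encard_preimage_le hm hmv
        (hrep B (hB.imp fun ψ h => ⟨h.1, h.2.1⟩)).1.1 _) fun w' hw' => ?_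
    refine (encard_image_le _ _).trans ?_
    by_cases hl : S.Y.IsLat i w'
    · exact (encard_le_encard fun c hc => hc.2.1).trans (Tilings.encard_topCells_le hm hmv hl)
    · simp [hl]
  have hfin : U.Finite := finite_of_encard_le_coe hU
  refine ⟨hfin.toFinset, ?_, fun χ hχ => ?_, fun ψ hψ hψd hmeet => ?_⟩
  · rw [hfin.encard_eq_coe_toFinset_card] at hU
    exact_mod_cast hU
  · rw [hfin.mem_toFinset] at hχ
    simp only [U, mem_iUnion] at hχ
    obtain ⟨w, ⟨hw, hwl⟩, B, hB, w', ⟨hw', hww⟩, c, ⟨hwl', ⟨hcd, hwc⟩, hc⟩, rfl⟩ := hχ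
    have hr := hrep B (hB.imp fun ψ h => ⟨h.1, h.2.1⟩)
    exact ⟨⟨_, hr.1.1, hc, rfl⟩, hcd, φ.toFun w, ⟨w, hw, rfl⟩, w', hwc, hww⟩
  · obtain ⟨w, hw, hwl, w', hw', hwl', hww⟩ := hS.exists_common_vertex hm hmv hai hφ hψ hmeet
    rintro _ ⟨y, hy, rfl⟩
    obtain ⟨ψ', hψ', hsub, hfun⟩ := hψ
    have htop : ψ' ∈ S.topMaps a := ⟨hψ', dirs_eq_univ hm hmv hsub hψd⟩
    have hr := hrep (S.Y.openImage a ψ') ⟨ψ', htop, rfl⟩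
    obtain ⟨g, hg, himg, hEq⟩ := hS.compat_group a ψ' hψ' _ hr.1.1 hr.2
    have hgm := S.Y.isGridMap_of_mem_G hm hmv hg
    have hgw : g w' ∈ S.Y.closedCell a (rep (S.Y.openImage a ψ')).cell :=
      himg ▸ mem_image_of_mem _ (hsub hw')
    have hgy : g y ∈ S.Y.closedCell a (rep (S.Y.openImage a ψ')).cell :=
      himg ▸ mem_image_of_mem _ (hsub hy)
    have hgwl := (hgm.of_le hm hmv hai).isLat w' hwl'
    have hdist : ∀ k, |g y k - g w' k| ≤ side m mv i k := by
      intro k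
      have h := fun k => S.Y.abs_sub_le_side hy hw' hm hmv k
      by_cases hk : k = 0
      · subst hk; rw [hgm.fst, hgm.fst]; exact h 0
      · simpa using hgm.bound (θ := 1) (i := i) (fun k _ => by simpa using h k) k hk
    obtain ⟨c, hcd, hc, hyc, hwc⟩ := S.Y.exists_subcell_vertex hm hmv hai hgy hgw hgwl hdist
    refine mem_iUnion₂.2 ⟨⟨c, (rep (S.Y.openImage a ψ')).toFun⟩, hfin.mem_toFinset.2 ?_, g y, hyc, ?_⟩
    · simp only [U, mem_iUnion]
      refine ⟨w, ⟨hw, hwl⟩, S.Y.openImage a ψ', ⟨ψ', htop, rfl, w', hsub hw', by rw [← hfun, hww]⟩,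
        g w', ⟨hgw, ?_⟩, c, ⟨hgwl, ⟨hcd.trans hr.1.2, hwc⟩, hc⟩, rfl⟩
      rw [← hww, hfun]
      exact (hEq (hsub hw')).symm
    · rw [hfun]
      exact (hEq (hsub hy)).symm

end System

/-! ### Sizes -/

section Size

variable {m : ℕ}

theorem size_ne_top (i : ℤ) : size m i ≠ ⊤ := ENNReal.ofReal_ne_top

theorem size_pos (hm : 2 ≤ m) (i : ℤ) : 0 < size m i := by
  have : (0 : ℝ) < m := by exact_mod_cast (by lia : 0 < m)
  exact ENNReal.ofReal_pos.2 (by positivity)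

theorem size_add (hm : 2 ≤ m) (i : ℤ) (k : ℕ) : size m i = m ^ k * size m (i + k) := by
  have : (m : ℝ) ≠ 0 := by exact_mod_cast (by lia : m ≠ 0)
  rw [size, size, ← ENNReal.ofReal_natCast m, ← ENNReal.ofReal_pow (Nat.cast_nonneg _),
    ← ENNReal.ofReal_mul (by positivity), ← zpow_natCast, ← zpow_add₀ this]
  congr 2
  lia

theorem size_anti (hm : 2 ≤ m) {i j : ℤ} (h : i ≤ j) : size m j ≤ size m i :=
  ENNReal.ofReal_le_ofReal (zpow_le_zpow_right₀ (by exact_mod_cast (by lia : 1 ≤ m)) (by lia))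

/-- Every radius lies between the sizes of two consecutive generations. -/
theorem exists_size_le_lt (hm : 2 ≤ m) {r : ℝ≥0∞} (h0 : r ≠ 0) (h1 : r ≠ ⊤) :
    ∃ i : ℤ, size m (i + 1) ≤ r ∧ r < size m i := by
  obtain ⟨k, hk1, hk2⟩ := exists_mem_Ico_zpow (ENNReal.toReal_pos h0 h1)
    (by exact_mod_cast (by lia : 1 < m) : (1 : ℝ) < m)
  refine ⟨-(k + 1), ?_, ?_⟩
  · rw [size, ENNReal.ofReal_le_iff_le_toReal h1]
    rwa [show -(-(k + 1) + 1) = k by ring]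
  · rw [size, ENNReal.lt_ofReal_iff_toReal_lt h1, neg_neg]
    exact hk2

theorem exists_size_lt (hm : 2 ≤ m) {r : ℝ≥0∞} (h0 : r ≠ 0) (j : ℤ) :
    ∃ i : ℤ, j ≤ i ∧ size m i < r := by
  have h1 : min r 1 ≠ 0 := by simp [h0]
  obtain ⟨i, hi, -⟩ := exists_size_le_lt hm h1 (by simp)
  refine ⟨max j (i + 2), le_max_left _ _, ?_⟩
  refine (size_anti hm (le_max_right _ _)).trans_lt (lt_of_lt_of_le ?_ (hi.trans (min_le_left _ _)))
  rw [size_add hm (i + 1) 1, show i + 1 + (1 : ℕ) = i + 2 by push_cast; ring, pow_one]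
  have := ENNReal.mul_lt_mul_left (size_pos hm (i + 2)).ne' (size_ne_top (i + 2))
    (by exact_mod_cast (by lia : 1 < m) : (1 : ℝ≥0∞) < m)
  simpa using this

theorem exists_lt_size (hm : 2 ≤ m) {r : ℝ≥0∞} (h1 : r ≠ ⊤) (j : ℤ) :
    ∃ i : ℤ, i ≤ j ∧ r < size m i := by
  obtain ⟨i, -, hi⟩ := exists_size_le_lt (r := max r 1) hm (by simp) (by simp [h1])
  exact ⟨min i j, min_le_right _ _, (le_max_left _ _).trans_lt
    (hi.trans_le (size_anti hm (min_le_left _ _)))⟩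

end Size

/-! ### The topology of `X j` and its metric -/

namespace Tilings

variable {n m mv : ℕ} [NeZero n] (Y : Tilings n m mv)

theorem closedCell_eq (j : ℤ) (c : GridCell n) :
    Y.closedCell j c = WithLp.toLp 2 '' Icc (Y.lo j c) (Y.hi j c) := by
  ext p
  rw [mem_closedCell]
  constructor
  · exact fun h => ⟨p, ⟨fun k => (h k).1, fun k => (h k).2⟩, rfl⟩
  · rintro ⟨q, ⟨h1, h2⟩, rfl⟩ k
    exact ⟨h1 k, h2 k⟩

theorem isCompact_closedCell (j : ℤ) (c : GridCell n) : IsCompact (Y.closedCell j c) := by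
  rw [closedCell_eq]
  exact isCompact_Icc.image (PiLp.continuous_toLp 2 _)

theorem isClosed_closedCell (j : ℤ) (c : GridCell n) : IsClosed (Y.closedCell j c) :=
  (Y.isCompact_closedCell j c).isClosed

theorem tendsto_side (hm : 2 ≤ m) (hmv : m ≤ mv) (j : ℤ) (k : Fin n) :
    Filter.Tendsto (fun l : ℕ => side m mv (j + l) k) Filter.atTop (nhds 0) := by
  have h : ∀ b : ℕ, 2 ≤ b →
      Filter.Tendsto (fun l : ℕ => (b : ℝ) ^ (-(j + l))) Filter.atTop (nhds 0) := by
    intro b hb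
    have hb0 : (b : ℝ) ≠ 0 := by exact_mod_cast (by lia : b ≠ 0)
    have hb1 : (1 : ℝ) < b := by exact_mod_cast (by lia : 1 < b)
    have := (tendsto_pow_atTop_nhds_zero_of_lt_one (inv_nonneg.2 (Nat.cast_nonneg b))
      (inv_lt_one_of_one_lt₀ hb1)).const_mul ((b : ℝ) ^ (-j))
    rw [mul_zero] at this
    refine this.congr fun l => ?_
    rw [neg_add, zpow_add₀ hb0, zpow_neg, zpow_neg, zpow_natCast, inv_pow]
  unfold side
  split_ifs
  · exact h m hm
  · exact h mv (hm.trans hmv)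

end Tilings

namespace System

variable {n m mv : ℕ} [NeZero n] {S : System.{u} n m mv} {Δ H : ℕ}

/-- A pseudodistance that is finite on each cell is finite. -/
theorem IsAdmissible.ne_top_of_cells (hS : S.IsAdmissible Δ H) {j : ℤ} {ρ : S.X j → S.X j → ℝ≥0∞}
    (hρ : IsPseudoDist ρ) (hc : ∀ φ ∈ S.Φ j, ∀ p ∈ S.Y.closedImage j φ,
      ∀ q ∈ S.Y.closedImage j φ, ρ p q ≠ ⊤) (p q : S.X j) : ρ p q ≠ ⊤ := by
  have key : ∀ A : Set (S.X j), (∀ x ∈ A, ∀ y, ρ x y ≠ ⊤ → y ∈ A) → IsClosed A := by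
    intro A hA
    refine (hS.complex j).weak_topology A fun φ hφ => ?_
    by_cases h : ∃ x ∈ S.Y.closedCell j φ.cell, φ.toFun x ∈ A
    · obtain ⟨x, hx, hxA⟩ := h
      convert S.Y.isClosed_closedCell j φ.cell using 1
      exact inter_eq_left.2 fun y hy => hA _ hxA _ (hc φ hφ _ ⟨x, hx, rfl⟩ _ ⟨y, hy, rfl⟩)
    · convert isClosed_empty using 1
      rw [eq_empty_iff_forall_notMem]
      rintro x ⟨hx, hxA⟩
      exact h ⟨x, hx, hxA⟩
  have htri : ∀ {x y z}, ρ x y ≠ ⊤ → ρ y z ≠ ⊤ → ρ x z ≠ ⊤ := fun h1 h2 =>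
    ne_top_of_le_ne_top (ENNReal.add_ne_top.2 ⟨h1, h2⟩) (hρ.triangle _ _ _)
  have h1 : IsClosed {y | ρ p y ≠ ⊤} := key _ fun x hx y hy => htri hx hy
  have h2 : IsClosed {y | ρ p y ≠ ⊤}ᶜ := key _ fun x hx y hy h => hx (htri h (by rwa [hρ.comm]))
  have := hS.connected j
  have : {y | ρ p y ≠ ⊤} = univ :=
    IsClopen.eq_univ ⟨h1, isClosed_compl_iff.1 h2⟩ ⟨p, by simp [hρ.self]⟩
  exact (this ▸ mem_univ q : q ∈ {y | ρ p y ≠ ⊤})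

/-- A point of `X j`, as a point of the metric space `(X j, d j)`. -/
def asFine {j : ℤ} (p : S.X j) : S.Fine j := p

theorem toFine_self {j : ℤ} (p : S.X j) : toFine j le_rfl p = asFine p := S.π_self j p

theorem IsAdmissible.edist_fine_ne_top (hS : S.IsAdmissible Δ H) {j : ℤ} (p q : S.Fine j) :
    edist p q ≠ ⊤ := by
  refine hS.ne_top_of_cells (isPseudoDist_edist_comp asFine)
    (fun φ hφ p hp q hq => ?_) p q
  have := edist_fine_le le_rfl hφ hp hq
  rw [toFine_self, toFine_self] at this
  exact ne_top_of_le_ne_top (size_ne_top j) this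

theorem IsAdmissible.edist_limitSpace_ne_top (hS : S.IsAdmissible Δ H) (p q : S.LimitSpace) :
    edist p q ≠ ⊤ := by
  obtain ⟨p, rfl⟩ := SeparationQuotient.surjective_mk p
  obtain ⟨q, rfl⟩ := SeparationQuotient.surjective_mk q
  rw [SeparationQuotient.edist_mk]
  obtain ⟨j, p, q, rfl, rfl⟩ := DirectLimit.exists_eq_mk₂ (f := S.π) p q
  exact hS.ne_top_of_cells (isPseudoDist_edist_comp (S.toLimit j))
    (fun φ hφ p hp q hq => ne_top_of_le_ne_top (size_ne_top j) (edist_toLimit_le hφ hp hq)) p q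

theorem IsAdmissible.surjective_π (hS : S.IsAdmissible Δ H) {i j : ℤ} (h : i ≤ j) :
    Function.Surjective (S.π i j h) := by
  induction j, h using Int.leInduction with
  | base => exact fun p => ⟨p, S.π_self i p⟩
  | succ j h ih =>
    intro p
    obtain ⟨q, rfl⟩ := hS.surjective j p
    obtain ⟨r, rfl⟩ := ih q
    exact ⟨r, (S.π_π h (by lia) r).symm⟩

/-- The points at distance less than `m ^ (-i)` from a point of an `n`-cell of generation `i` are
covered by a bounded number of such cells. -/
theorem IsAdmissible.exists_ball_cover (hS : S.IsAdmissible Δ H) (hm : 2 ≤ m) (hmv : m ≤ mv)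
    (hH : 2 * (m + 1) * (H + 1) < mv) {i j a : ℤ} (haj : a ≤ j) (ha : a = min i j)
    {φ : CharMap n (S.X a)} (hφ : φ ∈ S.subAt a i) :
    ∃ t : Finset (CharMap n (S.X a)), t.card ≤ starBound n Δ ∧
      (∀ χ ∈ t, χ ∈ S.subAt a i ∧ χ.cell.dirs = Finset.univ ∧
        (S.Y.closedImage i φ ∩ S.Y.closedImage i χ).Nonempty) ∧
      ∀ p ∈ S.Y.closedImage i φ, ∀ q, edist (toFine j haj p) (toFine j haj q) < size m i →
        ∃ χ ∈ t, q ∈ S.Y.closedImage i χ := by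
  obtain ⟨t, ht1, ht2, ht3⟩ := hS.exists_star_cover hm hmv (by lia : a ≤ i) hφ
  refine ⟨t, ht1, ht2, fun p hp q hpq => ?_⟩
  obtain ⟨ψ, hψ, hψd, hq⟩ := hS.exists_mem_subAt hm hmv (by lia : a ≤ i) q
  have := ht3 ψ hψ hψd (hS.meet_of_edist_fine hm hmv hH haj ha hφ hψ hp hq hpq) hq
  simpa using this

/-- For all `i ≥ j`, arbitrarily small cells of the subdivision of generation `i` containing the two
points intersect; pass to the limit in the Hausdorff space `X j`. -/
theorem IsAdmissible.eq_of_edist_fine_eq_zero (hS : S.IsAdmissible Δ H) (hm : 2 ≤ m) (hmv : m ≤ mv)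
    (hH : 2 * (m + 1) * (H + 1) < mv) {j : ℤ} {p q : S.Fine j} (h : edist p q = 0) : p = q := by
  obtain ⟨φ, hφ, x, hx, rfl⟩ := (hS.complex j).cover p
  obtain ⟨ψ, hψ, y, hy, rfl⟩ := (hS.complex j).cover q
  replace hx := S.Y.openCell_subset _ _ hx
  replace hy := S.Y.openCell_subset _ _ hy
  have hk : ∀ k : ℕ, ∃ x' ∈ S.Y.closedCell j φ.cell, ∃ y' ∈ S.Y.closedCell j ψ.cell,
      φ.toFun x' = ψ.toFun y' ∧ (∀ l, |x' l - x l| ≤ side m mv (j + k) l) ∧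
      ∀ l, |y' l - y l| ≤ side m mv (j + k) l := by
    intro k
    obtain ⟨c, -, hc, hxc⟩ := S.Y.exists_subcell hm hmv (by lia : j ≤ j + k) hx
    obtain ⟨c', -, hc', hyc⟩ := S.Y.exists_subcell hm hmv (by lia : j ≤ j + k) hy
    obtain ⟨_, ⟨x', hx', rfl⟩, ⟨y', hy', hxy⟩⟩ := hS.meet_of_edist_fine (i := j + k) hm hmv hH le_rfl (by lia)
      (φ := ⟨c, φ.toFun⟩) (ψ := ⟨c', ψ.toFun⟩) ⟨φ, hφ, hc, rfl⟩ ⟨ψ, hψ, hc', rfl⟩ ⟨x, hxc, rfl⟩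
      ⟨y, hyc, rfl⟩ (by rw [toFine_self, toFine_self]; exact h.trans_lt (size_pos hm _))
    exact ⟨x', hc hx', y', hc' hy', hxy.symm, fun l => S.Y.abs_sub_le_side hx' hxc hm hmv l,
      fun l => S.Y.abs_sub_le_side hy' hyc hm hmv l⟩
  choose x' hx' y' hy' hxy hxl hyl using hk
  have conv : ∀ (z : EuclideanSpace ℝ (Fin n)) (z' : ℕ → EuclideanSpace ℝ (Fin n)),
      (∀ k l, |z' k l - z l| ≤ side m mv (j + k) l) → Filter.Tendsto z' Filter.atTop (nhds z) := by
    intro z z' hz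
    have h1 : Filter.Tendsto (fun k => WithLp.ofLp (z' k)) Filter.atTop (nhds (WithLp.ofLp z)) := by
      rw [tendsto_pi_nhds]
      intro l
      rw [tendsto_iff_dist_tendsto_zero]
      exact squeeze_zero (fun _ => dist_nonneg) (fun k => hz k l) (Tilings.tendsto_side hm hmv j l)
    exact ((PiLp.continuous_toLp 2 _).tendsto _).comp h1
  have := (hS.complex j).t2
  have h1 := ((hS.complex j).continuousOn φ hφ x hx).tendsto.comp
    (tendsto_nhdsWithin_iff.2 ⟨conv x x' hxl, Filter.Eventually.of_forall hx'⟩)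
  have h2 := ((hS.complex j).continuousOn ψ hψ y hy).tendsto.comp
    (tendsto_nhdsWithin_iff.2 ⟨conv y y' hyl, Filter.Eventually.of_forall hy'⟩)
  exact (tendsto_nhds_unique (X := S.X j) h1 (h2.congr fun k => (hxy k).symm) :)

/-- The metric `d j` is continuous for the topology of the cell complex `X j`. -/
theorem IsAdmissible.continuous_fine (hS : S.IsAdmissible Δ H) (hm : 2 ≤ m) (hmv : m ≤ mv)
    (j : ℤ) : Continuous (asFine : S.X j → S.Fine j) := by
  rw [continuous_iff_isClosed]
  intro A hA
  refine (hS.complex j).weak_topology _ fun φ hφ => ?_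
  have hcont : ContinuousOn (fun x => asFine (φ.toFun x)) (S.Y.closedCell j φ.cell) := by
    intro x hx
    rw [ContinuousWithinAt, EMetric.tendsto_nhds]
    intro ε hε
    obtain ⟨i, hji, hi⟩ := exists_size_lt hm (ENNReal.half_pos hε.ne').ne' j
    have hopen : IsOpen {y : EuclideanSpace ℝ (Fin n) | ∀ k, |y k - x k| < side m mv i k / 2} := by
      simp only [ofPred_forall]
      refine isOpen_iInter_of_finite fun k => isOpen_lt ?_ continuous_const
      fun_prop
    refine mem_nhdsWithin.2 ⟨_, hopen, fun k => ?_, ?_⟩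
    · simpa using side_pos hm hmv i k
    rintro y ⟨hyx, hy⟩
    obtain ⟨w, hw, hwl, hxw⟩ := S.Y.exists_near_vertex hm hmv hji hx
    have hs := side_pos (n := n) hm hmv i
    obtain ⟨c, -, hc, hxc, hwc⟩ := S.Y.exists_subcell_vertex hm hmv hji hx hw hwl
      fun k => (hxw k).trans (by linarith [hs k])
    obtain ⟨c', -, hc', hyc, hwc'⟩ := S.Y.exists_subcell_vertex hm hmv hji hy hw hwl fun k => by
      have h1 := abs_sub_le (y k) (x k) (w k)
      have h2 := hyx k
      linarith [hxw k]
    have h1 := edist_fine_le_sub hji (φ := ⟨c', φ.toFun⟩) ⟨φ, hφ, hc', rfl⟩ ⟨y, hyc, rfl⟩ ⟨w, hwc', rfl⟩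
    have h2 := edist_fine_le_sub hji (φ := ⟨c, φ.toFun⟩) ⟨φ, hφ, hc, rfl⟩ ⟨w, hwc, rfl⟩ ⟨x, hxc, rfl⟩
    simp only [toFine_self] at h1 h2
    calc edist (asFine (φ.toFun y)) (asFine (φ.toFun x)) ≤ _ := edist_triangle _ (asFine (φ.toFun w)) _
      _ ≤ size m i + size m i := add_le_add h1 h2
      _ < ε / 2 + ε / 2 := ENNReal.add_lt_add hi hi
      _ = ε := ENNReal.add_halves ε
  exact hcont.preimage_isClosed_of_isClosed (S.Y.isClosed_closedCell j φ.cell) hA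

theorem IsAdmissible.isCompact_closedImage (hS : S.IsAdmissible Δ H) {a i : ℤ} {φ : CharMap n (S.X a)} (hφ : φ ∈ S.subAt a i) :
    IsCompact (S.Y.closedImage i φ) := by
  obtain ⟨ψ, hψ, hsub, hfun⟩ := hφ
  rw [Tilings.closedImage, hfun]
  exact (S.Y.isCompact_closedCell i _).image_of_continuousOn
    (((hS.complex a).continuousOn ψ hψ).mono hsub)

theorem IsAdmissible.t2_fine (hS : S.IsAdmissible Δ H) (hm : 2 ≤ m) (hmv : m ≤ mv)
    (hH : 2 * (m + 1) * (H + 1) < mv) (j : ℤ) : T2Space (S.Fine j) := by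
  have : T0Space (S.Fine j) := ⟨fun p q h =>
    hS.eq_of_edist_fine_eq_zero hm hmv hH (EMetric.inseparable_iff.1 h)⟩
  infer_instance

/-- `X j` is covered by countably many compact sets. -/
theorem IsAdmissible.exists_compact_cover (hS : S.IsAdmissible Δ H) (hm : 2 ≤ m) (hmv : m ≤ mv)
    (hH : 2 * (m + 1) * (H + 1) < mv) (j : ℤ) :
    ∃ K : ℕ → Set (S.X j), (∀ N, IsCompact (K N)) ∧ ⋃ N, K N = univ := by
  have := hS.connected j
  obtain ⟨p⟩ : Nonempty (S.X j) := inferInstance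
  have h : ∀ N : ℕ, ∃ K : Set (S.X j), IsCompact K ∧
      ∀ q : S.X j, edist (asFine p) (asFine q) < size m (j - N) → q ∈ K := by
    intro N
    obtain ⟨p', hp'⟩ := hS.surjective_π (by lia : j - N ≤ j) p
    obtain ⟨φ, hφ, -, hpφ⟩ := hS.exists_mem_subAt hm hmv (le_refl (j - N)) p'
    obtain ⟨t, -, ht1, ht2⟩ := hS.exists_ball_cover hm hmv hH (by lia : j - N ≤ j) (by lia) hφ
    refine ⟨⋃ χ ∈ t, S.π _ j (by lia) '' S.Y.closedImage (j - N) χ, ?_, fun q hq => ?_⟩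
    · exact t.isCompact_biUnion fun χ hχ =>
        (hS.isCompact_closedImage (ht1 χ hχ).1).image (S.π _ _ _).continuous
    · obtain ⟨q', hq'⟩ := hS.surjective_π (by lia : j - N ≤ j) q
      obtain ⟨χ, hχ, hqχ⟩ := ht2 p' hpφ q' (by rw [toFine, toFine, hp', hq']; exact hq)
      exact mem_iUnion₂.2 ⟨χ, hχ, q', hqχ, hq'⟩
  choose K hK1 hK2 using h
  refine ⟨K, hK1, eq_univ_of_forall fun q => ?_⟩
  obtain ⟨i, hi, hlt⟩ := exists_lt_size hm (hS.edist_fine_ne_top (j := j) (asFine p) (asFine q)) j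
  refine mem_iUnion.2 ⟨(j - i).toNat, hK2 _ q ?_⟩
  convert hlt using 2
  lia

/-- A closed set of the cell complex is a countable union of compact sets, which are closed for the
metric; conversely, the metric is continuous on the complex. -/
theorem IsAdmissible.borelSpace_fine (hS : S.IsAdmissible Δ H) (hm : 2 ≤ m) (hmv : m ≤ mv)
    (hH : 2 * (m + 1) * (H + 1) < mv) (j : ℤ) : BorelSpace (S.Fine j) := by
  have hcont := hS.continuous_fine hm hmv j
  have := hS.t2_fine hm hmv hH j
  have := hS.borel j
  refine ⟨le_antisymm ?_ ?_⟩
  · have h1 : (S.measurable j) = _root_.borel (S.X j) := (hS.borel j).measurable_eq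
    change S.measurable j ≤ _
    rw [h1, borel_eq_generateFrom_isClosed]
    refine MeasurableSpace.generateFrom_le fun F hF => ?_
    obtain ⟨K, hK1, hK2⟩ := hS.exists_compact_cover hm hmv hH j
    have hFK : F = ⋃ N, F ∩ K N := by rw [← inter_iUnion, hK2, inter_univ]
    rw [hFK]
    refine MeasurableSet.iUnion fun N => ?_
    have hc : IsCompact ((asFine : S.X j → S.Fine j) '' (F ∩ K N)) :=
      ((hK1 N).inter_left hF).image hcont
    rw [show (asFine '' (F ∩ K N) : Set (S.Fine j)) = F ∩ K N from image_id _] at hc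
    exact MeasurableSpace.measurableSet_generateFrom hc.isClosed.isOpen_compl |>.of_compl
  · refine MeasurableSpace.generateFrom_le fun U hU => ?_
    exact (hU.out.preimage hcont).measurableSet

end System

/-! ### Volumes and weights of cells -/

/-- The volume of the `n`-cells of generation `i`. -/
noncomputable def cellVolume (n m mv : ℕ) [NeZero n] (i : ℤ) : ℝ≥0∞ :=
  ∏ k : Fin n, ENNReal.ofReal (side m mv i k)

section Volume

variable {n m mv : ℕ} [NeZero n]

theorem prod_ite_zero {M : Type*} [CommMonoid M] (a b : M) :
    ∏ k : Fin n, (if k = 0 then a else b) = a * b ^ (n - 1) := by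
  rw [← Finset.mul_prod_erase _ _ (Finset.mem_univ 0), if_pos rfl]
  congr 1
  rw [Finset.prod_congr rfl fun k hk => if_neg (Finset.ne_of_mem_erase hk), Finset.prod_const,
    Finset.card_erase_of_mem (Finset.mem_univ _), Finset.card_univ, Fintype.card_fin]

theorem cellVolume_eq (i : ℤ) : cellVolume n m mv i = size m i * size mv i ^ (n - 1) := by
  rw [← prod_ite_zero]
  refine Finset.prod_congr rfl fun k _ => ?_
  rw [side]
  split_ifs <;> rfl

theorem cellVolume_add (hm : 2 ≤ m) (hmv : m ≤ mv) (i : ℤ) (k : ℕ) :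
    cellVolume n m mv i = ((m * mv ^ (n - 1)) ^ k : ℕ) * cellVolume n m mv (i + k) := by
  rw [cellVolume_eq, cellVolume_eq, size_add hm i k, size_add (hm.trans hmv) i k]
  push_cast
  ring

theorem cellVolume_pos (hm : 2 ≤ m) (hmv : m ≤ mv) (i : ℤ) : 0 < cellVolume n m mv i := by
  rw [cellVolume_eq]
  exact ENNReal.mul_pos (size_pos hm i).ne' (pow_ne_zero _ (size_pos (hm.trans hmv) i).ne')

theorem cellVolume_ne_top (i : ℤ) : cellVolume n m mv i ≠ ⊤ := by
  rw [cellVolume_eq]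
  exact ENNReal.mul_ne_top (size_ne_top i) (ENNReal.pow_ne_top (size_ne_top i))

end Volume

namespace Tilings

variable {n m mv : ℕ} [NeZero n] (Y : Tilings n m mv)

theorem volume_closedCell {j : ℤ} {c : GridCell n} (hc : c.dirs = Finset.univ) :
    volume (Y.closedCell j c) = cellVolume n m mv j := by
  have h : Y.closedCell j c =
      (MeasurableEquiv.toLp 2 (Fin n → ℝ)).symm ⁻¹' Icc (Y.lo j c) (Y.hi j c) := by
    ext p
    rw [mem_closedCell]
    exact ⟨fun h => ⟨fun k => (h k).1, fun k => (h k).2⟩, fun h k => ⟨h.1 k, h.2 k⟩⟩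
  rw [h, (EuclideanSpace.volume_preserving_symm_measurableEquiv_toLp (Fin n)).measure_preimage
    measurableSet_Icc.nullMeasurableSet, Real.volume_Icc_pi]
  refine Finset.prod_congr rfl fun k _ => ?_
  simp [hi, hc]

theorem openCell_eq_preimage {j : ℤ} {c : GridCell n} (hc : c.dirs = Finset.univ) :
    Y.openCell j c = (MeasurableEquiv.toLp 2 (Fin n → ℝ)).symm ⁻¹'
      univ.pi fun k => Ioo (Y.lo j c k) (Y.lo j c k + side m mv j k) := by
  ext p
  simp [openCell, hc, mem_pi]

theorem volume_openCell {j : ℤ} {c : GridCell n} (hc : c.dirs = Finset.univ) :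
    volume (Y.openCell j c) = cellVolume n m mv j := by
  rw [Y.openCell_eq_preimage hc,
    (EuclideanSpace.volume_preserving_symm_measurableEquiv_toLp (Fin n)).measure_preimage
    (MeasurableSet.univ_pi fun k => measurableSet_Ioo).nullMeasurableSet, Real.volume_pi_Ioo]
  simp [cellVolume]

theorem isOpen_openCell {j : ℤ} {c : GridCell n} (hc : c.dirs = Finset.univ) :
    IsOpen (Y.openCell j c) := by
  have : Y.openCell j c =
      ⋂ k, {p : EuclideanSpace ℝ (Fin n) | Y.lo j c k < p k ∧ p k < Y.lo j c k + side m mv j k} := by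
    ext p
    simp [openCell, hc]
  rw [this]
  have hk : ∀ k, Continuous fun p : EuclideanSpace ℝ (Fin n) => p k := fun k => by fun_prop
  exact isOpen_iInter_of_finite fun k =>
    (isOpen_lt continuous_const (hk k)).inter (isOpen_lt (hk k) continuous_const)

theorem volume_boundary {j : ℤ} {c : GridCell n} (hc : c.dirs = Finset.univ) :
    volume (Y.closedCell j c \ Y.openCell j c) = 0 := by
  rw [measure_sdiff (Y.openCell_subset j c) (Y.isOpen_openCell hc).measurableSet.nullMeasurableSet,
    Y.volume_closedCell hc, Y.volume_openCell hc, tsub_self]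
  rw [Y.volume_openCell hc]
  exact cellVolume_ne_top j

end Tilings

namespace System

variable {n m mv : ℕ} [NeZero n] {S : System.{u} n m mv} {Δ H : ℕ}

/-- A characteristic map is injective on the interior of an `n`-cell, even compared with the
boundary. -/
theorem IsAdmissible.eq_of_mem_openCell (hS : S.IsAdmissible Δ H) (hm : 2 ≤ m) (hmv : m ≤ mv)
    {a : ℤ} {φ : CharMap n (S.X a)} (hφ : φ ∈ S.Φ a) {x y : EuclideanSpace ℝ (Fin n)}
    (hx : x ∈ S.Y.openCell a φ.cell) (hy : y ∈ S.Y.closedCell a φ.cell)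
    (hxy : φ.toFun x = φ.toFun y) : x = y := by
  obtain ⟨f, -, hyf, hf, hcard, -⟩ := S.Y.exists_carrier hm hmv hy
  have hsub : S.Y.closedCell a f ⊆ S.Y.closedCell a φ.cell := by rw [hf]; exact fun p hp => hp.1
  rcases (hS.complex a).partition _ (hS.compat_face a φ hφ f hsub) φ hφ with h | h
  · exact (hS.complex a).injOn φ hφ hx (hcard h.2) hxy
  · exact absurd (mem_image_of_mem _ hx) (disjoint_left.1 h ⟨y, hyf, hxy.symm⟩)

/-- The measure on the `n`-cell of generation `i` of `X a` with characteristic map `φ` is `w`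
times Lebesgue measure. -/
def HasWeight (S : System.{u} n m mv) (a i : ℤ) (φ : CharMap n (S.X a)) (w : ℝ≥0) : Prop :=
  φ.cell.dirs = Finset.univ ∧ 0 < w ∧ ∃ ψ ∈ S.topMaps a,
    S.Y.closedCell i φ.cell ⊆ S.Y.closedCell a ψ.cell ∧ φ.toFun = ψ.toFun ∧ S.IsWeight a ψ w

theorem IsAdmissible.exists_hasWeight (hS : S.IsAdmissible Δ H) (hm : 2 ≤ m) (hmv : m ≤ mv)
    {a i : ℤ} {φ : CharMap n (S.X a)} (hφ : φ ∈ S.subAt a i) (hd : φ.cell.dirs = Finset.univ) :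
    ∃ w, S.HasWeight a i φ w := by
  obtain ⟨ψ, hψ, hsub, hfun⟩ := hφ
  have hψ' : ψ ∈ S.topMaps a := ⟨hψ, dirs_eq_univ hm hmv hsub hd⟩
  obtain ⟨w, hw0, hw⟩ := hS.lebesgue a ψ hψ'
  exact ⟨w, hd, hw0, ψ, hψ', hsub, hfun, hw⟩

theorem HasWeight.mem_subAt {a i : ℤ} {φ : CharMap n (S.X a)} {w : ℝ≥0}
    (h : S.HasWeight a i φ w) : φ ∈ S.subAt a i := by
  obtain ⟨-, -, ψ, hψ, h1, h2, -⟩ := h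
  exact ⟨ψ, hψ.1, h1, h2⟩

theorem HasWeight.sub {a i i' : ℤ} {φ : CharMap n (S.X a)} {w : ℝ≥0}
    (h : S.HasWeight a i φ w) {c : GridCell n} (hcd : c.dirs = Finset.univ)
    (hc : S.Y.closedCell i' c ⊆ S.Y.closedCell i φ.cell) : S.HasWeight a i' ⟨c, φ.toFun⟩ w := by
  obtain ⟨-, hw, ψ, hψ, hsub, hfun, hw'⟩ := h
  exact ⟨hcd, hw, ψ, hψ, hc.trans hsub, hfun, hw'⟩

theorem IsAdmissible.weight_le (hS : S.IsAdmissible Δ H) {a i : ℤ} {φ ψ : CharMap n (S.X a)}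
    {w w' : ℝ≥0} (hφ : S.HasWeight a i φ w) (hψ : S.HasWeight a i ψ w')
    (h : (S.Y.closedImage i φ ∩ S.Y.closedImage i ψ).Nonempty) : w ≤ Δ * w' := by
  obtain ⟨-, -, φ', hφ', h1, h2, h3⟩ := hφ
  obtain ⟨-, -, ψ', hψ', h4, h5, h6⟩ := hψ
  obtain ⟨_, ⟨x, hx, rfl⟩, y, hy, hxy⟩ := h
  exact hS.weight a φ' hφ' ψ' hψ' ⟨φ'.toFun x, ⟨x, h1 hx, rfl⟩, y, h4 hy, by rw [← h5, hxy, h2]⟩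
    w w' h3 h6

theorem IsAdmissible.measurableSet_closedImage (hS : S.IsAdmissible Δ H)
    {a i : ℤ} {φ : CharMap n (S.X a)} (hφ : φ ∈ S.subAt a i) :
    MeasurableSet (S.Y.closedImage i φ) := by
  have := (hS.complex a).t2
  have := hS.borel a
  exact (hS.isCompact_closedImage hφ).isClosed.measurableSet

theorem IsAdmissible.measurableSet_openImage (hS : S.IsAdmissible Δ H)
    {a : ℤ} {φ : CharMap n (S.X a)} (hφ : φ ∈ S.topMaps a) :
    MeasurableSet (S.Y.openImage a φ) := by
  have := (hS.complex a).t2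
  have := hS.borel a
  obtain ⟨F, hF1, hF2, hF3, -⟩ := (S.Y.isOpen_openCell (j := a) hφ.2).exists_iUnion_isClosed
  rw [Tilings.openImage, ← hF3, image_iUnion]
  refine MeasurableSet.iUnion fun k => ?_
  have hsub : F k ⊆ S.Y.closedCell a φ.cell := (hF2 k).trans (S.Y.openCell_subset a _)
  exact (((S.Y.isCompact_closedCell a φ.cell).of_isClosed_subset (hF1 k) hsub).image_of_continuousOn
    (((hS.complex a).continuousOn φ hφ.1).mono hsub)).isClosed.measurableSet

/-- The measure of a measurable subset of an `n`-cell. -/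
theorem IsAdmissible.measure_eq (hS : S.IsAdmissible Δ H) {a : ℤ} {φ : CharMap n (S.X a)}
    (hφ : φ ∈ S.topMaps a) {w : ℝ≥0} (hw : S.IsWeight a φ w) {B : Set (S.X a)}
    (hB : MeasurableSet B) (hsub : B ⊆ S.Y.closedImage a φ) :
    S.μ a B = w * volume (φ.toFun ⁻¹' B ∩ S.Y.closedCell a φ.cell) := by
  have := hS.borel a
  have hm : AEMeasurable φ.toFun (volume.restrict (S.Y.closedCell a φ.cell)) :=
    ((hS.complex a).continuousOn φ hφ.1).aemeasurable (S.Y.isClosed_closedCell a φ.cell).measurableSet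
  have h := congrArg (fun ν => ν B) hw
  rw [Measure.restrict_apply hB, inter_eq_left.2 hsub, Measure.smul_apply,
    Measure.map_apply_of_aemeasurable hm hB] at h
  rw [h, Measure.restrict_apply' (S.Y.isClosed_closedCell a φ.cell).measurableSet]
  rfl

theorem IsAdmissible.measure_closedImage (hS : S.IsAdmissible Δ H) (hm : 2 ≤ m) (hmv : m ≤ mv)
    {a i : ℤ} {φ : CharMap n (S.X a)} {w : ℝ≥0} (h : S.HasWeight a i φ w) :
    S.μ a (S.Y.closedImage i φ) = w * cellVolume n m mv i := by
  obtain ⟨hd, -, ψ, hψ, hsub, hfun, hw⟩ := h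
  have hmeas := hS.measurableSet_closedImage (φ := φ) (i := i) ⟨ψ, hψ.1, hsub, hfun⟩
  rw [hS.measure_eq hψ hw hmeas (by rw [Tilings.closedImage, hfun]; exact image_mono hsub),
    ← S.Y.volume_closedCell hd]
  congr 1
  refine le_antisymm ?_ (measure_mono fun x hx => ⟨⟨x, hx, by rw [hfun]⟩, hsub hx⟩)
  calc volume (ψ.toFun ⁻¹' S.Y.closedImage i φ ∩ S.Y.closedCell a ψ.cell)
      ≤ volume (S.Y.closedCell i φ.cell ∪ (S.Y.closedCell a ψ.cell \ S.Y.openCell a ψ.cell)) := by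
        refine measure_mono ?_
        rintro x ⟨⟨y, hy, hyx⟩, hx⟩
        by_cases hxo : x ∈ S.Y.openCell a ψ.cell
        · left
          rwa [hS.eq_of_mem_openCell hm hmv hψ.1 hxo (hsub hy) (by rw [← hyx, hfun])]
        · exact Or.inr ⟨hx, hxo⟩
    _ ≤ _ := measure_union_le _ _
    _ = volume (S.Y.closedCell i φ.cell) := by rw [S.Y.volume_boundary hψ.2, add_zero]

theorem IsAdmissible.map_π (hS : S.IsAdmissible Δ H) {i j : ℤ} (h : i ≤ j) :
    (S.μ i).map (S.π i j h) = S.μ j := by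
  have hmeas : ∀ {k l : ℤ} (h : k ≤ l), Measurable (S.π k l h) := fun {k l} h => by
    have := hS.borel k
    have := hS.borel l
    exact (S.π k l h).continuous.measurable
  induction j, h using Int.leInduction with
  | base =>
    have : (S.π i i le_rfl : S.X i → S.X i) = id := funext (S.π_self i)
    rw [this, Measure.map_id]
  | succ j h ih =>
    have : (S.π i (j + 1) (by lia) : S.X i → S.X (j + 1)) = S.next j ∘ S.π i j h :=
      funext fun p => (S.π_π h (by lia) p).symm
    have hnext : Measurable (S.next j) := hmeas (k := j) (l := j + 1) (by lia)
    rw [this, ← Measure.map_map hnext (hmeas h), ih, hS.pushforward]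

/-! ### Doubling -/

theorem measurable_toFine (hS : S.IsAdmissible Δ H) {a j : ℤ} (h : a ≤ j) :
    Measurable (toFine j h : S.X a → S.Fine j) := by
  have := hS.borel a
  have := hS.borel j
  exact (S.π a j h).continuous.measurable

theorem IsAdmissible.fineMeasure_eq (hS : S.IsAdmissible Δ H) {a j : ℤ} (h : a ≤ j)
    {B : Set (S.Fine j)} (hB : MeasurableSet B) :
    S.fineMeasure j B = S.μ a (toFine j h ⁻¹' B) := by
  have h1 : S.fineMeasure j = (S.μ a).map (toFine j h) := (hS.map_π h).symm
  rw [h1, Measure.map_apply (measurable_toFine hS h) hB]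

/-- Cells of any generation have the diameter assigned to them. -/
theorem IsAdmissible.edist_le_of_sub (hS : S.IsAdmissible Δ H) (hm : 2 ≤ m) (hmv : m ≤ mv)
    {i i' j a : ℤ} (haj : a ≤ j) (ha : a = min i j) (hi : i ≤ i') {φ : CharMap n (S.X a)}
    (hφ : φ ∈ S.subAt a i) {c : GridCell n} (hc : S.Y.closedCell i' c ⊆ S.Y.closedCell i φ.cell)
    {x y : EuclideanSpace ℝ (Fin n)} (hx : x ∈ S.Y.closedCell i' c)
    (hy : y ∈ S.Y.closedCell i' c) :
    edist (toFine j haj (φ.toFun x)) (toFine j haj (φ.toFun y)) ≤ size m i' := by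
  subst ha
  have h := (truncSystem hm hmv hS j).d_cell i' _
    ((truncSystem hm hmv hS j).subdiv_of_le hm hmv hi hφ hc) x hx y hy
  rwa [(truncSystem hm hmv hS j).toL_π, (truncSystem hm hmv hS j).toL_π] at h

/-- The ball is covered by a bounded number of cells adjacent to the cell of `φ`, whose weights are
at most `Δ w`. -/
theorem IsAdmissible.measure_ball_le (hS : S.IsAdmissible Δ H) (hm : 2 ≤ m) (hmv : m ≤ mv)
    (hH : 2 * (m + 1) * (H + 1) < mv) {i j a : ℤ} (haj : a ≤ j) (ha : a = min i j)
    {φ : CharMap n (S.X a)} {w : ℝ≥0} (hw : S.HasWeight a i φ w) {p : S.X a}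
    (hp : p ∈ S.Y.closedImage i φ) {r : ℝ≥0∞} (hr : r ≤ size m i) :
    S.fineMeasure j (Metric.eball (toFine j haj p) r) ≤
      (starBound n Δ * Δ : ℕ) * (w * cellVolume n m mv i) := by
  have hφ := hw.mem_subAt
  obtain ⟨t, ht1, ht2, ht3⟩ := hS.exists_ball_cover hm hmv hH haj ha hφ
  have := hS.borelSpace_fine hm hmv hH j
  rw [hS.fineMeasure_eq haj Metric.isOpen_eball.measurableSet]
  calc S.μ a (toFine j haj ⁻¹' Metric.eball (toFine j haj p) r)
      ≤ S.μ a (⋃ χ ∈ t, S.Y.closedImage i χ) := by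
        refine measure_mono fun q hq => ?_
        obtain ⟨χ, hχ, h⟩ := ht3 p hp q (by rw [edist_comm]; exact lt_of_lt_of_le hq hr)
        exact mem_iUnion₂.2 ⟨χ, hχ, h⟩
    _ ≤ ∑ χ ∈ t, S.μ a (S.Y.closedImage i χ) := measure_biUnion_finset_le _ _
    _ ≤ ∑ χ ∈ t, (Δ : ℝ≥0∞) * (w * cellVolume n m mv i) := by
        refine Finset.sum_le_sum fun χ hχ => ?_
        obtain ⟨h1, h2, h3⟩ := ht2 χ hχ
        obtain ⟨w', hw'⟩ := hS.exists_hasWeight hm hmv h1 h2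
        rw [hS.measure_closedImage hm hmv hw', ← mul_assoc]
        gcongr
        exact_mod_cast hS.weight_le hw' hw (by rwa [inter_comm])
    _ = t.card * ((Δ : ℝ≥0∞) * (w * cellVolume n m mv i)) := by simp
    _ ≤ _ := by
        push_cast
        rw [mul_assoc]
        gcongr

/-- The ball contains a cell of generation `i'`. -/
theorem IsAdmissible.le_measure_ball (hS : S.IsAdmissible Δ H) (hm : 2 ≤ m) (hmv : m ≤ mv)
    (hH : 2 * (m + 1) * (H + 1) < mv) {i i' j a : ℤ} (haj : a ≤ j) (ha : a = min i j) (hi : i ≤ i')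
    {φ : CharMap n (S.X a)} {w : ℝ≥0} (hw : S.HasWeight a i φ w) {p : S.X a}
    (hp : p ∈ S.Y.closedImage i φ) {r : ℝ≥0∞} (hr : size m i' < r) :
    w * cellVolume n m mv i' ≤ S.fineMeasure j (Metric.eball (toFine j haj p) r) := by
  have hφ := hw.mem_subAt
  obtain ⟨x, hx, rfl⟩ := hp
  obtain ⟨c, hcd, hc, hxc⟩ := S.Y.exists_subcell hm hmv hi hx
  have := hS.borelSpace_fine hm hmv hH j
  rw [hS.fineMeasure_eq haj Metric.isOpen_eball.measurableSet,
    ← hS.measure_closedImage hm hmv (hw.sub (hcd.trans hw.1) hc)]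
  refine measure_mono ?_
  rintro _ ⟨y, hy, rfl⟩
  exact (hS.edist_le_of_sub hm hmv haj ha hi hφ hc hy hxc).trans_lt hr

/-- The doubling constant. -/
def doublingConstant (n m mv Δ : ℕ) : ℕ := starBound n Δ * Δ * (m * mv ^ (n - 1)) ^ 3

theorem IsAdmissible.isDoubling (hS : S.IsAdmissible Δ H) (hm : 2 ≤ m) (hmv : m ≤ mv)
    (hH : 2 * (m + 1) * (H + 1) < mv) (j : ℤ) :
    IsDoublingMetricMeasureSpace (S.Fine j) (S.fineMeasure j) (doublingConstant n m mv Δ) := by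
  -- the two estimates for the measure of balls of radius `2 r < m ^ (-i)` and `r > m ^ (-(i + 3))`
  have key : ∀ (x : S.Fine j) (r : ℝ≥0), 0 < r → ∃ (i : ℤ) (w : ℝ≥0), 0 < w ∧
      w * cellVolume n m mv (i + 3) ≤ S.fineMeasure j (Metric.eball x r) ∧
      S.fineMeasure j (Metric.eball x (2 * r)) ≤
        (starBound n Δ * Δ : ℕ) * (w * cellVolume n m mv i) := by
    intro x r hr
    have hr' : (r : ℝ≥0∞) ≠ 0 := by exact_mod_cast hr.ne'
    obtain ⟨i, hi1, hi2⟩ := exists_size_le_lt (r := 2 * r) hm (by simp [hr'])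
      (ENNReal.mul_ne_top (by simp) (by simp))
    obtain ⟨p, hp⟩ := hS.surjective_π (min_le_right i j) x
    obtain ⟨φ, hφ, hφd, hpφ⟩ := hS.exists_mem_subAt hm hmv (min_le_left i j) p
    obtain ⟨w, hw⟩ := hS.exists_hasWeight hm hmv hφ hφd
    have hx : toFine j (min_le_right i j) p = x := hp
    refine ⟨i, w, hw.2.1, ?_, ?_⟩
    · rw [← hx]
      refine hS.le_measure_ball hm hmv hH _ rfl (by lia) hw hpφ ?_
      have h4 : 4 * size m (i + 3) ≤ size m (i + 1) := by
        rw [size_add hm (i + 1) 2, show i + 1 + (2 : ℕ) = i + 3 by push_cast; ring]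
        gcongr
        exact_mod_cast (by nlinarith : 4 ≤ m ^ 2)
      by_contra! hle
      have h5 : 4 * (r : ℝ≥0∞) ≤ 2 * r := (by gcongr : 4 * (r : ℝ≥0∞) ≤ _).trans (h4.trans hi1)
      have h6 : 4 * r ≤ 2 * r := by exact_mod_cast h5
      have : 0 < (r : ℝ) := hr
      have h7 : 4 * (r : ℝ) ≤ 2 * r := by exact_mod_cast h6
      linarith
    · rw [← hx]
      exact hS.measure_ball_le hm hmv hH _ rfl hw hpφ hi2.le
  refine ⟨fun x y => hS.edist_fine_ne_top x y, fun x y h => hS.eq_of_edist_fine_eq_zero hm hmv hH h,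
    hS.borelSpace_fine hm hmv hH j, fun x r hr => ?_, fun x r => ?_, fun x r => ?_⟩
  · obtain ⟨i, w, hw, h, -⟩ := key x r hr
    refine lt_of_lt_of_le (ENNReal.mul_pos ?_ (cellVolume_pos hm hmv _).ne') h
    exact_mod_cast hw.ne'
  · obtain ⟨i, w, hw, -, h⟩ := key x (r + 1) (by positivity)
    refine lt_of_le_of_lt (measure_mono (Metric.eball_subset_eball ?_)) (h.trans_lt ?_)
    · push_cast
      rw [two_mul]
      exact (le_add_right le_rfl).trans (le_add_right le_rfl)
    · exact ENNReal.mul_lt_top (ENNReal.natCast_lt_top _) (ENNReal.mul_lt_top (by simp) (cellVolume_ne_top i).lt_top)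
  · rcases eq_or_ne r 0 with rfl | hr
    · simp
    obtain ⟨i, w, hw, h1, h2⟩ := key x r (pos_iff_ne_zero.2 hr)
    refine h2.trans ?_
    rw [cellVolume_add hm hmv i 3, doublingConstant]
    calc _ = (starBound n Δ * Δ * (m * mv ^ (n - 1)) ^ 3 : ℕ) *
          ((w : ℝ≥0∞) * cellVolume n m mv (i + 3)) := by push_cast; ring
      _ ≤ _ := by
        rw [ENNReal.coe_natCast]
        gcongr

end System

/-! ### Distances of coordinates to the lattice -/

namespace Tilings

variable {n m mv : ℕ} [NeZero n] (Y : Tilings n m mv)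

/-- Up to an error `ε`, some coordinate of `a` other than the first one has a lattice coordinate
of generation `i` at distance `τ`. -/
def HasLatDist (i : ℤ) (a : EuclideanSpace ℝ (Fin n)) (τ ε : ℝ) : Prop :=
  ∃ k : Fin n, k ≠ 0 ∧ ∃ z, Y.LatCoord i k z ∧ |(|a k - z|) - τ| ≤ ε

variable {Y}

/-- Symmetries of the tiling preserve the distances of the vertical coordinates to the lattice. -/
theorem HasLatDist.gridMap {i : ℤ} {a : EuclideanSpace ℝ (Fin n)} {τ ε : ℝ}
    (h : Y.HasLatDist i a τ ε) {g : EuclideanSpace ℝ (Fin n) → EuclideanSpace ℝ (Fin n)}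
    (hg : Y.IsGridMap i g) : Y.HasLatDist i (g a) τ ε := by
  obtain ⟨k, hk, z, hz, h⟩ := h
  obtain ⟨σ, e, h0, he, hσ⟩ := hg.signedPerm
  obtain ⟨w₀, hw₀⟩ := Y.exists_isLat i
  let w : EuclideanSpace ℝ (Fin n) := WithLp.toLp 2 (Function.update (fun l => w₀ l) k z)
  have hwk : w k = z := by simp [w]
  have hw : Y.IsLat i w := by
    intro l
    by_cases hl : l = k
    · subst hl; rwa [hwk]
    · simpa [w, hl] using hw₀ l
  refine ⟨σ k, fun h => hk (σ.injective (h.trans h0.symm)), g w (σ k), hg.isLat w hw _, ?_⟩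
  rw [hσ, hwk, abs_mul]
  have : |e k| = 1 := by rcases he k with h | h <;> simp [h]
  rwa [this, one_mul]

theorem HasLatDist.near {i : ℤ} {a b : EuclideanSpace ℝ (Fin n)} {τ ε s : ℝ}
    (h : Y.HasLatDist i a τ ε) (hab : ∀ k : Fin n, k ≠ 0 → |a k - b k| ≤ s) :
    Y.HasLatDist i b τ (ε + s) := by
  obtain ⟨k, hk, z, hz, h⟩ := h
  refine ⟨k, hk, z, hz, ?_⟩
  have h1 : |(|b k - z|) - (|a k - z|)| ≤ |a k - b k| := by
    refine (abs_abs_sub_abs_le _ _).trans (le_of_eq ?_)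
    rw [abs_sub_comm]
    congr 1
    ring
  have h2 := abs_add_le (|b k - z| - |a k - z|) (|a k - z| - τ)
  rw [sub_add_sub_cancel] at h2
  linarith [hab k hk]

theorem HasLatDist.mono {i : ℤ} {a : EuclideanSpace ℝ (Fin n)} {τ ε ε' : ℝ}
    (h : Y.HasLatDist i a τ ε) (hε : ε ≤ ε') : Y.HasLatDist i a τ ε' := by
  obtain ⟨k, hk, z, hz, h⟩ := h
  exact ⟨k, hk, z, hz, h.trans hε⟩

/-- Among `n + 1` well spaced values between `σ / 2` and `3 σ / 4`, where `σ` is the lattice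
spacing, at least one is far from the distances of the coordinates of `a` to lattice points: each
coordinate excludes at most one value, as it has at most one such distance in this range. -/
theorem exists_threshold (hm : 2 ≤ m) (hmv : m ≤ mv) {i : ℤ} (a : EuclideanSpace ℝ (Fin n)) {ε : ℝ}
    (hε : 8 * (n + 2) * ε < (mv : ℝ) ^ (-i)) :
    ∃ τ : ℝ, (mv : ℝ) ^ (-i) / 2 < τ ∧ τ < 3 / 4 * (mv : ℝ) ^ (-i) ∧ ¬ Y.HasLatDist i a τ ε := by
  set σ := (mv : ℝ) ^ (-i) with hσ
  have hσ0 : 0 < σ := by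
    have : (0 : ℝ) < mv := by exact_mod_cast (by lia : 0 < mv)
    positivity
  set g := σ / (4 * (n + 2)) with hg
  have hg0 : 0 < g := by positivity
  have hgσ : g * (n + 2) = σ / 4 := by rw [hg]; field_simp
  have hεg : 2 * ε < g := by rw [hg, lt_div_iff₀ (by positivity)]; linarith
  by_contra! hcon
  have hbad : ∀ l : Fin (n + 1), Y.HasLatDist i a (σ / 2 + (l + 1) * g) ε := by
    intro l
    refine hcon _ (by nlinarith [(Nat.cast_nonneg l.1 : (0 : ℝ) ≤ l.1)]) ?_
    have : ((l : ℕ) : ℝ) + 1 ≤ n + 1 := by exact_mod_cast l.2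
    nlinarith
  choose k hk z hz hd using hbad
  obtain ⟨l, l', hne, hkk⟩ := Fintype.exists_ne_map_eq_of_card_lt k (by simp)
  have hz' := hz l'
  have hd' := hd l'
  rw [← hkk] at hz' hd'
  obtain ⟨N, hN⟩ := (hz l).exists_sub hz'
  rw [side_of_ne (hk l), ← hσ] at hN
  have h1 := abs_le.1 (hd l)
  have h2 := abs_le.1 hd'
  have hl : ∀ l : Fin (n + 1), g ≤ ((l : ℕ) + 1) * g ∧ (((l : ℕ) : ℝ) + 1) * g + g ≤ σ / 4 := by
    intro l
    have : ((l : ℕ) : ℝ) + 1 ≤ n + 1 := by exact_mod_cast l.2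
    exact ⟨by nlinarith [(Nat.cast_nonneg l.1 : (0 : ℝ) ≤ l.1)], by nlinarith⟩
  have b1 := hl l
  have b2 := hl l'
  have heq : |a (k l) - z l| = |a (k l) - z l'| := by
    by_cases hN0 : N = 0
    · rw [show z l = z l' by rw [hN0] at hN; simp at hN; linarith]
    exfalso
    have hN1 : σ ≤ |z l - z l'| := by
      rw [hN, abs_mul, abs_of_pos hσ0]
      have : (1 : ℝ) ≤ |(N : ℝ)| := by exact_mod_cast Int.one_le_abs hN0
      nlinarith
    have hN2 : |z l - z l'| = σ ∨ 2 * σ ≤ |z l - z l'| := by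
      rw [hN, abs_mul, abs_of_pos hσ0]
      rcases (Int.one_le_abs hN0).eq_or_lt with h | h
      · left
        have : |(N : ℝ)| = 1 := by exact_mod_cast h.symm
        rw [this, one_mul]
      · right
        have : (2 : ℝ) ≤ |(N : ℝ)| := by exact_mod_cast h
        nlinarith
    rcases abs_cases (a (k l) - z l) with ⟨e1, _⟩ | ⟨e1, _⟩ <;>
      rcases abs_cases (a (k l) - z l') with ⟨e2, _⟩ | ⟨e2, _⟩ <;>
      rcases abs_cases (z l - z l') with ⟨e3, _⟩ | ⟨e3, _⟩ <;>
      rcases hN2 with h | h <;> rw [e1] at h1 <;> rw [e2] at h2 <;> rw [e3] at h hN1 <;> linarith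
  rw [heq] at h1
  have h3 : |(((l : ℕ) : ℝ) - (l' : ℕ)) * g| < g := by
    rw [abs_lt]
    constructor <;> linarith
  rw [abs_mul, abs_of_pos hg0] at h3
  have h4 : (1 : ℝ) ≤ |((l : ℕ) : ℝ) - (l' : ℕ)| := by
    have : (1 : ℤ) ≤ |((l : ℕ) : ℤ) - (l' : ℕ)| :=
      Int.one_le_abs (sub_ne_zero.2 fun h => hne (Fin.ext (by exact_mod_cast h)))
    exact_mod_cast this
  nlinarith

end Tilings

/-! ### Points with nearby images in the limit space -/

namespace System

variable {n m mv : ℕ} [NeZero n] {S : System.{u} n m mv} {Δ H : ℕ}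

theorem IsAdmissible.push_subAt (hS : S.IsAdmissible Δ H) (hm : 2 ≤ m) (hmv : m ≤ mv) {j i : ℤ}
    (hji : j ≤ i) {φ : CharMap n (S.X j)} (hφ : φ ∈ S.subAt j i) :
    ⟨φ.cell, fun p => S.π j i hji (φ.toFun p)⟩ ∈ S.Φ i := by
  obtain ⟨ψ, hψ, h1, h2⟩ := hφ
  rw [h2]
  exact (limitSystem hm hmv hS).subdiv_of_le hm hmv hji hψ h1

/-- Points of `X j` with nearby images in the limit space lie in cells whose images in `X i`
intersect. -/
theorem IsAdmissible.meet_of_edist_toLimit (hS : S.IsAdmissible Δ H) (hm : 2 ≤ m) (hmv : m ≤ mv)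
    (hH : 2 * (m + 1) * (H + 1) < mv) {i j : ℤ} (hji : j ≤ i) {φ ψ : CharMap n (S.X j)}
    (hφ : φ ∈ S.subAt j i) (hψ : ψ ∈ S.subAt j i) {a b : EuclideanSpace ℝ (Fin n)}
    (ha : a ∈ S.Y.closedCell i φ.cell) (hb : b ∈ S.Y.closedCell i ψ.cell)
    (h : edist (S.toLimit j (φ.toFun a)) (S.toLimit j (ψ.toFun b)) < size m i) :
    (S.Y.closedImage i (⟨φ.cell, fun p => S.π j i hji (φ.toFun p)⟩ : CharMap n (S.X i)) ∩
      S.Y.closedImage i ⟨ψ.cell, fun p => S.π j i hji (ψ.toFun p)⟩).Nonempty :=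
  hS.meet_of_edist_limit hm hmv hH (hS.push_subAt hm hmv hji hφ) (hS.push_subAt hm hmv hji hψ)
    ⟨a, ha, rfl⟩ ⟨b, hb, rfl⟩ (by simp only [toLimit_π]; exact h)

/-- Points with nearby images in the limit space have nearby first coordinates. -/
theorem IsAdmissible.abs_fst_sub_le (hS : S.IsAdmissible Δ H) (hm : 2 ≤ m) (hmv : m ≤ mv)
    (hH : 2 * (m + 1) * (H + 1) < mv) {i i' j : ℤ} (hji : j ≤ i) (hii : i ≤ i')
    {φ ψ : CharMap n (S.X j)} (hφ : φ ∈ S.subAt j i) (hψ : ψ ∈ S.subAt j i)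
    {a b : EuclideanSpace ℝ (Fin n)} (ha : a ∈ S.Y.closedCell i φ.cell)
    (hb : b ∈ S.Y.closedCell i ψ.cell)
    (h : edist (S.toLimit j (φ.toFun a)) (S.toLimit j (ψ.toFun b)) < size m i') :
    |a 0 - b 0| ≤ 2 * (m : ℝ) ^ (-i') := by
  obtain ⟨c, -, hc, hac⟩ := S.Y.exists_subcell hm hmv hii ha
  obtain ⟨c', -, hc', hbc⟩ := S.Y.exists_subcell hm hmv hii hb
  have h1 : (⟨c, φ.toFun⟩ : CharMap n (S.X j)) ∈ S.subAt j i' := subAt_sub hφ hc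
  have h2 : (⟨c', ψ.toFun⟩ : CharMap n (S.X j)) ∈ S.subAt j i' := subAt_sub hψ hc'
  obtain ⟨u, ⟨x, hx, hxu⟩, y, hy, hyu⟩ :=
    hS.meet_of_edist_toLimit hm hmv hH (hji.trans hii) h1 h2 hac hbc h
  have e1 := hS.compat_x i' _ (hS.push_subAt hm hmv (hji.trans hii) h1) x hx
  have e2 := hS.compat_x i' _ (hS.push_subAt hm hmv (hji.trans hii) h2) y hy
  simp only at e1 e2 hxu hyu
  rw [hxu] at e1
  rw [hyu] at e2
  have d1 := S.Y.abs_sub_le_side hac hx hm hmv 0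
  have d2 := S.Y.abs_sub_le_side hy hbc hm hmv 0
  rw [side_zero] at d1 d2
  have := abs_sub_le (a 0) (x 0) (b 0)
  rw [show x 0 = y 0 by rw [← e1, ← e2]] at this d1
  linarith

theorem hasLatDist_of_path (hS : S.IsAdmissible Δ H) (hm : 2 ≤ m) (hmv : m ≤ mv) {i : ℤ}
    {φ ψ : CharMap n (S.X i)} (hφ : φ ∈ S.Φ i) (hψ : ψ ∈ S.Φ i) {a b : EuclideanSpace ℝ (Fin n)}
    (ha : a ∈ S.Y.closedCell i φ.cell) (hb : b ∈ S.Y.closedCell i ψ.cell) {l : ℕ} {v : ℕ → S.X i}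
    (hv0 : v 0 = φ.toFun a) (hvl : v l = ψ.toFun b)
    (hv : ∀ t < l, VStep S.Y i (S.Φ i) (v t) (v (t + 1))) {τ ε : ℝ}
    (h : S.Y.HasLatDist i a τ ε) : S.Y.HasLatDist i b τ (ε + l * (mv : ℝ) ^ (-(i + 1))) := by
  -- the property passes from one set of coordinates of a point to another one
  have htr : ∀ {φ ψ : CharMap n (S.X i)} {a b : EuclideanSpace ℝ (Fin n)} {τ ε : ℝ}, φ ∈ S.Φ i →
      ψ ∈ S.Φ i → a ∈ S.Y.closedCell i φ.cell → b ∈ S.Y.closedCell i ψ.cell →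
      φ.toFun a = ψ.toFun b → S.Y.HasLatDist i a τ ε → S.Y.HasLatDist i b τ ε := by
    intro φ ψ a b τ ε hφ hψ ha hb hab h
    obtain ⟨g, hg, rfl, -⟩ := hS.transfer hm hmv le_rfl (hS.subAt_self i ▸ hφ)
      (hS.subAt_self i ▸ hψ) ha hb hab
    exact h.gridMap hg
  induction l generalizing ψ b with
  | zero => simpa using htr hφ hψ ha hb (hv0.symm.trans hvl) h
  | succ l ih =>
    obtain ⟨χ, hχ, x, hx, y, hy, hxv, hyv, -, hxy⟩ := hv l (by lia)
    have h1 := (ih hχ hx hxv.symm fun t ht => hv t (by lia)).near (s := (mv : ℝ) ^ (-(i + 1)))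
      fun k hk => (hxy k hk).trans_eq (side_of_ne hk)
    refine (htr hχ hψ hy hb (hyv.trans hvl) h1).mono (le_of_eq ?_)
    push_cast
    ring

/-- Points with nearby images in the limit space have nearly the same distances of coordinates to
the lattice. -/
theorem IsAdmissible.hasLatDist_of_edist (hS : S.IsAdmissible Δ H) (hm : 2 ≤ m) (hmv : m ≤ mv)
    (hH : 2 * (m + 1) * (H + 1) < mv) {i j : ℤ} (hji : j ≤ i)
    {φ ψ : CharMap n (S.X j)} (hφ : φ ∈ S.subAt j i) (hψ : ψ ∈ S.subAt j i)
    {a b : EuclideanSpace ℝ (Fin n)} (ha : a ∈ S.Y.closedCell i φ.cell)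
    (hb : b ∈ S.Y.closedCell i ψ.cell)
    (hab : edist (S.toLimit j (φ.toFun a)) (S.toLimit j (ψ.toFun b)) < size m (i + 1)) {τ ε : ℝ}
    (h : S.Y.HasLatDist i a τ ε) :
    S.Y.HasLatDist i b τ (ε + (H + 2) * (mv : ℝ) ^ (-(i + 1))) := by
  have hii : i ≤ i + 1 := by lia
  have hs0 : 0 < (mv : ℝ) ^ (-(i + 1)) := by
    have : (0 : ℝ) < mv := by exact_mod_cast (by lia : 0 < mv)
    positivity
  obtain ⟨c, -, hc, hac⟩ := S.Y.exists_subcell hm hmv hii ha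
  obtain ⟨c', -, hc', hbc⟩ := S.Y.exists_subcell hm hmv hii hb
  have h1 : (⟨c, φ.toFun⟩ : CharMap n (S.X j)) ∈ S.subAt j (i + 1) := subAt_sub hφ hc
  have h2 : (⟨c', ψ.toFun⟩ : CharMap n (S.X j)) ∈ S.subAt j (i + 1) := subAt_sub hψ hc'
  have p1 := hS.push_subAt hm hmv (hji.trans hii) h1
  have p2 := hS.push_subAt hm hmv (hji.trans hii) h2
  obtain ⟨w, hw, hwl, w', hw', -, hww⟩ := hS.exists_common_vertex hm hmv le_rfl
    (hS.subAt_self (i + 1) ▸ p1) (hS.subAt_self (i + 1) ▸ p2)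
    (hS.meet_of_edist_toLimit hm hmv hH (hji.trans hii) h1 h2 hac hbc hab)
  obtain ⟨l, hl, v, hv0, hvl, hv⟩ := hS.fiber_path hm hmv hii (Or.inr ⟨rfl, rfl⟩)
    (hS.subAt_self (i + 1) ▸ p1) hw hwl (y := S.π j i hji (φ.toFun w))
    (y' := S.π j i hji (ψ.toFun w')) (S.π_π hji hii _) ((S.π_π hji hii _).trans hww)
  rw [hS.subAt_self] at hv
  have hd : ∀ {c : GridCell n} {x y : EuclideanSpace ℝ (Fin n)}, x ∈ S.Y.closedCell (i + 1) c →
      y ∈ S.Y.closedCell (i + 1) c → ∀ k : Fin n, k ≠ 0 → |x k - y k| ≤ (mv : ℝ) ^ (-(i + 1)) :=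
    fun hx hy k hk => (S.Y.abs_sub_le_side hx hy hm hmv k).trans_eq (side_of_ne hk)
  refine ((hasLatDist_of_path hS hm hmv (hS.push_subAt hm hmv hji hφ) (hS.push_subAt hm hmv hji hψ)
    (hc hw) (hc' hw') hv0 hvl hv (h.near (hd hac hw))).near (hd hw' hbc)).mono ?_
  have : (l : ℝ) ≤ H := by exact_mod_cast hl
  nlinarith

end System

/-! ### The projection is Lipschitz light -/

namespace System

variable {n m mv : ℕ} [NeZero n] {S : System.{u} n m mv} {Δ H : ℕ}

theorem edist_asFine_le {j i : ℤ} (h : j ≤ i) {φ : CharMap n (S.X j)} (hφ : φ ∈ S.subAt j i)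
    {p q : S.X j} (hp : p ∈ S.Y.closedImage i φ) (hq : q ∈ S.Y.closedImage i φ) :
    edist (asFine p) (asFine q) ≤ size m i := by
  have := edist_fine_le_sub h hφ hp hq
  rwa [toFine_self, toFine_self] at this

theorem IsAdmissible.edist_toLimit_le_edist (hS : S.IsAdmissible Δ H) (hm : 2 ≤ m) (hmv : m ≤ mv)
    {j : ℤ} (p q : S.Fine j) : edist (S.toLimit j p) (S.toLimit j q) ≤ edist p q := by
  refine le_edist_fine (isPseudoDist_edist_comp (S.toLimit j)) ?_ ?_ p q
  · intro i hi φ hφ p hp q hq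
    simp only [toLimit_π]
    exact edist_toLimit_le hφ hp hq
  · rintro i hi φ hφ _ ⟨a, ha, rfl⟩ _ ⟨b, hb, rfl⟩
    have := edist_toLimit_le (hS.push_subAt hm hmv hi hφ) ⟨a, ha, rfl⟩ ⟨b, hb, rfl⟩
    simpa only [toLimit_π] using this

theorem IsAdmissible.lipschitz_proj (hS : S.IsAdmissible Δ H) (hm : 2 ≤ m) (hmv : m ≤ mv) (j : ℤ) :
    LipschitzWith 1 (S.proj j) := by
  intro p q
  rw [ENNReal.coe_one, one_mul]
  exact (SeparationQuotient.edist_mk _ _).trans_le (hS.edist_toLimit_le_edist hm hmv p q)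

/-- The description of the points which can be reached from `φ₀ a₀` by small steps without leaving
the inverse image of a small set: they lie in a cell of generation `i` containing the fixed
vertex `u`, and their distance from `u` in the directions other than the first one is less than
the threshold `τ`. -/
def IsCaptured (S : System.{u} n m mv) {j : ℤ} (i : ℤ) (u : S.X j) (τ : ℝ) (p : S.X j) : Prop :=
  ∃ φ ∈ S.subAt j i, ∃ a ∈ S.Y.closedCell i φ.cell, φ.toFun a = p ∧
    ∃ w ∈ S.Y.closedCell i φ.cell, S.Y.IsLat i w ∧ φ.toFun w = u ∧
      (∀ k : Fin n, k ≠ 0 → |a k - w k| < τ) ∧ |a 0 - w 0| ≤ 3 / 4 * (m : ℝ) ^ (-i)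

/-- A step of size less than `m ^ (-(i + 3))` does not leave the set of captured points, if no
distance of a coordinate to the lattice is close to the threshold. -/
theorem IsAdmissible.isCaptured_step (hS : S.IsAdmissible Δ H) (hm : 2 ≤ m) (hmv : m ≤ mv)
    (hH : 2 * (m + 1) * (H + 1) < mv) {i j : ℤ} (hji : j ≤ i) {u : S.X j} {τ : ℝ}
    (hτ : τ < 3 / 4 * (mv : ℝ) ^ (-i)) {φ₀ : CharMap n (S.X j)} (hφ₀ : φ₀ ∈ S.subAt j i)
    {a₀ w₀ : EuclideanSpace ℝ (Fin n)} (ha₀ : a₀ ∈ S.Y.closedCell i φ₀.cell)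
    (hw₀ : w₀ ∈ S.Y.closedCell i φ₀.cell) (hu : φ₀.toFun w₀ = u)
    (haw₀ : |a₀ 0 - w₀ 0| ≤ (m : ℝ) ^ (-i) / 2)
    (hthr : ¬ S.Y.HasLatDist i a₀ τ ((H + 4) * (mv : ℝ) ^ (-(i + 1)))) {p q : S.X j}
    (hp : S.IsCaptured i u τ p)
    (hpq : edist (asFine p) (asFine q) < size m (i + 3))
    (hq : edist (S.toLimit j (φ₀.toFun a₀)) (S.toLimit j q) < size m (i + 3)) :
    S.IsCaptured i u τ q := by
  obtain ⟨φ, hφ, a, ha, rfl, w, hw, hwl, hwu, haw, haw0⟩ := hp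
  have hm0 : (0 : ℝ) < m := by exact_mod_cast (by lia : 0 < m)
  have hm2 : (2 : ℝ) ≤ m := by exact_mod_cast hm
  have hmv0 : (0 : ℝ) < mv := by exact_mod_cast (by lia : 0 < mv)
  have hmv2 : (2 : ℝ) ≤ mv := by exact_mod_cast hm.trans hmv
  have hpow : ∀ b : ℝ, 2 ≤ b → 8 * b ^ (-(i + 3)) ≤ b ^ (-i) ∧ b ^ (-(i + 3)) ≤ b ^ (-(i + 1)) := by
    intro b hb
    have hb0 : 0 < b := by linarith
    constructor
    · rw [show -i = -(i + 3) + (3 : ℕ) by push_cast; ring, zpow_add₀ hb0.ne', zpow_natCast, mul_comm]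
      have : (8 : ℝ) ≤ b ^ 3 := by nlinarith [pow_two_nonneg b, mul_self_nonneg (b - 2)]
      gcongr
    · exact zpow_le_zpow_right₀ (by linarith) (by lia)
  obtain ⟨hx8, -⟩ := hpow m hm2
  obtain ⟨hv8, hv1⟩ := hpow mv hmv2
  set X := (m : ℝ) ^ (-i)
  set X3 := (m : ℝ) ^ (-(i + 3)) with hX3
  set V := (mv : ℝ) ^ (-i) with hV
  set V3 := (mv : ℝ) ^ (-(i + 3)) with hV3
  have hX3p : 0 < X3 := by positivity
  have hV3p : 0 < V3 := by positivity
  -- cells of generation `i + 3` containing the two points intersect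
  obtain ⟨c, -, hc, hac⟩ := S.Y.exists_subcell hm hmv (by lia : i ≤ i + 3) ha
  obtain ⟨ψ, hψ, -, b, hb, rfl⟩ := hS.exists_mem_subAt hm hmv (by lia : j ≤ i + 3) q
  obtain ⟨ψ', hψ', hsub, hfun⟩ := hψ
  obtain ⟨e, he1, he2⟩ := S.Y.exists_between hm hmv hji (by lia : i ≤ i + 3) hsub
  have hψe : (⟨e, ψ.toFun⟩ : CharMap n (S.X j)) ∈ S.subAt j i := ⟨ψ', hψ', he2, hfun⟩
  obtain ⟨_, ⟨x, hx, rfl⟩, y, hy, hyx⟩ := hS.meet_of_edist_fine (i := i + 3) hm hmv hH le_rfl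
    (by lia) (φ := ⟨c, φ.toFun⟩) (subAt_sub hφ hc) ⟨ψ', hψ', hsub, hfun⟩ ⟨a, hac, rfl⟩
    ⟨b, hb, rfl⟩ (by rwa [toFine_self, toFine_self])
  have hxa := S.Y.abs_sub_le_side hx hac hm hmv
  have hby := S.Y.abs_sub_le_side hb hy hm hmv
  have hxw : ∀ k : Fin n, k ≠ 0 → |x k - w k| < (τ + V3) / V * side m mv i k := by
    intro k hk
    rw [side_of_ne hk, div_mul_cancel₀ _ (by positivity)]
    have h1 := abs_sub_le (x k) (a k) (w k)
    have h2 := hxa k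
    rw [side_of_ne hk] at h2
    linarith [haw k hk]
  obtain ⟨g, hg, rfl, htr⟩ := hS.transfer hm hmv hji hφ hψe (hc hx) (he1 hy) hyx.symm
  obtain ⟨hgw, hgwu⟩ := htr w hw hwl fun k => by
    by_cases hk : k = 0
    · subst hk
      have h1 := abs_sub_le (x 0) (a 0) (w 0)
      have h2 := hxa 0
      rw [side_zero] at h2 ⊢
      linarith
    · refine (hxw k hk).trans_le ?_
      rw [side_of_ne hk, div_mul_cancel₀ _ (by positivity)]
      linarith
  have hbw : ∀ k : Fin n, k ≠ 0 → |b k - g w k| < τ + 2 * V3 := by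
    intro k hk
    have h1 := abs_sub_le (b k) (g x k) (g w k)
    have h2 := hby k
    have h3 := hg.bound_lt hxw k hk
    rw [side_of_ne hk] at h2 h3
    rw [div_mul_cancel₀ _ (by positivity)] at h3
    linarith
  refine ⟨⟨e, ψ.toFun⟩, hψe, b, he1 hb, rfl, g w, hgw, hg.isLat w hwl, hgwu.trans hwu,
    fun k hk => ?_, ?_⟩
  · by_contra! hle
    refine hthr ((hS.hasLatDist_of_edist hm hmv hH hji hψe hφ₀ (he1 hb) ha₀ (τ := τ) (ε := 2 * V3)
      ?_ ⟨k, hk, g w k, hg.isLat w hwl k, ?_⟩).mono ?_)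
    · rw [edist_comm]
      exact hq.trans_le (size_anti hm (by lia))
    · rw [abs_of_nonneg (by linarith)]
      linarith [hbw k hk]
    · linarith
  · have h1 := hS.abs_fst_sub_le hm hmv hH hji (by lia : i ≤ i + 3) hψe hφ₀ (he1 hb) ha₀
      (by rw [edist_comm]; exact hq)
    have h2 : g w 0 = w₀ 0 := by
      have e1 := hS.compat_x i _ (hS.push_subAt hm hmv hji hψe) _ hgw
      have e2 := hS.compat_x i _ (hS.push_subAt hm hmv hji hφ₀) _ hw₀
      simp only at e1 e2 hgwu
      rw [← e1, ← e2, hgwu, hwu, hu]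
    rw [h2]
    have h3 := abs_sub_le (b 0) (a₀ 0) (w₀ 0)
    linarith

/-- Points whose distance in the limit space is less than `m ^ (-i)`, with `i ≤ j`, are close in
`X j`. -/
theorem IsAdmissible.edist_le_of_edist_toLimit (hS : S.IsAdmissible Δ H) (hm : 2 ≤ m)
    (hmv : m ≤ mv) (hH : 2 * (m + 1) * (H + 1) < mv) {i j : ℤ} (hij : i ≤ j) {p q : S.Fine j}
    (h : edist (S.toLimit j p) (S.toLimit j q) < size m i) :
    edist p q ≤ size m i + size m i := by
  obtain ⟨p', hp'⟩ := hS.surjective_π hij p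
  obtain ⟨q', hq'⟩ := hS.surjective_π hij q
  obtain ⟨φ, hφ, hpφ⟩ := hS.union_topCells i p'
  obtain ⟨ψ, hψ, hqψ⟩ := hS.union_topCells i q'
  obtain ⟨u, hu1, hu2⟩ := hS.meet_of_edist_limit hm hmv hH hφ.1 hψ.1 hpφ hqψ (by
    rw [← toLimit_π hij, ← toLimit_π hij, hp', hq']
    exact h)
  have e1 := edist_fine_le hij hφ.1 hpφ hu1
  have e2 := edist_fine_le hij hψ.1 hu2 hqψ
  have hp'' : toFine j hij p' = p := hp'
  have hq'' : toFine j hij q' = q := hq'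
  rw [hp''] at e1
  rw [hq''] at e2
  exact (edist_triangle _ _ _).trans (add_le_add e1 e2)

/-- The components of the inverse image of a small set are small. -/
theorem IsAdmissible.edist_le_of_component (hS : S.IsAdmissible Δ H) (hm : 2 ≤ m) (hmv : m ≤ mv)
    (hH : 2 * (m + 1) * (H + 1) < mv) (hM : 8 * (n + 2) * (H + 4) < mv) {j : ℤ}
    {W : Set S.LimitSpace} {δ : ℝ≥0∞} (hδ0 : δ ≠ 0) (hδ : δ ≠ ⊤)
    (hW : ∀ u ∈ W, ∀ v ∈ W, edist u v ≤ δ) {p q : S.Fine j}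
    (h : InSameComponent δ (S.proj j ⁻¹' W) p q) : edist p q ≤ 2 * m ^ 4 * δ := by
  obtain ⟨i, hi1, hi2⟩ := exists_size_le_lt hm hδ0 hδ
  obtain ⟨i, rfl⟩ : ∃ i', i = i' + 3 := ⟨i - 3, by ring⟩
  obtain ⟨hpW, hchain⟩ := h
  have hsize : size m i + size m i ≤ 2 * m ^ 4 * δ := by
    rw [← two_mul, size_add hm i 4, ← mul_assoc]
    gcongr
    rwa [show i + ((4 : ℕ) : ℤ) = i + 3 + 1 by lia]
  have hlim : ∀ q : S.Fine j, q ∈ S.proj j ⁻¹' W →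
      edist (S.toLimit j p) (S.toLimit j q) < size m (i + 3) := fun q hq =>
    (SeparationQuotient.edist_mk _ _).symm.trans_lt ((hW _ hpW _ hq).trans_lt hi2)
  rcases le_total i j with hij | hji
  · -- all points of the inverse image are close to each other
    have hqW : q ∈ S.proj j ⁻¹' W := by
      induction hchain with
      | refl => exact hpW
      | tail _ h _ => exact h.2.1
    exact (hS.edist_le_of_edist_toLimit hm hmv hH hij
      ((hlim q hqW).trans_le (size_anti hm (by lia)))).trans hsize
  · obtain ⟨φ, hφ, -, a, ha, hap⟩ := hS.exists_mem_subAt hm hmv hji (p : S.X j)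
    obtain ⟨w, hw, hwl, haw⟩ := S.Y.exists_near_vertex hm hmv le_rfl ha
    have hmv0 : (0 : ℝ) < mv := by exact_mod_cast (by lia : 0 < mv)
    obtain ⟨τ, hτ1, hτ2, hthr⟩ := Tilings.exists_threshold (Y := S.Y) hm hmv (i := i) a
      (ε := (H + 4) * (mv : ℝ) ^ (-(i + 1))) (by
        rw [show -i = -(i + 1) + 1 by ring, zpow_add₀ hmv0.ne', zpow_one, mul_comm (_ ^ _) (mv : ℝ),
          ← mul_assoc]
        have hM' : 8 * ((n : ℝ) + 2) * (H + 4) < mv := by exact_mod_cast hM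
        exact mul_lt_mul_of_pos_right hM' (by positivity))
    have hcap : S.IsCaptured i (φ.toFun w) τ q := by
      induction hchain with
      | refl =>
        refine ⟨φ, hφ, a, ha, hap, w, hw, hwl, rfl, fun k hk => ?_, ?_⟩
        · have := haw k
          rw [side_of_ne hk] at this
          linarith
        · have h1 := haw 0
          have h2 := side_pos (n := n) hm hmv i 0
          rw [side_zero] at h1 h2
          linarith
      | tail _ h ih =>
        refine hS.isCaptured_step hm hmv hH hji hτ2 hφ ha hw rfl ?_ hthr ih ?_ ?_
        · have h1 := haw 0
          rwa [side_zero] at h1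
        · exact h.2.2.trans_lt hi2
        · rw [hap]
          exact hlim _ h.2.1
    obtain ⟨ψ, hψ, b, hb, rfl, w', hw', -, hwu, -, -⟩ := hcap
    have e1 : edist p (asFine (φ.toFun w)) ≤ size m i :=
      edist_asFine_le hji hφ ⟨a, ha, hap⟩ ⟨w, hw, rfl⟩
    have e2 : edist (asFine (φ.toFun w)) (asFine (ψ.toFun b)) ≤ size m i :=
      edist_asFine_le hji hψ ⟨w', hw', hwu⟩ ⟨b, hb, rfl⟩
    exact (edist_triangle _ _ _).trans ((add_le_add e1 e2).trans hsize)

/-- The constant of Lipschitz lightness. -/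
def lightConstant (m : ℕ) : ℕ := 4 * m ^ 4

theorem IsAdmissible.isLipschitzLight (hS : S.IsAdmissible Δ H) (hm : 2 ≤ m) (hmv : m ≤ mv)
    (hH : 2 * (m + 1) * (H + 1) < mv) (hM : 8 * (n + 2) * (H + 4) < mv) (j : ℤ) :
    IsLipschitzLight (S.proj j) (lightConstant m) := by
  refine ⟨(hS.lipschitz_proj hm hmv j).weaken ?_, fun W hW p => Metric.ediam_le fun x hx y hy => ?_⟩
  · have : 1 ≤ lightConstant m := Nat.mul_pos (by norm_num) (pow_pos (by lia) 4)
    exact_mod_cast this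
  rcases eq_or_ne (Metric.ediam W) 0 with h0 | h0
  · -- steps of length zero do not move
    have key : ∀ z, InSameComponent (Metric.ediam W) (S.proj j ⁻¹' W) p z → z = p := by
      rintro z ⟨-, hz⟩
      induction hz with
      | refl => rfl
      | tail _ h ih =>
        rw [← ih]
        exact (hS.eq_of_edist_fine_eq_zero hm hmv hH (le_antisymm (h0 ▸ h.2.2) bot_le)).symm
    rw [key x hx, key y hy, edist_self]
    exact bot_le
  · have hle : ∀ u ∈ W, ∀ v ∈ W, edist u v ≤ Metric.ediam W := fun u hu v hv =>
      Metric.edist_le_ediam_of_mem hu hv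
    have h1 := hS.edist_le_of_component hm hmv hH hM h0 hW hle hx
    have h2 := hS.edist_le_of_component hm hmv hH hM h0 hW hle hy
    refine (edist_triangle_left x y p).trans ((add_le_add h1 h2).trans (le_of_eq ?_))
    rw [lightConstant]
    push_cast
    ring

theorem inSameComponent_symm {X : Type*} [PseudoEMetricSpace X] {δ : ℝ≥0∞} {A : Set X} {x y : X}
    (h : InSameComponent δ A x y) : InSameComponent δ A y x := by
  obtain ⟨hx, h⟩ := h
  have hy : y ∈ A := by
    cases h with
    | refl => exact hx
    | tail _ h => exact h.2.1
  refine ⟨hy, ?_⟩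
  have : Std.Symm fun p q : X => p ∈ A ∧ q ∈ A ∧ edist p q ≤ δ :=
    ⟨fun p q h => ⟨h.2.1, h.1, by rw [edist_comm]; exact h.2.2⟩⟩
  exact Relation.ReflTransGen.stdSymm.symm _ _ h

/-- The `r`-components of the point inverse form the required cover. -/
theorem IsAdmissible.assouadNagata (hS : S.IsAdmissible Δ H) (hm : 2 ≤ m) (hmv : m ≤ mv)
    (hH : 2 * (m + 1) * (H + 1) < mv) (hM : 8 * (n + 2) * (H + 4) < mv) (j : ℤ) (p : S.LimitSpace) :
    AssouadNagataLE (S.proj j ⁻¹' {p}) 0 (lightConstant m) := by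
  intro r hr
  have hr0 : (r : ℝ≥0∞) ≠ 0 := by exact_mod_cast hr.ne'
  set F := S.proj j ⁻¹' {p} with hF
  -- the cover by the `r`-components
  refine ⟨(fun x => {y | InSameComponent r F x y}) '' F, ?_, ?_, ?_, ?_⟩
  · rintro _ ⟨x, -, rfl⟩ y hy
    exact (inSameComponent_symm hy).1
  · exact fun x hx => ⟨_, ⟨x, hx, rfl⟩, hx, Relation.ReflTransGen.refl⟩
  · rintro _ ⟨x, -, rfl⟩
    refine Metric.ediam_le fun y hy z hz => ?_
    have hle : ∀ u ∈ ({p} : Set S.LimitSpace), ∀ v ∈ ({p} : Set S.LimitSpace),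
        edist u v ≤ (r : ℝ≥0∞) := by
      rintro u rfl v rfl
      rw [edist_self]
      exact bot_le
    have h1 := hS.edist_le_of_component hm hmv hH hM hr0 ENNReal.coe_ne_top hle hy
    have h2 := hS.edist_le_of_component hm hmv hH hM hr0 ENNReal.coe_ne_top hle hz
    refine (edist_triangle_left y z x).trans ((add_le_add h1 h2).trans (le_of_eq ?_))
    rw [lightConstant]
    push_cast
    ring
  · intro x hx
    rw [Nat.cast_zero, zero_add, encard_le_one_iff]
    -- every component meeting the ball is the component of its centre
    have key : ∀ A, (A ∈ (fun x => {y | InSameComponent (r : ℝ≥0∞) F x y}) '' F ∧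
        (A ∩ Metric.eball x r).Nonempty) → A = {y | InSameComponent (r : ℝ≥0∞) F x y} := by
      rintro _ ⟨⟨x', hx', rfl⟩, z, hz, hzx⟩
      have hzF : z ∈ F := (inSameComponent_symm hz).1
      have hxz : InSameComponent r F x z := ⟨hx, .single ⟨hx, hzF, by
        rw [edist_comm]; exact (Metric.mem_eball.1 hzx).le⟩⟩
      ext y
      exact ⟨fun hy => ⟨hx, hxz.2.trans ((inSameComponent_symm hz).2.trans hy.2)⟩,
        fun hy => ⟨hx', hz.2.trans ((inSameComponent_symm hxz).2.trans hy.2)⟩⟩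
    exact fun A B hA hB => (key A hA).trans (key B hB).symm

end System

/-! ### Direct systems that are injective on open `n`-cells -/

namespace Tilings

variable {n m mv : ℕ} [NeZero n] (Y : Tilings n m mv)

theorem openCell_subset_openCell (hm : 2 ≤ m) (hmv : m ≤ mv) {i j : ℤ} {c C : GridCell n}
    (hc : c.dirs = Finset.univ) (hC : C.dirs = Finset.univ)
    (h : Y.closedCell i c ⊆ Y.closedCell j C) : Y.openCell i c ⊆ Y.openCell j C := by
  have h1 : WithLp.toLp 2 (Y.lo i c) ∈ Y.closedCell i c :=
    Y.mem_closedCell.2 fun k => ⟨le_rfl, Y.lo_le_hi hm hmv i c k⟩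
  have h2 : WithLp.toLp 2 (Y.hi i c) ∈ Y.closedCell i c :=
    Y.mem_closedCell.2 fun k => ⟨Y.lo_le_hi hm hmv i c k, le_rfl⟩
  intro p hp k
  refine ⟨fun hk => ?_, fun hk => absurd (hC ▸ Finset.mem_univ k) hk⟩
  have e1 := ((h h1 k).1 hk).1
  have e2 := ((h h2 k).1 hk).2
  have e3 := (hp k).1 (hc ▸ Finset.mem_univ k)
  have e4 : Y.hi i c k = Y.lo i c k + side m mv i k := by simp [hi, hc]
  simp only [e4] at e1 e2
  exact ⟨e1.trans_lt e3.1, e3.2.trans_le e2⟩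

end Tilings

namespace System

variable {n m mv : ℕ} [NeZero n] {S : System.{u} n m mv} {Δ H : ℕ}

/-- The projections are injective over the open `n`-cells. -/
theorem IsAdmissible.eq_of_π_eq (hS : S.IsAdmissible Δ H) (hm : 2 ≤ m) (hmv : m ≤ mv)
    (hI : S.InjectiveOnTopCells) {j i : ℤ} (hji : j ≤ i) {ψ : CharMap n (S.X i)}
    (hψ : ψ ∈ S.topMaps i) {q q' : S.X j} (hq : S.π j i hji q ∈ S.Y.openImage i ψ)
    (hqq : S.π j i hji q = S.π j i hji q') : q = q' := by
  induction i, hji using Int.leInduction with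
  | base => simpa only [S.π_self] using hqq
  | succ i hji ih =>
    obtain ⟨φ, ⟨φ', hφ', hsub, hfun⟩, hd, hpre⟩ := hI i ψ hψ
    have hsub' : S.Y.closedCell (i + 1) φ.cell ⊆ S.Y.closedCell i φ'.cell := hsub
    have hd' := dirs_eq_univ hm hmv hsub' hd
    have hi1 : i ≤ i + 1 := by lia
    rw [← S.π_π hji hi1 q] at hq
    rw [← S.π_π hji hi1 q, ← S.π_π hji hi1 q'] at hqq
    have h1 : S.π j i hji q ∈ S.Y.openImage (i + 1) φ := by rw [← hpre]; exact hq
    have h2 : S.π j i hji q' ∈ S.Y.openImage (i + 1) φ := by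
      rw [hqq] at hq
      rw [← hpre]
      exact hq
    obtain ⟨x, hx, hxq⟩ := h1
    obtain ⟨x', hx', hxq'⟩ := h2
    have hxx : x = x' := (hS.complex (i + 1)).injOn _ (hS.compat_subdiv i φ' hφ' φ.cell hsub') hx hx'
      (by
        change S.π i (i + 1) _ (φ'.toFun x) = S.π i (i + 1) _ (φ'.toFun x')
        rw [← hfun, hxq, hxq', hqq])
    refine ih ⟨hφ', hd'⟩ ⟨x, S.Y.openCell_subset_openCell hm hmv hd hd' hsub' hx, ?_⟩ ?_
    · rw [← hxq, hfun]
    · rw [← hxq, ← hxq', hxx]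

theorem IsAdmissible.measure_openImage (hS : S.IsAdmissible Δ H) {a : ℤ} {φ : CharMap n (S.X a)}
    (hφ : φ ∈ S.topMaps a) {w : ℝ≥0} (hw : S.IsWeight a φ w) :
    S.μ a (S.Y.openImage a φ) = w * cellVolume n m mv a := by
  rw [hS.measure_eq hφ hw (hS.measurableSet_openImage hφ) (image_mono (S.Y.openCell_subset a _))]
  congr 1
  refine le_antisymm ((measure_mono inter_subset_right).trans_eq (S.Y.volume_closedCell hφ.2)) ?_
  rw [← S.Y.volume_openCell hφ.2]
  exact measure_mono fun x hx => ⟨⟨x, hx, rfl⟩, S.Y.openCell_subset a _ hx⟩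

theorem hasWeight_self {a : ℤ} {φ : CharMap n (S.X a)}
    (hφ : φ ∈ S.topMaps a) {w : ℝ≥0} (hw0 : 0 < w) (hw : S.IsWeight a φ w) : S.HasWeight a a φ w :=
  ⟨hφ.2, hw0, φ, hφ, subset_rfl, rfl, hw⟩

/-- The weights do not increase from one generation to the next, since only one cell lies over a
given one. -/
theorem IsAdmissible.weight_next_le (hS : S.IsAdmissible Δ H) (hm : 2 ≤ m) (hmv : m ≤ mv)
    (hI : S.InjectiveOnTopCells) {i : ℤ} {φ : CharMap n (S.X i)} (hφ : φ ∈ S.topMaps i)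
    {c : GridCell n} (hcd : c.dirs = Finset.univ)
    (hc : S.Y.closedCell (i + 1) c ⊆ S.Y.closedCell i φ.cell) {w w' : ℝ≥0}
    (hw : S.IsWeight i φ w) (hw' : S.IsWeight (i + 1) ⟨c, S.next i ∘ φ.toFun⟩ w') : w' ≤ w := by
  have hψ : (⟨c, S.next i ∘ φ.toFun⟩ : CharMap n (S.X (i + 1))) ∈ S.topMaps (i + 1) :=
    ⟨hS.compat_subdiv i φ hφ.1 c hc, hcd⟩
  obtain ⟨φ₁, ⟨φ', hφ', hsub, hfun⟩, hd, hpre⟩ := hI i _ hψ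
  have hsub' : S.Y.closedCell (i + 1) φ₁.cell ⊆ S.Y.closedCell i φ'.cell := hsub
  have htop : φ' ∈ S.topMaps i := ⟨hφ', dirs_eq_univ hm hmv hsub' hd⟩
  -- the cell over the given one is contained in the `n`-cell of `φ`
  have himage : S.Y.openImage i φ = S.Y.openImage i φ' := by
    obtain ⟨x, hx⟩ := S.Y.openCell_nonempty hm hmv (i + 1) c
    have h1 : φ.toFun x ∈ S.next i ⁻¹' S.Y.openImage (i + 1) ⟨c, S.next i ∘ φ.toFun⟩ := ⟨x, hx, rfl⟩
    rw [hpre] at h1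
    obtain ⟨x', hx', hxx⟩ := h1
    rcases (hS.complex i).partition φ hφ.1 φ' hφ' with h | h
    · exact h.1
    · refine absurd ?_ (disjoint_left.1 h
        ⟨x, S.Y.openCell_subset_openCell hm hmv hcd hφ.2 hc hx, rfl⟩)
      exact ⟨x', S.Y.openCell_subset_openCell hm hmv hd htop.2 hsub' hx', by rw [← hxx, hfun]⟩
  obtain ⟨w₁, hw₁0, hw₁⟩ := hS.lebesgue i φ' htop
  have hweq : (w : ℝ≥0∞) = w₁ := by
    have h1 := hS.measure_openImage hφ hw
    rw [himage, hS.measure_openImage htop hw₁] at h1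
    exact ((ENNReal.mul_left_inj (cellVolume_pos hm hmv i).ne' (cellVolume_ne_top i)).1 h1).symm
  have h2 : (w' : ℝ≥0∞) * cellVolume n m mv (i + 1) ≤ w * cellVolume n m mv (i + 1) := by
    have := hS.borel i
    have := hS.borel (i + 1)
    rw [← hS.measure_openImage hψ hw', ← hS.pushforward i,
      Measure.map_apply (S.next i).continuous.measurable (hS.measurableSet_openImage hψ), hpre, hweq,
      ← hS.measure_closedImage hm hmv (φ := φ₁) ⟨hd, hw₁0, φ', htop, hsub', hfun, hw₁⟩]
    exact measure_mono (image_mono (S.Y.openCell_subset _ _))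
  have := (ENNReal.mul_le_mul_iff_left (cellVolume_pos hm hmv (i + 1)).ne'
    (cellVolume_ne_top (i + 1))).1 h2
  exact_mod_cast this

/-- The estimate of `IsAdmissible.weight_next_le` for several generations. -/
theorem IsAdmissible.exists_weight_le (hS : S.IsAdmissible Δ H) (hm : 2 ≤ m) (hmv : m ≤ mv)
    (hI : S.InjectiveOnTopCells) {i i' : ℤ} (hi : i ≤ i') {φ : CharMap n (S.X i)}
    (hφ : φ ∈ S.topMaps i) {c : GridCell n} (hcd : c.dirs = Finset.univ)
    (hc : S.Y.closedCell i' c ⊆ S.Y.closedCell i φ.cell) {w : ℝ≥0} (hw0 : 0 < w)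
    (hw : S.IsWeight i φ w) :
    ∃ w', w' ≤ w ∧ 0 < w' ∧ S.IsWeight i' ⟨c, fun x => S.π i i' hi (φ.toFun x)⟩ w' := by
  have hmem : ∀ {i' : ℤ} (hi : i ≤ i') {e : GridCell n}, e.dirs = Finset.univ →
      S.Y.closedCell i' e ⊆ S.Y.closedCell i φ.cell →
      (⟨e, fun x => S.π i i' hi (φ.toFun x)⟩ : CharMap n (S.X i')) ∈ S.topMaps i' :=
    fun hi e hed he => ⟨(limitSystem hm hmv hS).subdiv_of_le hm hmv hi hφ.1 he, hed⟩
  induction i', hi using Int.leInduction generalizing c with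
  | base =>
    obtain ⟨w', hw'0, hw'⟩ := hS.lebesgue _ _ (hmem le_rfl hcd hc)
    refine ⟨w', ?_, hw'0, hw'⟩
    have h1 := hS.measure_closedImage hm hmv (i := i) (φ := ⟨c, φ.toFun⟩)
      ⟨hcd, hw0, φ, hφ, hc, rfl, hw⟩
    have h2 := hS.measure_closedImage hm hmv (hasWeight_self (hmem le_rfl hcd hc) hw'0 hw')
    simp only [S.π_self] at h2
    rw [h1, ENNReal.mul_left_inj (cellVolume_pos hm hmv i).ne' (cellVolume_ne_top i)] at h2
    exact (by exact_mod_cast h2 : w = w').ge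
  | succ i' hi ih =>
    obtain ⟨e, h1, h2⟩ := S.Y.exists_between hm hmv hi (by lia : i' ≤ i' + 1) hc
    have hed := dirs_eq_univ hm hmv h1 hcd
    obtain ⟨w₁, hw₁, -, hw₁'⟩ := ih hed h2
    obtain ⟨w₂, hw₂0, hw₂⟩ := hS.lebesgue _ _ (hmem (by lia : i ≤ i' + 1) hcd hc)
    have hfun : (fun x => S.π i (i' + 1) (by lia) (φ.toFun x)) =
        S.next i' ∘ fun x => S.π i i' hi (φ.toFun x) :=
      funext fun x => (S.π_π hi (by lia) (φ.toFun x)).symm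
    refine ⟨w₂, le_trans ?_ hw₁, hw₂0, hw₂⟩
    rw [hfun] at hw₂
    exact hS.weight_next_le hm hmv hI (hmem hi hed h2) hcd h1 hw₁' hw₂

/-- The weights do not increase under subdivision and projection. -/
theorem IsAdmissible.exists_hasWeight_le (hS : S.IsAdmissible Δ H) (hm : 2 ≤ m) (hmv : m ≤ mv)
    (hI : S.InjectiveOnTopCells) {a a' i i' : ℤ} (ha : a ≤ a') (hai : a' ≤ i')
    {φ : CharMap n (S.X a)} {w : ℝ≥0} (hw : S.HasWeight a i φ w) {c : GridCell n}
    (hcd : c.dirs = Finset.univ) (hc : S.Y.closedCell i' c ⊆ S.Y.closedCell i φ.cell) :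
    ∃ w', w' ≤ w ∧ S.HasWeight a' i' ⟨c, fun x => S.π a a' ha (φ.toFun x)⟩ w' := by
  obtain ⟨hd, hw0, ψ, hψ, hsub, hfun, hw⟩ := hw
  obtain ⟨e, h1, h2⟩ := S.Y.exists_between hm hmv ha hai (hc.trans hsub)
  have hed := dirs_eq_univ hm hmv h1 hcd
  obtain ⟨w', hle, hw'0, hw'⟩ := hS.exists_weight_le hm hmv hI ha hψ hed h2 hw0 hw
  exact ⟨w', hle, hcd, hw'0, _,
    ⟨(limitSystem hm hmv hS).subdiv_of_le hm hmv ha hψ.1 h2, hed⟩, h1, by rw [hfun]; rfl, hw'⟩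

/-! ### The projection is David–Semmes regular -/

/-- The constant of David–Semmes regularity. -/
def regularConstant (n m Δ : ℕ) : ℕ := 2 ^ n * (Δ + 1) + 6 * m

/-- A ball of radius comparable to `m ^ (-i)` in the limit space lies in the star of a cell of
generation `i`. For `i ≤ j` this star is small already in `X j`; for `j ≤ i` its inverse image in
`X j` consists of a bounded number of cells, as each open `n`-cell of `X i` has a single one over
it. -/
theorem IsAdmissible.isDavidSemmesRegular (hS : S.IsAdmissible Δ H) (hm : 2 ≤ m) (hmv : m ≤ mv)
    (hH : 2 * (m + 1) * (H + 1) < mv) (hI : S.InjectiveOnTopCells) (j : ℤ) :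
    IsDavidSemmesRegular (S.proj j) (regularConstant n m Δ) := by
  classical
  refine ⟨(hS.lipschitz_proj hm hmv j).weaken ?_, fun y r hr => ?_⟩
  · have : 1 ≤ regularConstant n m Δ := by
      have := Nat.mul_pos (pow_pos (by norm_num : 0 < 2) n) (Nat.succ_pos Δ)
      unfold regularConstant
      lia
    exact_mod_cast this
  rcases (S.proj j ⁻¹' Metric.eball y r).eq_empty_or_nonempty with hemp | ⟨p, hp⟩
  · exact ⟨∅, by simp, by simp [hemp]⟩
  have hr' : (r : ℝ≥0∞) ≠ 0 := by exact_mod_cast hr.ne'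
  have h2r0 : (2 * r : ℝ≥0∞) ≠ 0 := by simp [hr']
  have h2r : (2 * r : ℝ≥0∞) ≠ ⊤ := ENNReal.mul_ne_top (by simp) (by simp)
  obtain ⟨i, hi1, hi2⟩ := exists_size_le_lt hm h2r0 h2r
  -- the inverse image is contained in that of a ball centered at a point of the image
  have hball : ∀ q ∈ S.proj j ⁻¹' Metric.eball y r,
      edist (S.toLimit j p) (S.toLimit j q) < size m i := by
    intro q hq
    refine lt_of_lt_of_le ?_ hi2.le
    have h1 : edist (S.toLimit j p) (S.toLimit j q) = edist (S.proj j p) (S.proj j q) :=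
      (SeparationQuotient.edist_mk _ _).symm
    rw [h1, two_mul]
    exact (edist_triangle_right _ _ y).trans_lt (ENNReal.add_lt_add hp hq)
  have hrad : size m i + size m i < (regularConstant n m Δ : ℝ≥0) * (r : ℝ≥0∞) := by
    have h1 : size m i ≤ m * (2 * r) := by
      rw [size_add hm i 1, pow_one]
      gcongr
      exact hi1
    have hmr : (m * (2 * r) : ℝ≥0∞) ≠ ⊤ := ENNReal.mul_ne_top (by simp) h2r
    have hmr0 : (m * (2 * r) : ℝ≥0∞) ≠ 0 := mul_ne_zero (by simp; lia) h2r0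
    calc size m i + size m i ≤ m * (2 * r) + m * (2 * r) := add_le_add h1 h1
      _ < m * (2 * r) + m * (2 * r) + m * (2 * r) :=
        ENNReal.lt_add_right (ENNReal.add_ne_top.2 ⟨hmr, hmr⟩) hmr0
      _ = (6 * m : ℕ) * r := by push_cast; ring
      _ ≤ _ := by
        rw [ENNReal.coe_natCast]
        gcongr
        unfold regularConstant
        lia
  rcases le_total i j with hij | hji
  · refine ⟨{p}, ?_, fun q hq => ?_⟩
    · have : 1 ≤ regularConstant n m Δ := by unfold regularConstant; lia
      rw [Finset.card_singleton]
      exact_mod_cast this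
    · simp only [Finset.mem_singleton, iUnion_iUnion_eq_left]
      rw [Metric.mem_eball, edist_comm]
      exact (hS.edist_le_of_edist_toLimit hm hmv hH hij (hball q hq)).trans_lt hrad
  · obtain ⟨φ, hφ, hφd, a, ha, hap⟩ := hS.exists_mem_subAt hm hmv hji (p : S.X j)
    have hΦ := hS.push_subAt hm hmv hji hφ
    -- one point over each of the open `n`-cells adjacent to a cell containing the centre
    set 𝓑 := {B | ∃ ψ ∈ S.topMaps i, B = S.Y.openImage i ψ ∧
      S.Adjacent i ⟨φ.cell, fun x => S.π j i hji (φ.toFun x)⟩ ψ} with h𝓑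
    have hcard := hS.encard_adjacent_le hm hmv hΦ
    have hfin : 𝓑.Finite := finite_of_encard_le_coe hcard
    have hpt : ∀ B : Set (S.X i), ∃ q : S.Fine j, B ∈ 𝓑 → S.π j i hji q ∈ B := by
      intro B
      by_cases hB : B ∈ 𝓑
      · obtain ⟨ψ, -, rfl, -⟩ := hB
        obtain ⟨x, hx⟩ := S.Y.openCell_nonempty hm hmv i ψ.cell
        obtain ⟨q, hq⟩ := hS.surjective_π hji (ψ.toFun x)
        exact ⟨q, fun _ => hq ▸ ⟨x, hx, rfl⟩⟩
      · exact ⟨p, fun h => absurd h hB⟩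
    choose pt hpt using hpt
    refine ⟨hfin.toFinset.image pt, ?_, fun q hq => ?_⟩
    · rw [hfin.encard_eq_coe_toFinset_card] at hcard
      have h1 : (hfin.toFinset.image pt).card ≤ 2 ^ n * (Δ + 1) :=
        Finset.card_image_le.trans (by exact_mod_cast hcard)
      have h2 : (hfin.toFinset.image pt).card ≤ regularConstant n m Δ :=
        h1.trans (Nat.le_add_right _ _)
      exact_mod_cast h2
    · obtain ⟨ψ, hψ, hψd, b, hb, hbq⟩ := hS.exists_mem_subAt hm hmv hji (q : S.X j)
      have hmeet := hS.meet_of_edist_toLimit hm hmv hH hji hφ hψ ha hb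
        (by rw [hap, hbq]; exact hball q hq)
      have hΨ : (⟨ψ.cell, fun x => S.π j i hji (ψ.toFun x)⟩ : CharMap n (S.X i)) ∈ S.topMaps i :=
        ⟨hS.push_subAt hm hmv hji hψ, hψd⟩
      have hB : S.Y.openImage i ⟨ψ.cell, fun x => S.π j i hji (ψ.toFun x)⟩ ∈ 𝓑 :=
        ⟨_, hΨ, rfl, hmeet⟩
      obtain ⟨z, hz, hzq⟩ := hpt _ hB
      have hq' := hS.eq_of_π_eq hm hmv hI hji hΨ (q := ψ.toFun z) ⟨z, hz, rfl⟩ hzq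
      refine mem_iUnion₂.2 ⟨_, Finset.mem_image_of_mem pt (hfin.mem_toFinset.2 hB), ?_⟩
      have h1 : edist q (pt (S.Y.openImage i ⟨ψ.cell, fun x => S.π j i hji (ψ.toFun x)⟩)) ≤ size m i :=
        edist_asFine_le hji hψ ⟨b, hb, hbq⟩ ⟨z, S.Y.openCell_subset i _ hz, hq'⟩
      exact h1.trans_lt (lt_of_le_of_lt (le_add_right le_rfl) hrad)

end System

/-! ### A criterion for Ahlfors regularity -/

/-- The Hausdorff measure of balls is bounded from below by the mass distribution principle and
from above by efficient coverings by small sets. -/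
theorem hausdorffMeasure_closedEBall_bounds {X : Type*} [EMetricSpace X] [MeasurableSpace X]
    [BorelSpace X] {Q : ℝ} {C : ℝ≥0}
    (hl : ∀ (x : X) (r : ℝ≥0), 0 < r → ∃ (ν : Measure X) (ε K : ℝ≥0∞), 0 < ε ∧ K ≠ 0 ∧ K ≠ ⊤ ∧
      (∀ s, Metric.ediam s ≤ ε → ν s ≤ K * Metric.ediam s ^ Q) ∧
      K * (r : ℝ≥0∞) ^ Q ≤ C * ν (Metric.closedEBall x r))
    (hu : ∀ (x : X) (r : ℝ≥0), 0 < r → ∀ ε : ℝ≥0∞, 0 < ε → ∃ U : Finset (Set X),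
      Metric.closedEBall x r ⊆ ⋃ A ∈ U, A ∧ (∀ A ∈ U, Metric.ediam A ≤ ε) ∧
      ∑ A ∈ U, Metric.ediam A ^ Q ≤ C * (r : ℝ≥0∞) ^ Q) (x : X) (r : ℝ≥0) (hr : 0 < r) :
    (r : ℝ≥0∞) ^ Q ≤ C * Measure.hausdorffMeasure Q (Metric.closedEBall x r) ∧
      Measure.hausdorffMeasure Q (Metric.closedEBall x r) ≤ C * (r : ℝ≥0∞) ^ Q := by
  constructor
  · obtain ⟨ν, ε, K, hε, hK0, hK, hν, hball⟩ := hl x r hr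
    have hle : K⁻¹ • ν ≤ Measure.hausdorffMeasure Q := by
      refine Measure.le_hausdorffMeasure Q _ ε hε fun s hs => ?_
      rw [Measure.smul_apply, smul_eq_mul]
      calc K⁻¹ * ν s ≤ K⁻¹ * (K * Metric.ediam s ^ Q) := by gcongr; exact hν s hs
        _ = Metric.ediam s ^ Q := by rw [← mul_assoc, ENNReal.inv_mul_cancel hK0 hK, one_mul]
    have h1 := hle (Metric.closedEBall x r)
    rw [Measure.smul_apply, smul_eq_mul] at h1
    calc (r : ℝ≥0∞) ^ Q = K⁻¹ * (K * (r : ℝ≥0∞) ^ Q) := by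
          rw [← mul_assoc, ENNReal.inv_mul_cancel hK0 hK, one_mul]
      _ ≤ K⁻¹ * (C * ν (Metric.closedEBall x r)) := by gcongr
      _ = C * (K⁻¹ * ν (Metric.closedEBall x r)) := by ring
      _ ≤ _ := by gcongr
  · choose U hU1 hU2 hU3 using fun k : ℕ => hu x r hr ((k : ℝ≥0∞) + 1)⁻¹ (by simp)
    have hlim : Filter.Tendsto (fun k : ℕ => ((k : ℝ≥0∞) + 1)⁻¹) Filter.atTop (nhds 0) := by
      have := (Filter.tendsto_add_atTop_iff_nat 1).2 ENNReal.tendsto_inv_nat_nhds_zero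
      simpa using this
    refine (Measure.hausdorffMeasure_le_liminf_sum (ι := fun k => U k) Q _ _ hlim
      (fun k A => A.1) (Filter.Eventually.of_forall fun k A => hU2 k A A.2)
      (Filter.Eventually.of_forall fun k y hy => ?_)).trans ?_
    · obtain ⟨A, hA, hy⟩ := mem_iUnion₂.1 (hU1 k hy)
      exact mem_iUnion.2 ⟨⟨A, hA⟩, hy⟩
    · refine Filter.liminf_le_of_le (by isBoundedDefault) fun b hb => ?_
      obtain ⟨k, hk⟩ := hb.exists
      refine hk.trans (le_trans (le_of_eq ?_) (hU3 k))
      exact Finset.sum_coe_sort (U k) fun A => Metric.ediam A ^ Q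

/-- `hausdorffMeasure_closedEBall_bounds`, for a pseudometric space in which points are
separated. -/
theorem isAhlforsRegular_of {X : Type*} [PseudoEMetricSpace X] [hX : MeasurableSpace X]
    [BorelSpace X] {Q : ℝ} {C : ℝ≥0} (h0 : ∀ {x y : X}, edist x y = 0 → x = y)
    (hl : ∀ (x : X) (r : ℝ≥0), 0 < r → ∃ (ν : Measure X) (ε K : ℝ≥0∞), 0 < ε ∧ K ≠ 0 ∧ K ≠ ⊤ ∧
      (∀ s, Metric.ediam s ≤ ε → ν s ≤ K * Metric.ediam s ^ Q) ∧
      K * (r : ℝ≥0∞) ^ Q ≤ C * ν (Metric.closedEBall x r))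
    (hu : ∀ (x : X) (r : ℝ≥0), 0 < r → ∀ ε : ℝ≥0∞, 0 < ε → ∃ U : Finset (Set X),
      Metric.closedEBall x r ⊆ ⋃ A ∈ U, A ∧ (∀ A ∈ U, Metric.ediam A ≤ ε) ∧
      ∑ A ∈ U, Metric.ediam A ^ Q ≤ C * (r : ℝ≥0∞) ^ Q) : IsAhlforsRegular X Q C := by
  obtain rfl : hX = borel X := BorelSpace.measurable_eq
  let _ : EMetricSpace X := { ‹PseudoEMetricSpace X› with eq_of_edist_eq_zero := h0 }
  exact ⟨h0, fun x r hr _ =>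
    @hausdorffMeasure_closedEBall_bounds X _ (borel X) _ Q C hl hu x r hr⟩

/-! ### Ahlfors regularity of the spaces `X j` -/

/-- The homogeneous dimension of the tilings. -/
noncomputable def homogeneousDim (n m mv : ℕ) : ℝ := 1 + ((n : ℝ) - 1) * Real.log mv / Real.log m

section Dimension

variable {n m mv : ℕ} [NeZero n]

theorem homogeneousDim_pos (hm : 2 ≤ m) (hmv : m ≤ mv) : 0 < homogeneousDim n m mv := by
  have h1 : 0 < Real.log m := Real.log_pos (by exact_mod_cast (by lia : 1 < m))
  have h2 : 0 < Real.log mv := Real.log_pos (by exact_mod_cast (by lia : 1 < mv))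
  have h3 : (1 : ℝ) ≤ n := by exact_mod_cast NeZero.one_le
  have : 0 ≤ ((n : ℝ) - 1) * Real.log mv / Real.log m :=
    div_nonneg (mul_nonneg (by linarith) h2.le) h1.le
  unfold homogeneousDim
  linarith

/-- The exponent is chosen such that the volume of a cell is this power of its size. -/
theorem size_rpow (hm : 2 ≤ m) (hmv : m ≤ mv) (i : ℤ) :
    size m i ^ homogeneousDim n m mv = cellVolume n m mv i := by
  have hm0 : (0 : ℝ) < m := by exact_mod_cast (by lia : 0 < m)
  have hmv0 : (0 : ℝ) < mv := by exact_mod_cast (by lia : 0 < mv)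
  have hm1 : (m : ℝ) ≠ 1 := by exact_mod_cast (by lia : m ≠ 1)
  have hs : size m i ^ Real.logb m mv = size mv i := by
    rw [size, size, ENNReal.ofReal_rpow_of_pos (by positivity)]
    congr 1
    rw [← Real.rpow_intCast, ← Real.rpow_mul hm0.le, mul_comm, Real.rpow_mul hm0.le,
      Real.rpow_logb hm0 hm1 hmv0, Real.rpow_intCast]
  have hQ : homogeneousDim n m mv = 1 + Real.logb m mv * ((n - 1 : ℕ) : ℝ) := by
    rw [homogeneousDim, Nat.cast_sub NeZero.one_le, Nat.cast_one, Real.logb]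
    ring
  rw [hQ, ENNReal.rpow_add _ _ (size_pos hm i).ne' (size_ne_top i), ENNReal.rpow_one,
    ENNReal.rpow_mul, hs, ENNReal.rpow_natCast, cellVolume_eq]

end Dimension

namespace Tilings

variable {n m mv : ℕ} [NeZero n] (Y : Tilings n m mv)

theorem encard_subcells_succ_le (hm : 2 ≤ m) (hmv : m ≤ mv) (j : ℤ) (C : GridCell n) :
    {c : GridCell n | c.dirs = Finset.univ ∧ Y.closedCell (j + 1) c ⊆ Y.closedCell j C}.encard ≤
      (m * mv ^ (n - 1) : ℕ) := by
  have h : ∀ s : (k : Fin n) → Fin (ratio m mv k), ∃ c : GridCell n, c.dirs = Finset.univ ∧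
      ∀ k, Y.lo (j + 1) c k = Y.lo j C k + (s k : ℕ) * side m mv (j + 1) k := fun s =>
    Y.exists_cell _ fun k =>
      (Y.latCoord_of_le hm hmv (by lia : j ≤ j + 1) (Y.latCoord_lo j C k)).add_mul (s k : ℕ)
  choose F hF using h
  have hcard : Fintype.card ((k : Fin n) → Fin (ratio m mv k)) = m * mv ^ (n - 1) := by
    rw [Fintype.card_pi, ← prod_ite_zero (n := n) m mv]
    exact Finset.prod_congr rfl fun k _ => Fintype.card_fin _
  rw [← hcard]
  refine (encard_le_encard ?_).trans (encard_range_le F)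
  rintro c ⟨hc, hsub⟩
  have h1 : WithLp.toLp 2 (Y.lo (j + 1) c) ∈ Y.closedCell (j + 1) c :=
    Y.mem_closedCell.2 fun k => ⟨le_rfl, Y.lo_le_hi hm hmv _ c k⟩
  have h2 : WithLp.toLp 2 (Y.hi (j + 1) c) ∈ Y.closedCell (j + 1) c :=
    Y.mem_closedCell.2 fun k => ⟨Y.lo_le_hi hm hmv _ c k, le_rfl⟩
  have hC := System.dirs_eq_univ hm hmv hsub hc
  have key : ∀ k, ∃ z : Fin (ratio m mv k),
      Y.lo (j + 1) c k = Y.lo j C k + (z : ℕ) * side m mv (j + 1) k := by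
    intro k
    obtain ⟨z, hz⟩ := (Y.latCoord_lo (j + 1) c k).exists_sub
      (Y.latCoord_of_le hm hmv (by lia : j ≤ j + 1) (Y.latCoord_lo j C k))
    have hs := side_pos hm hmv (j + 1) k
    have e1 := ((hsub h1 k).1 (hC ▸ Finset.mem_univ k)).1
    have e2 := ((hsub h2 k).1 (hC ▸ Finset.mem_univ k)).2
    have e3 : Y.hi (j + 1) c k = Y.lo (j + 1) c k + side m mv (j + 1) k := by simp [hi, hc]
    simp only [e3] at e1 e2
    rw [side_succ hm hmv j k] at e2
    have hz0 : (0 : ℝ) ≤ z := by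
      by_contra! hneg
      nlinarith
    have hz1 : (z : ℝ) < ratio m mv k := by
      by_contra! hge
      nlinarith
    have hz0' : 0 ≤ z := by exact_mod_cast hz0
    lift z to ℕ using hz0'
    refine ⟨⟨z, by exact_mod_cast hz1⟩, ?_⟩
    push_cast at hz
    simp only
    linarith
  choose s hs using key
  exact ⟨s, Y.cell_eq hm hmv (j := j + 1) ((hF s).1.trans hc.symm) fun k => by rw [(hF s).2, hs]⟩

theorem encard_subcells_le (hm : 2 ≤ m) (hmv : m ≤ mv) (j : ℤ) (C : GridCell n) (l : ℕ) :
    {c : GridCell n | c.dirs = Finset.univ ∧ Y.closedCell (j + l) c ⊆ Y.closedCell j C}.encard ≤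
      ((m * mv ^ (n - 1)) ^ l : ℕ) := by
  induction l with
  | zero =>
    rw [pow_zero, Nat.cast_one, encard_le_one_iff]
    rintro c c' ⟨hc, hsub⟩ ⟨hc', hsub'⟩
    rw [Nat.cast_zero, add_zero] at hsub hsub'
    -- a cell contained in a cell of the same generation and dimension is equal to it
    have key : ∀ c : GridCell n, c.dirs = Finset.univ → Y.closedCell j c ⊆ Y.closedCell j C →
        ∀ k, Y.lo j c k = Y.lo j C k := by
      intro c hc hsub k
      have h1 : WithLp.toLp 2 (Y.lo j c) ∈ Y.closedCell j c :=
        Y.mem_closedCell.2 fun k => ⟨le_rfl, Y.lo_le_hi hm hmv _ c k⟩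
      have h2 : WithLp.toLp 2 (Y.hi j c) ∈ Y.closedCell j c :=
        Y.mem_closedCell.2 fun k => ⟨Y.lo_le_hi hm hmv _ c k, le_rfl⟩
      have hC := System.dirs_eq_univ hm hmv hsub hc
      have e1 := ((hsub h1 k).1 (hC ▸ Finset.mem_univ k)).1
      have e2 := ((hsub h2 k).1 (hC ▸ Finset.mem_univ k)).2
      have e3 : Y.hi j c k = Y.lo j c k + side m mv j k := by simp [hi, hc]
      simp only [e3] at e1 e2
      linarith
    exact Y.cell_eq hm hmv (hc.trans hc'.symm) fun k => by rw [key c hc hsub, key c' hc' hsub']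
  | succ l ih =>
    rw [pow_succ]
    refine (encard_le_encard ?_).trans (encard_biUnion_le_mul ih
      fun e _ => Y.encard_subcells_succ_le hm hmv (j + l) e)
    rintro c ⟨hc, hsub⟩
    have hcast : j + ((l + 1 : ℕ) : ℤ) = j + l + 1 := by push_cast; ring
    rw [hcast] at hsub
    obtain ⟨e, h1, h2⟩ := Y.exists_between hm hmv (by lia : j ≤ j + l) (by lia : j + l ≤ j + l + 1) hsub
    exact mem_iUnion₂.2 ⟨e, ⟨System.dirs_eq_univ hm hmv h1 hc, h2⟩, hc, h1⟩

end Tilings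

namespace System

variable {n m mv : ℕ} [NeZero n] {S : System.{u} n m mv} {Δ H : ℕ}

/-- The measure of a small subset of a cell is bounded in terms of the weight of that cell. -/
theorem IsAdmissible.measure_inter_le (hS : S.IsAdmissible Δ H) (hm : 2 ≤ m) (hmv : m ≤ mv)
    (hH : 2 * (m + 1) * (H + 1) < mv) (hI : S.InjectiveOnTopCells) {i i' j a : ℤ} (haj : a ≤ j)
    (ha : a = min i j) (hi : i ≤ i') {φ : CharMap n (S.X a)} {w : ℝ≥0} (hw : S.HasWeight a i φ w)
    {s : Set (S.Fine j)} (hs : Metric.ediam s < size m i') :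
    S.fineMeasure j (s ∩ toFine j haj '' S.Y.closedImage i φ) ≤
      (starBound n Δ * Δ : ℕ) * (w * cellVolume n m mv i') := by
  rcases (s ∩ toFine j haj '' S.Y.closedImage i φ).eq_empty_or_nonempty with hemp | ⟨x, hxs, hx⟩
  · simp [hemp]
  obtain ⟨_, ⟨z, hz, rfl⟩, rfl⟩ := hx
  obtain ⟨c, hcd, hc, hzc⟩ := S.Y.exists_subcell hm hmv hi hz
  have haa : a ≤ min i' j := by lia
  obtain ⟨w', hle, hw'⟩ := hS.exists_hasWeight_le hm hmv hI haa (min_le_left i' j) hw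
    (hcd.trans hw.1) hc
  have h := hS.measure_ball_le hm hmv hH (min_le_right i' j) rfl hw'
    (p := S.π a _ haa (φ.toFun z)) ⟨z, hzc, rfl⟩ (le_refl (size m i'))
  have he : toFine j (min_le_right i' j) (S.π a _ haa (φ.toFun z)) = toFine j haj (φ.toFun z) :=
    S.π_π haa _ _
  rw [he] at h
  refine (measure_mono fun y hy => ?_).trans (h.trans (by gcongr))
  exact (Metric.edist_le_ediam_of_mem hy.1 hxs).trans_lt hs

/-- The constant of Ahlfors regularity. -/
def ahlforsConstant (n m mv Δ : ℕ) : ℕ :=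
  m * mv ^ (n - 1) * (starBound n Δ * Δ * (m * mv ^ (n - 1)) + 1) + starBound n Δ * (m * mv ^ (n - 1))

theorem cellVolume_succ (hm : 2 ≤ m) (hmv : m ≤ mv) (i : ℤ) :
    cellVolume n m mv i = (m * mv ^ (n - 1) : ℕ) * cellVolume n m mv (i + 1) := by
  have := cellVolume_add (n := n) hm hmv i 1
  rwa [pow_one, Nat.cast_one] at this

/-- Small subsets of a cell satisfy the bound required in the mass distribution principle. -/
theorem IsAdmissible.measure_inter_le_ediam (hS : S.IsAdmissible Δ H) (hm : 2 ≤ m) (hmv : m ≤ mv)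
    (hH : 2 * (m + 1) * (H + 1) < mv) (hI : S.InjectiveOnTopCells) {i j a : ℤ} (haj : a ≤ j)
    (ha : a = min i j) {φ : CharMap n (S.X a)} {w : ℝ≥0} (hw : S.HasWeight a i φ w)
    {s : Set (S.Fine j)} (hs : Metric.ediam s ≤ size m (i + 1)) :
    S.fineMeasure j (s ∩ toFine j haj '' S.Y.closedImage i φ) ≤
      (starBound n Δ * Δ * (m * mv ^ (n - 1)) : ℕ) * w *
        Metric.ediam s ^ homogeneousDim n m mv := by
  rcases eq_or_ne (Metric.ediam s) 0 with h0 | h0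
  · -- the measure is less than that of cells of arbitrarily high generation
    suffices hzero : S.fineMeasure j (s ∩ toFine j haj '' S.Y.closedImage i φ) = 0 by
      rw [hzero]; exact bot_le
    by_contra hne
    have hB : ((starBound n Δ * Δ : ℕ) * (w * cellVolume n m mv i) : ℝ≥0∞) ≠ ⊤ :=
      ENNReal.mul_ne_top (ENNReal.natCast_ne_top _)
        (ENNReal.mul_ne_top ENNReal.coe_ne_top (cellVolume_ne_top i))
    obtain ⟨N, hN⟩ := ENNReal.exists_nat_mul_gt hne hB
    have h1 := hS.measure_inter_le hm hmv hH hI haj ha (by lia : i ≤ i + N) hw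
      (s := s) (h0 ▸ size_pos hm _)
    refine absurd hN (not_lt.2 ?_)
    rw [cellVolume_add hm hmv i N]
    have h2 : N ≤ (m * mv ^ (n - 1)) ^ N := by
      refine (Nat.lt_pow_self ?_).le
      calc 1 < m := by lia
        _ ≤ m * mv ^ (n - 1) := Nat.le_mul_of_pos_right m (pow_pos (by lia) _)
    calc (N : ℝ≥0∞) * S.fineMeasure j (s ∩ toFine j haj '' S.Y.closedImage i φ)
        ≤ ((m * mv ^ (n - 1)) ^ N : ℕ) *
          ((starBound n Δ * Δ : ℕ) * (w * cellVolume n m mv (i + N))) := by gcongr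
      _ = _ := by ring
  · have htop : Metric.ediam s ≠ ⊤ := ne_top_of_le_ne_top (size_ne_top _) hs
    obtain ⟨i', hi1, hi2⟩ := exists_size_le_lt hm h0 htop
    have hii : i ≤ i' := by
      by_contra! hlt
      have h1 : size m i ≤ size m (i + 1) := (size_anti hm (by lia)).trans (hi1.trans hs)
      rw [size_add hm i 1, pow_one, Nat.cast_one] at h1
      have h2 := ENNReal.mul_lt_mul_left (size_pos hm (i + 1)).ne' (size_ne_top (i + 1))
        (by exact_mod_cast (by lia : 1 < m) : (1 : ℝ≥0∞) < m)
      simp only [one_mul] at h2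
      exact absurd h1 (not_le.2 h2)
    refine (hS.measure_inter_le hm hmv hH hI haj ha hii hw hi2).trans ?_
    rw [cellVolume_succ hm hmv i', ← size_rpow hm hmv]
    calc _ = ((starBound n Δ * Δ * (m * mv ^ (n - 1)) : ℕ) * w : ℝ≥0∞) *
          size m (i' + 1) ^ homogeneousDim n m mv := by push_cast; ring
      _ ≤ _ := by
        gcongr
        exact (homogeneousDim_pos hm hmv).le

/-- The lower bound comes from the restriction of the measure to a cell of size comparable to `r`,
the upper bound from covering the ball by cells of high generation. -/
theorem IsAdmissible.isAhlforsRegular (hS : S.IsAdmissible Δ H) (hm : 2 ≤ m) (hmv : m ≤ mv)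
    (hH : 2 * (m + 1) * (H + 1) < mv) (hI : S.InjectiveOnTopCells) (j : ℤ) :
    IsAhlforsRegular (S.Fine j) (homogeneousDim n m mv) (ahlforsConstant n m mv Δ) := by
  classical
  have := hS.borelSpace_fine hm hmv hH j
  have hQ := (homogeneousDim_pos (n := n) hm hmv).le
  set N := m * mv ^ (n - 1) with hN
  have hr' : ∀ r : ℝ≥0, 0 < r → (r : ℝ≥0∞) ≠ 0 := fun r hr => by exact_mod_cast hr.ne'
  refine isAhlforsRegular_of (fun h => hS.eq_of_edist_fine_eq_zero hm hmv hH h) ?_ ?_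
  · intro x r hr
    obtain ⟨i, hi1, hi2⟩ := exists_size_le_lt hm (hr' r hr) ENNReal.coe_ne_top
    obtain ⟨i, rfl⟩ : ∃ i', i = i' - 1 := ⟨i + 1, by ring⟩
    rw [sub_add_cancel] at hi1
    obtain ⟨p, hp⟩ := hS.surjective_π (min_le_right i j) x
    obtain ⟨φ, hφ, hφd, z, hz, hzp⟩ := hS.exists_mem_subAt hm hmv (min_le_left i j) p
    obtain ⟨w, hw⟩ := hS.exists_hasWeight hm hmv hφ hφd
    set E := toFine j (min_le_right i j) '' S.Y.closedImage i φ with hE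
    have hEm : MeasurableSet E := by
      have := hS.t2_fine hm hmv hH j
      refine (IsCompact.isClosed ?_).measurableSet
      exact (hS.isCompact_closedImage hφ).image
        ((hS.continuous_fine hm hmv j).comp (S.π _ j (min_le_right i j)).continuous)
    refine ⟨(S.fineMeasure j).restrict E, size m (i + 1), (starBound n Δ * Δ * N + 1 : ℕ) * w,
      size_pos hm _, ?_, ENNReal.mul_ne_top (ENNReal.natCast_ne_top _) ENNReal.coe_ne_top,
      fun s hs => ?_, ?_⟩
    · refine mul_ne_zero (Nat.cast_ne_zero.2 (Nat.succ_ne_zero _)) ?_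
      exact_mod_cast hw.2.1.ne'
    · rw [Measure.restrict_apply' hEm]
      refine (hS.measure_inter_le_ediam hm hmv hH hI _ rfl hw hs).trans ?_
      gcongr
      exact Nat.le_succ _
    · have hEball : E ⊆ Metric.closedEBall x r := by
        rintro _ ⟨_, ⟨y, hy, rfl⟩, rfl⟩
        have h1 := hS.edist_le_of_sub hm hmv (min_le_right i j) rfl le_rfl hφ subset_rfl hy hz
        rw [hzp, show toFine j (min_le_right i j) p = x from hp] at h1
        exact h1.trans hi1
      rw [Measure.restrict_apply' hEm, inter_eq_right.2 hEball]
      have h1 : w * cellVolume n m mv i ≤ S.fineMeasure j E := by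
        rw [hS.fineMeasure_eq (min_le_right i j) hEm, ← hS.measure_closedImage hm hmv hw]
        exact measure_mono (subset_preimage_image _ _)
      have h2 : (r : ℝ≥0∞) ^ homogeneousDim n m mv ≤ N * cellVolume n m mv i := by
        have := cellVolume_succ (n := n) hm hmv (i - 1)
        rw [sub_add_cancel, ← size_rpow hm hmv (i - 1)] at this
        rw [← this]
        gcongr
      calc ((starBound n Δ * Δ * N + 1 : ℕ) * w : ℝ≥0∞) * (r : ℝ≥0∞) ^ homogeneousDim n m mv
          ≤ ((starBound n Δ * Δ * N + 1 : ℕ) * w : ℝ≥0∞) * (N * cellVolume n m mv i) := by gcongr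
        _ = (N * (starBound n Δ * Δ * N + 1) : ℕ) * (w * cellVolume n m mv i) := by
          push_cast; ring
        _ ≤ _ := by
          rw [ENNReal.coe_natCast]
          gcongr
          exact Nat.le_add_right _ _
  · intro x r hr ε hε
    obtain ⟨i, hi1, hi2⟩ := exists_size_le_lt hm (hr' r hr) ENNReal.coe_ne_top
    obtain ⟨i', hii, hi'⟩ := exists_size_lt hm hε.ne' i
    obtain ⟨l, rfl⟩ := Int.le.dest hii
    obtain ⟨p, hp⟩ := hS.surjective_π (min_le_right i j) x
    obtain ⟨φ, hφ, -, hpφ⟩ := hS.exists_mem_subAt hm hmv (min_le_left i j) p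
    obtain ⟨t, ht1, ht2, ht3⟩ := hS.exists_ball_cover hm hmv hH (min_le_right i j) rfl hφ
    -- the cells of generation `i + l` contained in the cells of generation `i` covering the ball
    let A : CharMap n (S.X (min i j)) → GridCell n → Set (S.Fine j) := fun χ c =>
      (fun y => toFine j (min_le_right i j) (χ.toFun y)) '' S.Y.closedCell (i + l) c
    let D : CharMap n (S.X (min i j)) → Set (GridCell n) := fun χ =>
      {c | c.dirs = Finset.univ ∧ S.Y.closedCell (i + l) c ⊆ S.Y.closedCell i χ.cell}
    let U : Set (Set (S.Fine j)) := ⋃ χ ∈ (t : Set (CharMap n (S.X (min i j)))), A χ '' D χ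
    have hUcard : U.encard ≤ (starBound n Δ * N ^ l : ℕ) :=
      encard_biUnion_le_mul (by rw [encard_coe_eq_coe_finsetCard]; exact_mod_cast ht1)
        fun χ _ => (encard_image_le _ _).trans (S.Y.encard_subcells_le hm hmv i χ.cell l)
    have hfin : U.Finite := finite_of_encard_le_coe hUcard
    have hdiam : ∀ B ∈ U, Metric.ediam B ≤ size m (i + l) := by
      intro B hB
      obtain ⟨χ, hχ, c, ⟨-, hc⟩, rfl⟩ := mem_iUnion₂.1 hB
      refine Metric.ediam_le ?_
      rintro _ ⟨y, hy, rfl⟩ _ ⟨y', hy', rfl⟩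
      exact hS.edist_le_of_sub hm hmv (min_le_right i j) rfl hii (ht2 χ hχ).1 hc hy hy'
    refine ⟨hfin.toFinset, fun y hy => ?_, fun B hB => ?_, ?_⟩
    · obtain ⟨q, hq⟩ := hS.surjective_π (min_le_right i j) y
      have hpx : toFine j (min_le_right i j) p = x := hp
      have hqy : toFine j (min_le_right i j) q = y := hq
      obtain ⟨χ, hχ, b, hb, hbq⟩ := ht3 p hpφ q (by
        rw [hpx, hqy, edist_comm]
        exact lt_of_le_of_lt hy hi2)
      obtain ⟨c, hcd, hc, hbc⟩ := S.Y.exists_subcell hm hmv hii hb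
      refine mem_iUnion₂.2 ⟨A χ c, hfin.mem_toFinset.2 (mem_iUnion₂.2
        ⟨χ, hχ, c, ⟨hcd.trans (ht2 χ hχ).2.1, hc⟩, rfl⟩), b, hbc, ?_⟩
      simp only [hbq, hqy]
    · exact (hdiam B (hfin.mem_toFinset.1 hB)).trans hi'.le
    · rw [hfin.encard_eq_coe_toFinset_card] at hUcard
      have hcard : hfin.toFinset.card ≤ starBound n Δ * N ^ l := by exact_mod_cast hUcard
      calc ∑ B ∈ hfin.toFinset, Metric.ediam B ^ homogeneousDim n m mv
          ≤ ∑ B ∈ hfin.toFinset, cellVolume n m mv (i + l) := by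
            refine Finset.sum_le_sum fun B hB => ?_
            rw [← size_rpow hm hmv]
            gcongr
            exact hdiam B (hfin.mem_toFinset.1 hB)
        _ = hfin.toFinset.card * cellVolume n m mv (i + l) := by simp
        _ ≤ (starBound n Δ * N ^ l : ℕ) * cellVolume n m mv (i + l) := by gcongr
        _ = starBound n Δ * cellVolume n m mv i := by
          rw [cellVolume_add hm hmv i l, ← hN]
          push_cast
          ring
        _ = (starBound n Δ * N : ℕ) * size m (i + 1) ^ homogeneousDim n m mv := by
          rw [size_rpow hm hmv, cellVolume_succ hm hmv i, ← hN]
          push_cast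
          ring
        _ ≤ _ := by
          rw [ENNReal.coe_natCast]
          gcongr
          exact Nat.le_add_left _ _

end System

/-! ### Enlarging the constants -/

section Mono

variable {X Y : Type*} [PseudoEMetricSpace X] [PseudoEMetricSpace Y] {C C' : ℝ≥0}

theorem IsDoublingMetricMeasureSpace.mono [MeasurableSpace X] {μ : Measure X}
    (h : IsDoublingMetricMeasureSpace X μ C) (hC : C ≤ C') : IsDoublingMetricMeasureSpace X μ C' :=
  { h with doubling := fun x r => (h.doubling x r).trans (by gcongr) }

theorem IsLipschitzLight.mono {f : X → Y} (h : IsLipschitzLight f C) (hC : C ≤ C') :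
    IsLipschitzLight f C' :=
  ⟨h.lipschitz.weaken hC, fun W hW x => (h.light W hW x).trans (by gcongr)⟩

theorem AssouadNagataLE.mono {F : Set X} {k : ℕ} (h : AssouadNagataLE F k C) (hC : C ≤ C') :
    AssouadNagataLE F k C' := fun r hr => by
  obtain ⟨U, h1, h2, h3, h4⟩ := h r hr
  exact ⟨U, h1, h2, fun A hA => (h3 A hA).trans (by gcongr), h4⟩

theorem IsAhlforsRegular.mono {Q : ℝ} (h : IsAhlforsRegular X Q C) (hC : C ≤ C') :
    IsAhlforsRegular X Q C' := by
  obtain ⟨h0, h⟩ := h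
  refine ⟨h0, fun x r hr hrd => ?_⟩
  obtain ⟨h1, h2⟩ := h x r hr hrd
  exact ⟨h1.trans (by gcongr), h2.trans (by gcongr)⟩

theorem IsDavidSemmesRegular.mono {f : X → Y} (h : IsDavidSemmesRegular f C) (hC : C ≤ C') :
    IsDavidSemmesRegular f C' := by
  refine ⟨h.lipschitz.weaken hC, fun y r hr => ?_⟩
  obtain ⟨t, h1, h2⟩ := h.cover y r hr
  refine ⟨t, h1.trans hC, h2.trans (iUnion₂_mono fun x _ => Metric.eball_subset_eball ?_)⟩
  gcongr

end Mono

end Admissible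

theorem theorem11p4 (n m H : ℕ) [NeZero n] (hn : 2 ≤ n) (hm : 2 ≤ m) :
    ∃ M : ℕ, ∀ mv : ℕ, M ≤ mv → m ≤ mv → ∀ Δ : ℕ, ∃ C : ℝ≥0,
      ∀ S : Admissible.System.{u} n m mv, S.IsAdmissible Δ H →
        (∀ p q : S.LimitSpace, edist p q ≠ ⊤) ∧
        ∀ j : ℤ,
          Admissible.IsDoublingMetricMeasureSpace (S.Fine j) (S.fineMeasure j) C ∧
          Admissible.IsLipschitzLight (S.proj j) C ∧
          (∀ p : S.LimitSpace, Admissible.AssouadNagataLE (S.proj j ⁻¹' {p}) 0 C) ∧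
          (S.InjectiveOnTopCells →
            Admissible.IsAhlforsRegular (S.Fine j)
              (1 + ((n : ℝ) - 1) * Real.log mv / Real.log m) C ∧
            Admissible.IsDavidSemmesRegular (S.proj j) C) := by
  -- the first summand makes nearby cells intersect, the second one keeps components small
  refine ⟨2 * (m + 1) * (H + 1) + 8 * (n + 2) * (H + 4) + 1, fun mv hM hmv Δ =>
    ⟨(Admissible.System.doublingConstant n m mv Δ + Admissible.System.lightConstant m +
      Admissible.System.ahlforsConstant n m mv Δ + Admissible.System.regularConstant n m Δ : ℕ),
      fun S hS => ⟨hS.edist_limitSpace_ne_top, fun j => ?_⟩⟩⟩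
  have hH : 2 * (m + 1) * (H + 1) < mv := by lia
  have hM' : 8 * (n + 2) * (H + 4) < mv := by lia
  exact ⟨(hS.isDoubling hm hmv hH j).mono (Nat.cast_le.2 (by lia)),
    (hS.isLipschitzLight hm hmv hH hM' j).mono (Nat.cast_le.2 (by lia)),
    fun p => (hS.assouadNagata hm hmv hH hM' j p).mono (Nat.cast_le.2 (by lia)),
    fun hI => ⟨(hS.isAhlforsRegular hm hmv hH hI j).mono (Nat.cast_le.2 (by lia)),
      (hS.isDavidSemmesRegular hm hmv hH hI j).mono (Nat.cast_le.2 (by lia))⟩⟩
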